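/- Let $M$ be a smooth four-dimensional Hausdorff manifold without boundary, with a smooth Lorentzian metric $g$ of signature $(-,+,+,+)$, and suppose that $(M,g)$ is time-orientable, i.e. that there is a continuous timelike vector field $T$ on $M$; fix such a $T$. A timelike or null tangent vector $v$ (null means $v\neq 0$ and $g(v,v)=0$) is future-pointing if $g(T,v)<0$. For $A,B\in M$: - a future-pointing timelike curve from $A$ to $B$ is a $C^1$ map $\gamma:[a,b]\to M$, $a<b$, with $\gamma(a)=A$ and $\gamma(b)=B$, whose velocity is timelike and future-pointing at every point of $[a,b]$; - a future-pointing null geodesic from $A$ to $B$ is an affinely parametrized geodesic $\gamma:[a,b]\to M$ of $g$, $a<b$, with $\gamma(a)=A$ and $\gamma(b)=B$, whose velocity is null and future-pointing at every point of $[a,b]$; - a lightlike path from $A$ to $B$ consists of points $A_0=A,A_1,\dots,A_n=B$ with $n\ge 1$ and, for each $1\le i\le n$, a future-pointing null geodesic from $A_{i-1}$ to $A_i$. Then, for all $A,B\in M$: (i) If there is a lightlike path from $A$ to $B$, then there is a future-pointing timelike curve from $A$ to $B$ or a future-pointing null geodesic from $A$ to $B$. (ii) If there is a future-pointing timelike curve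 from $A$ to $B$, then there is a lightlike path from $A$ to $B$. -/

import Mathlib

open Set Bundle
open scoped Manifold ContDiff

noncomputable section

/-- A smooth Lorentzian metric of signature `(-,+,+,+)` on a smooth four-dimensional manifold
without boundary. -/
structure LorentzMetric (M : Type*) [TopologicalSpace M]
    [ChartedSpace (EuclideanSpace ℝ (Fin 4)) M] [IsManifold (𝓡 4) ∞ M] where
  /-- The bilinear form on the tangent space at each event. -/
  form : ∀ p : M, TangentSpace (𝓡 4) p →L[ℝ] TangentSpace (𝓡 4) p →L[ℝ] ℝ
  symm : ∀ (p : M) (v w : TangentSpace (𝓡 4) p), form p v w = form p w v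
  /-- At each event there is an orthonormal frame, whose zeroth vector is timelike and whose
  other vectors are spacelike. -/
  signature : ∀ p : M, ∃ e : Module.Basis (Fin 4) ℝ (TangentSpace (𝓡 4) p),
    ∀ i j : Fin 4, form p (e i) (e j) = if i = j then (if i = 0 then -1 else 1) else 0
  smooth : ContMDiff (𝓡 4) ((𝓡 4).prod
      𝓘(ℝ, EuclideanSpace ℝ (Fin 4) →L[ℝ] EuclideanSpace ℝ (Fin 4) →L[ℝ] ℝ)) ∞
    (fun p ↦ TotalSpace.mk' (EuclideanSpace ℝ (Fin 4) →L[ℝ] EuclideanSpace ℝ (Fin 4) →L[ℝ] ℝ)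
      (E := fun p : M ↦ TangentSpace (𝓡 4) p →L[ℝ] TangentSpace (𝓡 4) p →L[ℝ] ℝ) p (form p))

/-- A time orientation: a continuous timelike vector field, which designates the future
half of each light cone. -/
structure TimeOrientation {M : Type*} [TopologicalSpace M]
    [ChartedSpace (EuclideanSpace ℝ (Fin 4)) M] [IsManifold (𝓡 4) ∞ M]
    (g : LorentzMetric M) where
  /-- The timelike vector field. -/
  field : ∀ p : M, TangentSpace (𝓡 4) p
  continuous_field : Continuous (fun p ↦ (⟨p, field p⟩ : TangentBundle (𝓡 4) M))
  timelike_field : ∀ p : M, g.form p (field p) (field p) < 0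

section Curves

variable {M : Type*} [TopologicalSpace M] [ChartedSpace (EuclideanSpace ℝ (Fin 4)) M]
  [IsManifold (𝓡 4) ∞ M]

/-- The velocity at parameter value `t` of a curve defined on the interval `[a, b]`
(one-sided at the end points). -/
def curveVelocity (γ : ℝ → M) (a b t : ℝ) : TangentSpace (𝓡 4) (γ t) :=
  mfderivWithin 𝓘(ℝ, ℝ) (𝓡 4) γ (Icc a b) t (1 : ℝ)

namespace LorentzMetric

variable (g : LorentzMetric M)

/-- A timelike vector. -/
def IsTimelike {p : M} (v : TangentSpace (𝓡 4) p) : Prop := g.form p v v < 0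

/-- A null vector (the zero vector is not null). -/
def IsNull {p : M} (v : TangentSpace (𝓡 4) p) : Prop := v ≠ 0 ∧ g.form p v v = 0

/-- The component function `y ↦ g(v, w)` of the metric in the coordinates given by the preferred
chart at `x₀`, for two constant coordinate vectors `v`, `w`. -/
def chartForm (x₀ : M) (v w : EuclideanSpace ℝ (Fin 4)) (y : EuclideanSpace ℝ (Fin 4)) : ℝ :=
  g.form ((extChartAt (𝓡 4) x₀).symm y)
    (mfderiv (𝓡 4) (𝓡 4) (extChartAt (𝓡 4) x₀).symm y v)
    (mfderiv (𝓡 4) (𝓡 4) (extChartAt (𝓡 4) x₀).symm y w)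

/-- The Christoffel symbols of the first kind,
`Γ(u, v; w) = (∂ᵤ g(v, w) + ∂ᵥ g(u, w) - ∂_w g(u, v)) / 2`,
at the point `y` of the preferred chart at `x₀`. -/
def christoffel (x₀ : M) (y u v w : EuclideanSpace ℝ (Fin 4)) : ℝ :=
  (fderiv ℝ (g.chartForm x₀ v w) y u + fderiv ℝ (g.chartForm x₀ u w) y v
    - fderiv ℝ (g.chartForm x₀ u v) y w) / 2

/-- A curve on `[a, b]` is an (affinely parametrized) geodesic if it is `C²` and satisfies, in every
chart of the atlas, the geodesic equation `x'' + Γ(x', x') = 0`. The index is lowered here by pairing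
the equation with an arbitrary vector `w`; the metric is nondegenerate, so nothing is lost. -/
def IsGeodesicOn (γ : ℝ → M) (a b : ℝ) : Prop :=
  ContMDiffOn 𝓘(ℝ, ℝ) (𝓡 4) 2 γ (Icc a b) ∧
  ∀ (x₀ : M) (t : ℝ), t ∈ Icc a b → γ t ∈ (extChartAt (𝓡 4) x₀).source →
    let x : ℝ → EuclideanSpace ℝ (Fin 4) := fun s ↦ extChartAt (𝓡 4) x₀ (γ s)
    let x' : ℝ → EuclideanSpace ℝ (Fin 4) := derivWithin x (Icc a b)
    let x'' : ℝ → EuclideanSpace ℝ (Fin 4) := derivWithin x' (Icc a b)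
    ∀ w : EuclideanSpace ℝ (Fin 4),
      g.chartForm x₀ (x'' t) w (x t) + g.christoffel x₀ (x t) (x' t) (x' t) w = 0

end LorentzMetric

namespace TimeOrientation

variable {g : LorentzMetric M} (T : TimeOrientation g)

/-- A timelike or null vector is future-pointing if it lies in the same half of the light cone
as the chosen timelike field. -/
def IsFuturePointing {p : M} (v : TangentSpace (𝓡 4) p) : Prop := g.form p (T.field p) v < 0

/-- There is a future-pointing timelike curve from `A` to `B`. -/
def ExistsTimelikeCurve (A B : M) : Prop :=
  ∃ (γ : ℝ → M) (a b : ℝ), a < b ∧ γ a = A ∧ γ b = B ∧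
    ContMDiffOn 𝓘(ℝ, ℝ) (𝓡 4) 1 γ (Icc a b) ∧
    ∀ t ∈ Icc a b, g.IsTimelike (curveVelocity γ a b t) ∧
      T.IsFuturePointing (curveVelocity γ a b t)

/-- There is a future-pointing null geodesic from `A` to `B`. -/
def ExistsNullGeodesic (A B : M) : Prop :=
  ∃ (γ : ℝ → M) (a b : ℝ), a < b ∧ γ a = A ∧ γ b = B ∧
    g.IsGeodesicOn γ a b ∧
    ∀ t ∈ Icc a b, g.IsNull (curveVelocity γ a b t) ∧
      T.IsFuturePointing (curveVelocity γ a b t)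

/-- There is a lightlike path from `A` to `B`: finitely many (at least one) future-pointing null
geodesic segments laid end to end, the first starting at `A` and the last ending at `B`. -/
def ExistsLightlikePath (A B : M) : Prop :=
  ∃ (n : ℕ) (P : ℕ → M), 0 < n ∧ P 0 = A ∧ P n = B ∧
    ∀ i < n, T.ExistsNullGeodesic (P i) (P (i + 1))

end TimeOrientation

end Curves

end

/-!
Both halves rest on local statements about short segments in a chart, continued along a curve by
`interval_propagation`. There the metric is a smooth field of Lorentzian forms (`IsLorentz`,
`LorentzMetric.inChart`); the future timelike vectors form an open set (`isOpen_futureCone`), convex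
over each point (`futureCone_segment`).

**From lightlike paths to timelike curves or null geodesics.** Timelike curves laid end to end can
be rounded to a `C¹` timelike curve, because the velocities at the corner span a segment inside the
cone (`ExistsTimelikeCurve.trans`); hence the chronological future and past of a point are open.
A timelike curve followed or preceded by a null curve can be replaced by a timelike one
(`ExistsTimelikeCurve.trans_null`, `ExistsTimelikeCurve.null_trans`): pushing a short piece of the
null curve along the time orientation, by an amount that is proportional to `ε` and vanishes at one
end, makes it timelike, and openness absorbs the displacement of the other end.
Let two null geodesics meet, with velocities `u` and `v` at the joint. Either `g(u, v) < 0`; then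
`u + v` is timelike, the chord that cuts off the corner is timelike, and it absorbs what remains of
the two geodesics (`existsTimelikeCurve_of_corner`). Or `u` and `v` are proportional; then, after an
affine change of parameter, the velocities agree, the second derivatives agree by the geodesic
equation, and the union is a single null geodesic (`existsNullGeodesic_glue`). Induction on the
number of geodesics concludes.

**From timelike curves to lightlike paths.** A future timelike vector `v` at `y` is the sum of two
future null vectors `k₁`, `k₂` with `g(k₁, k₂) ≠ 0` (`IsLorentz.exists_null_add_null`). The
displacement of the null geodesic from `y` with initial velocity `w` during time `h` is
`h Q(h, y, w)` with `Q(0, y, w) = w`, and `Q` is strictly differentiable at `h = 0` (`exists_average_flow`,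
`exists_null_step`). Consider two consecutive geodesic steps with initial velocities `w₁`, `w₂`. The
map which sends `(h, y, w₁, w₂)` to `(h, y)`, the total displacement divided by `h`, and the squares
of `w₁` and `w₂`, has surjective derivative at `(0, y, k₁, k₂)`, because `g(k₁, k₂) ≠ 0`, and
therefore is open there. So all short segments with direction near `v` join the ends of two
consecutive null geodesics (`eventually_existsLightlikePath_segment`). The chords of a timelike curve
are such segments.

Integral curves of the geodesic spray are constructed in one chart; that they are geodesics in all
charts is the covariance of the geodesic equation (`geodesicEquationAt_coordChange`).
-/

noncomputable section

open Filter Topology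

/-! ### Lorentzian bilinear forms -/

/-- A symmetric bilinear form of Lorentzian type, with the signature expressed without a frame:
there is a vector of negative square, and the form is positive definite on the orthogonal
complement of each such vector. -/
structure IsLorentz {V : Type*} [NormedAddCommGroup V] [NormedSpace ℝ V]
    (B : V →L[ℝ] V →L[ℝ] ℝ) : Prop where
  symm : ∀ v w, B v w = B w v
  exists_timelike : ∃ t, B t t < 0
  pos_of_orthogonal : ∀ t x, B t t < 0 → B t x = 0 → x ≠ 0 → 0 < B x x

namespace IsLorentz

variable {V : Type*} [NormedAddCommGroup V] [NormedSpace ℝ V] {B : V →L[ℝ] V →L[ℝ] ℝ}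

theorem of_basis (hsymm : ∀ v w, B v w = B w v) (e : Module.Basis (Fin 4) ℝ V)
    (he : ∀ i j : Fin 4, B (e i) (e j) = if i = j then (if i = 0 then -1 else 1) else 0) :
    IsLorentz B := by
  have key : ∀ v w, B v w = - (e.repr v 0 * e.repr w 0) + e.repr v 1 * e.repr w 1
      + e.repr v 2 * e.repr w 2 + e.repr v 3 * e.repr w 3 := by
    intro v w
    have hv := e.sum_repr v
    have hw := e.sum_repr w
    rw [Fin.sum_univ_four] at hv hw
    conv_lhs => rw [← hv, ← hw]
    simp [he]
  refine ⟨hsymm, ⟨e 0, by rw [he]; norm_num⟩, fun t x ht hx hx0 ↦ ?_⟩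
  rw [key] at ht hx ⊢
  have hne : e.repr x 0 ≠ 0 ∨ e.repr x 1 ≠ 0 ∨ e.repr x 2 ≠ 0 ∨ e.repr x 3 ≠ 0 := by
    by_contra! h
    exact hx0 (e.ext_elem fun i ↦ by fin_cases i <;> simp [h])
  generalize e.repr x 0 = x0 at *
  generalize e.repr x 1 = x1 at *
  generalize e.repr x 2 = x2 at *
  generalize e.repr x 3 = x3 at *
  generalize e.repr t 0 = t0 at *
  generalize e.repr t 1 = t1 at *
  generalize e.repr t 2 = t2 at *
  generalize e.repr t 3 = t3 at *
  have ht0 : 0 < t0 ^ 2 := by nlinarith [sq_nonneg t1, sq_nonneg t2, sq_nonneg t3]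
  have hS : 0 < x1 ^ 2 + x2 ^ 2 + x3 ^ 2 := by
    by_contra! h
    have h1 : x1 = 0 := by nlinarith [sq_nonneg x1, sq_nonneg x2, sq_nonneg x3]
    have h2 : x2 = 0 := by nlinarith [sq_nonneg x1, sq_nonneg x2, sq_nonneg x3]
    have h3 : x3 = 0 := by nlinarith [sq_nonneg x1, sq_nonneg x2, sq_nonneg x3]
    subst h1 h2 h3
    have : t0 * x0 = 0 := by linarith
    rcases mul_eq_zero.1 this with h0 | h0
    · simp [h0] at ht0
    · simp [h0] at hne
  have hcs : (t0 * x0) ^ 2 ≤ (t1 ^ 2 + t2 ^ 2 + t3 ^ 2) * (x1 ^ 2 + x2 ^ 2 + x3 ^ 2) := by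
    have : t0 * x0 = t1 * x1 + t2 * x2 + t3 * x3 := by linarith
    rw [this]
    nlinarith [sq_nonneg (t1 * x2 - t2 * x1), sq_nonneg (t1 * x3 - t3 * x1),
      sq_nonneg (t2 * x3 - t3 * x2)]
  have hlt : t0 ^ 2 * x0 ^ 2 < t0 ^ 2 * (x1 ^ 2 + x2 ^ 2 + x3 ^ 2) := by
    calc t0 ^ 2 * x0 ^ 2 = (t0 * x0) ^ 2 := by ring
      _ ≤ _ := hcs
      _ < _ := by apply mul_lt_mul_of_pos_right _ hS; linarith
  have := lt_of_mul_lt_mul_left hlt ht0.le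
  linarith

variable (hB : IsLorentz B)
include hB

/-- Two vectors `u`, `v` in the half space `B t < 0` have a combination orthogonal to `t`;
positivity there bounds the product `B u v`. -/
theorem combination_nonneg {t u v : V} (ht : B t t < 0) :
    2 * (B t u * B t v) * B u v ≤ (B t v) ^ 2 * B u u + (B t u) ^ 2 * B v v ∧
    (B t v • u ≠ B t u • v →
      2 * (B t u * B t v) * B u v < (B t v) ^ 2 * B u u + (B t u) ^ 2 * B v v) := by
  set w := B t v • u - B t u • v with hw
  have horth : B t w = 0 := by simp [hw]; ring
  have hexp : B w w = (B t v) ^ 2 * B u u + (B t u) ^ 2 * B v v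
      - 2 * (B t u * B t v) * B u v := by
    simp [hw, hB.symm v u]; ring
  have hpos := hB.pos_of_orthogonal t w ht horth
  constructor
  · by_cases h0 : w = 0
    · have : B w w = 0 := by rw [h0]; simp
      linarith
    · linarith [hpos h0]
  · intro hne
    linarith [hpos (sub_ne_zero.2 hne)]

theorem neg_of_causal_of_timelike {t u v : V} (ht : B t t < 0) (hu : B u u ≤ 0) (hv : B v v < 0)
    (htu : B t u < 0) (htv : B t v < 0) : B u v < 0 := by
  have h := (hB.combination_nonneg (u := u) (v := v) ht).1
  have h1 : 0 < B t u * B t v := mul_pos_of_neg_of_neg htu htv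
  have h2 : 0 < (B t u) ^ 2 := sq_pos_of_neg htu
  by_contra! hc
  nlinarith [mul_nonneg h1.le hc, mul_pos h2 (neg_pos.2 hv),
    mul_nonneg (sq_nonneg (B t v)) (neg_nonneg.2 hu)]

/-- Two null vectors in the same half of the light cone are either positively proportional or
have negative product. -/
theorem null_dichotomy {t u v : V} (ht : B t t < 0) (hu : B u u = 0) (hv : B v v = 0)
    (htu : B t u < 0) (htv : B t v < 0) : B u v < 0 ∨ ∃ c : ℝ, 0 < c ∧ u = c • v := by
  by_cases h : B t v • u = B t u • v
  · right
    refine ⟨B t u / B t v, div_pos_of_neg_of_neg htu htv, ?_⟩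
    rw [div_eq_inv_mul, mul_smul, ← h, smul_smul, inv_mul_cancel₀ htv.ne, one_smul]
  · left
    have h := (hB.combination_nonneg (u := u) (v := v) ht).2 h
    rw [hu, hv] at h
    have h1 : 0 < B t u * B t v := mul_pos_of_neg_of_neg htu htv
    by_contra! hc
    nlinarith [mul_nonneg h1.le hc]

theorem eq_zero_of_forall {v : V} (hv : ∀ w, B v w = 0) : v = 0 := by
  obtain ⟨t, ht⟩ := hB.exists_timelike
  by_contra h0
  exact (hB.pos_of_orthogonal t v ht (by rw [hB.symm, hv]) h0).ne' (hv v)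

/-- A Lorentzian form on a finite-dimensional space is nondegenerate: it identifies the space
with its dual. -/
theorem isInvertible [FiniteDimensional ℝ V] : B.IsInvertible := by
  have hinj : Function.Injective (B : V →ₗ[ℝ] (V →L[ℝ] ℝ)) := by
    rw [← LinearMap.ker_eq_bot, LinearMap.ker_eq_bot']
    exact fun v hv ↦ hB.eq_zero_of_forall fun w ↦ by
      have := DFunLike.congr_fun hv w
      simpa using this
  have hdim : Module.finrank ℝ V = Module.finrank ℝ (V →L[ℝ] ℝ) := by
    rw [← LinearEquiv.finrank_eq (LinearMap.toContinuousLinearMap (E := V) (F' := ℝ) (𝕜 := ℝ))]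
    exact (Subspace.dual_finrank_eq (K := ℝ) (V := V)).symm
  refine ⟨(LinearEquiv.ofInjectiveOfFinrankEq (B : V →ₗ[ℝ] (V →L[ℝ] ℝ)) hinj
    hdim).toContinuousLinearEquiv, ?_⟩
  ext v w
  rfl

/-- A future timelike vector is the sum of two future null vectors, which span a timelike plane. -/
theorem exists_null_add_null [FiniteDimensional ℝ V] (hdim : 1 < Module.finrank ℝ V) {t v : V}
    (ht : B t t < 0) (hv : B v v < 0) (htv : B t v < 0) :
    ∃ k l : V, k + l = v ∧ B k k = 0 ∧ B l l = 0 ∧ B t k < 0 ∧ B t l < 0 ∧ B k l < 0 := by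
  obtain ⟨e, he, he0⟩ : ∃ e : V, B v e = 0 ∧ e ≠ 0 := by
    by_contra! h
    have hinj : Function.Injective ((B v : V →L[ℝ] ℝ) : V →ₗ[ℝ] ℝ) := by
      rw [← LinearMap.ker_eq_bot, LinearMap.ker_eq_bot']
      exact h
    have := LinearMap.finrank_le_finrank_of_injective hinj
    rw [Module.finrank_self] at this
    omega
  have hee := hB.pos_of_orthogonal v e hv he he0
  -- The two null vectors are `(v ± r e) / 2`, where `e` is orthogonal to `v`.
  set r := Real.sqrt (- B v v / B e e) with hr
  have hr2 : r ^ 2 * B e e = - B v v := by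
    rw [hr, Real.sq_sqrt (div_nonneg (by linarith) hee.le)]
    field_simp
  have hev : B e v = 0 := by rw [hB.symm, he]
  have hvt : B v t < 0 := by rw [hB.symm]; exact htv
  have hnull : ∀ s : ℝ, s ^ 2 = r ^ 2 →
      B ((1 / 2 : ℝ) • (v + s • e)) ((1 / 2 : ℝ) • (v + s • e)) = 0 := by
    intro s hs
    rw [← hs] at hr2
    simp [he, hev]
    linarith
  have hfut : ∀ s : ℝ, s ^ 2 = r ^ 2 → B t ((1 / 2 : ℝ) • (v + s • e)) < 0 := by
    intro s hs
    rw [hB.symm]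
    refine hB.neg_of_causal_of_timelike hv (hnull s hs).le ht ?_ hvt
    have : B v ((1 / 2 : ℝ) • (v + s • e)) = B v v / 2 := by simp [he]; ring
    linarith
  refine ⟨(1 / 2 : ℝ) • (v + r • e), (1 / 2 : ℝ) • (v + (-r) • e), ?_, hnull r rfl,
    hnull (-r) (by ring), hfut r rfl, hfut (-r) (by ring), ?_⟩
  · module
  · simp [he, hev]
    linarith

end IsLorentz

/-! ### Induction along an interval -/

/-- A property that propagates to the right near every point of a compact interval propagates from
its left end to its right end. -/
theorem interval_propagation {a b : ℝ} (hab : a ≤ b) {Q : ℝ → Prop}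
    (h : ∀ t₀ ∈ Icc a b, ∀ᶠ p : ℝ × ℝ in 𝓝 (t₀, t₀), p.1 ∈ Icc a b → p.2 ∈ Icc a b →
      p.1 ≤ p.2 → Q p.1 → Q p.2) (ha : Q a) : Q b := by
  have hε : ∀ t₀ ∈ Icc a b, ∃ ε > 0, ∀ s ∈ Icc a b, ∀ t ∈ Icc a b, |s - t₀| < ε → |t - t₀| < ε →
      s ≤ t → Q s → Q t := by
    intro t₀ ht₀
    obtain ⟨ε, hε, h'⟩ := Metric.eventually_nhds_iff.1 (h t₀ ht₀)
    refine ⟨ε, hε, fun s hs t ht hs' ht' ↦ h' (y := (s, t)) ?_ hs ht⟩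
    rw [Prod.dist_eq]
    exact max_lt hs' ht'
  set S := {t | t ∈ Icc a b ∧ Q t} with hS
  have hSne : S.Nonempty := ⟨a, left_mem_Icc.2 hab, ha⟩
  have hSb : BddAbove S := ⟨b, fun t ht ↦ ht.1.2⟩
  set c := sSup S with hc
  have hcm : c ∈ Icc a b :=
    ⟨le_csSup hSb ⟨left_mem_Icc.2 hab, ha⟩, csSup_le hSne fun t ht ↦ ht.1.2⟩
  obtain ⟨ε, hεpos, hprop⟩ := hε c hcm
  obtain ⟨s, hsS, hs⟩ := exists_lt_of_lt_csSup hSne (show c - ε < c by linarith)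
  have hsc : s ≤ c := le_csSup hSb hsS
  have hstep : ∀ t ∈ Icc a b, c ≤ t → t < c + ε → Q t := fun t ht hct hlt ↦
    hprop s hsS.1 t ht (by rw [abs_lt]; constructor <;> linarith)
      (by rw [abs_lt]; constructor <;> linarith) (hsc.trans hct) hsS.2
  rcases hcm.2.eq_or_lt with hcb | hcb
  · exact hcb ▸ hstep c hcm le_rfl (by linarith)
  · exfalso
    have hm : min b (c + ε / 2) ∈ Icc a b :=
      ⟨le_min hab (by linarith [hcm.1]), min_le_left _ _⟩
    have hlt : c < min b (c + ε / 2) := lt_min hcb (by linarith)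
    exact absurd (le_csSup hSb ⟨hm, hstep _ hm hlt.le
      (lt_of_le_of_lt (min_le_right _ _) (by linarith))⟩) (not_le.2 hlt)

/-! ### Gluing and rounding of curves in a vector space -/

section Glue

variable {E : Type*} [NormedAddCommGroup E] [NormedSpace ℝ E]

/-- The concatenation at parameter `c` of two curves. -/
def glue {X : Type*} (c : ℝ) (f g : ℝ → X) (t : ℝ) : X := if t ≤ c then f t else g t

theorem glue_of_le {X : Type*} {c : ℝ} {f g : ℝ → X} {t : ℝ} (h : t ≤ c) : glue c f g t = f t :=
  if_pos h

theorem glue_of_ge {X : Type*} {c : ℝ} {f g : ℝ → X} {t : ℝ} (h0 : f c = g c) (h : c ≤ t) :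
    glue c f g t = g t := by
  rcases h.eq_or_lt with rfl | h
  · rw [glue_of_le le_rfl, h0]
  · exact if_neg (not_le.2 h)

theorem glue_eventuallyEq_left {X : Type*} {c : ℝ} {f g : ℝ → X} {t : ℝ} (h : t < c) :
    glue c f g =ᶠ[𝓝 t] f := by
  filter_upwards [Iio_mem_nhds h] with s hs using glue_of_le (le_of_lt hs)

theorem glue_eventuallyEq_right {X : Type*} {c : ℝ} {f g : ℝ → X} {t : ℝ} (h : c < t) :
    glue c f g =ᶠ[𝓝 t] g := by
  filter_upwards [Ioi_mem_nhds h] with s hs using if_neg (not_le.2 hs)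

theorem eventually_nhds_of_sides {P : ℝ → Prop} {c : ℝ} (h0 : P c)
    (hl : ∀ᶠ t in 𝓝[≤] c, t < c → P t) (hr : ∀ᶠ t in 𝓝[≥] c, c < t → P t) : ∀ᶠ t in 𝓝 c, P t := by
  rw [← nhdsLE_sup_nhdsGE, eventually_sup]
  constructor
  · filter_upwards [hl, self_mem_nhdsWithin] with t ht htc
    rcases (mem_Iic.1 htc).eq_or_lt with rfl | h
    exacts [h0, ht h]
  · filter_upwards [hr, self_mem_nhdsWithin] with t ht htc
    rcases (mem_Ici.1 htc).eq_or_lt with rfl | h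
    exacts [h0, ht h]

theorem ContDiffWithinAt.derivWithin_right {f : ℝ → E} {s : Set ℝ} {t : ℝ} {m n : WithTop ℕ∞}
    (hf : ContDiffWithinAt ℝ n f s t) (hs : UniqueDiffOn ℝ s) (hmn : m + 1 ≤ n) (ht : t ∈ s) :
    ContDiffWithinAt ℝ m (derivWithin f s) s t := by
  have h := (hf.fderivWithin_right hs hmn ht).clm_apply
    (contDiffWithinAt_const (c := (1 : ℝ)) (s := s) (x := t))
  exact h

theorem eventually_continuousAt_glue {f g : ℝ → E} {c : ℝ}
    (hf : ContDiffWithinAt ℝ 0 f (Iic c) c) (hg : ContDiffWithinAt ℝ 0 g (Ici c) c)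
    (h0 : f c = g c) : ∀ᶠ t in 𝓝 c, ContinuousAt (glue c f g) t := by
  have hfe := hf.eventually (by simp)
  have hge := hg.eventually (by simp)
  rw [insert_eq_of_mem self_mem_Iic] at hfe
  rw [insert_eq_of_mem self_mem_Ici] at hge
  refine eventually_nhds_of_sides ?_ ?_ ?_
  · have h1 : ContinuousWithinAt (glue c f g) (Iic c) c :=
      hf.continuousWithinAt.congr (fun t ht ↦ glue_of_le ht) (glue_of_le le_rfl)
    have h2 : ContinuousWithinAt (glue c f g) (Ici c) c :=
      hg.continuousWithinAt.congr (fun t ht ↦ glue_of_ge h0 ht) (glue_of_ge h0 le_rfl)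
    have := h1.union h2
    rwa [Iic_union_Ici, continuousWithinAt_univ] at this
  · filter_upwards [hfe] with t ht htc
    exact (ht.continuousWithinAt.continuousAt (Iic_mem_nhds htc)).congr
      (glue_eventuallyEq_left htc).symm
  · filter_upwards [hge] with t ht htc
    exact (ht.continuousWithinAt.continuousAt (Ici_mem_nhds htc)).congr
      (glue_eventuallyEq_right htc).symm

theorem eventually_hasDerivAt_glue {f g : ℝ → E} {c : ℝ}
    (hf : ContDiffWithinAt ℝ 1 f (Iic c) c) (hg : ContDiffWithinAt ℝ 1 g (Ici c) c)
    (h0 : f c = g c) (h1 : derivWithin f (Iic c) c = derivWithin g (Ici c) c) :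
    ∀ᶠ t in 𝓝 c, HasDerivAt (glue c f g)
      (glue c (derivWithin f (Iic c)) (derivWithin g (Ici c)) t) t := by
  have hfe := hf.eventually (by simp)
  have hge := hg.eventually (by simp)
  rw [insert_eq_of_mem self_mem_Iic] at hfe
  rw [insert_eq_of_mem self_mem_Ici] at hge
  refine eventually_nhds_of_sides ?_ ?_ ?_
  · have h1 : HasDerivWithinAt (glue c f g)
        (glue c (derivWithin f (Iic c)) (derivWithin g (Ici c)) c) (Iic c) c := by
      rw [glue_of_le le_rfl]
      exact (hf.differentiableWithinAt one_ne_zero).hasDerivWithinAt.congr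
        (fun t ht ↦ glue_of_le ht) (glue_of_le le_rfl)
    have h2 : HasDerivWithinAt (glue c f g)
        (glue c (derivWithin f (Iic c)) (derivWithin g (Ici c)) c) (Ici c) c := by
      rw [glue_of_le le_rfl, ‹derivWithin f (Iic c) c = _›]
      exact (hg.differentiableWithinAt one_ne_zero).hasDerivWithinAt.congr
        (fun t ht ↦ glue_of_ge h0 ht) (glue_of_ge h0 le_rfl)
    have := h1.union h2
    rwa [Iic_union_Ici, hasDerivWithinAt_univ] at this
  · filter_upwards [hfe] with t ht htc
    rw [glue_of_le htc.le]
    exact ((ht.differentiableWithinAt one_ne_zero).hasDerivWithinAt.hasDerivAt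
      (Iic_mem_nhds htc)).congr_of_eventuallyEq (glue_eventuallyEq_left htc)
  · filter_upwards [hge] with t ht htc
    rw [glue_of_ge h1 htc.le]
    exact ((ht.differentiableWithinAt one_ne_zero).hasDerivWithinAt.hasDerivAt
      (Ici_mem_nhds htc)).congr_of_eventuallyEq (glue_eventuallyEq_right htc)

theorem contDiffAt_succ_of_hasDerivAt {f f' : ℝ → E} {c : ℝ} {n : ℕ}
    (h : ∀ᶠ t in 𝓝 c, HasDerivAt f (f' t) t) (h' : ContDiffAt ℝ n f' c) :
    ContDiffAt ℝ (n + 1) f c := by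
  rw [contDiffAt_succ_iff_hasFDerivAt]
  refine ⟨fun t ↦ ContinuousLinearMap.toSpanSingleton ℝ (f' t), ⟨_, h, fun t ht ↦ ?_⟩, ?_⟩
  · exact HasDerivAt.hasFDerivAt ht
  · exact ((ContinuousLinearMap.toSpanSingletonCLE
      (𝕜 := ℝ)).toContinuousLinearMap.contDiff).contDiffAt.comp c h'

theorem contDiffAt_one_glue {f g : ℝ → E} {c : ℝ}
    (hf : ContDiffWithinAt ℝ 1 f (Iic c) c) (hg : ContDiffWithinAt ℝ 1 g (Ici c) c)
    (h0 : f c = g c) (h1 : derivWithin f (Iic c) c = derivWithin g (Ici c) c) :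
    ContDiffAt ℝ 1 (glue c f g) c := by
  have := contDiffAt_succ_of_hasDerivAt (n := 0) (eventually_hasDerivAt_glue hf hg h0 h1) ?_
  · simpa using this
  · have h := eventually_continuousAt_glue
      (hf.derivWithin_right (m := 0) (uniqueDiffOn_Iic c) (by simp) self_mem_Iic)
      (hg.derivWithin_right (m := 0) (uniqueDiffOn_Ici c) (by simp) self_mem_Ici) h1
    exact contDiffAt_zero.2 ⟨_, h, fun t ht ↦ ContinuousAt.continuousWithinAt ht⟩

theorem contDiffAt_two_glue {f g : ℝ → E} {c : ℝ}
    (hf : ContDiffWithinAt ℝ 2 f (Iic c) c) (hg : ContDiffWithinAt ℝ 2 g (Ici c) c)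
    (h0 : f c = g c) (h1 : derivWithin f (Iic c) c = derivWithin g (Ici c) c)
    (h2 : derivWithin (derivWithin f (Iic c)) (Iic c) c
      = derivWithin (derivWithin g (Ici c)) (Ici c) c) :
    ContDiffAt ℝ 2 (glue c f g) c := by
  have h12 : (1 : WithTop ℕ∞) + 1 ≤ 2 := by norm_num
  have := contDiffAt_succ_of_hasDerivAt (n := 1) (eventually_hasDerivAt_glue
    (hf.of_le one_le_two) (hg.of_le one_le_two) h0 h1) ?_
  · exact_mod_cast this
  · exact_mod_cast contDiffAt_one_glue
      (hf.derivWithin_right (uniqueDiffOn_Iic c) h12 self_mem_Iic)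
      (hg.derivWithin_right (uniqueDiffOn_Ici c) h12 self_mem_Ici) h1 h2

/-- A `C¹` approximation of the function `t ↦ max t 0`, which agrees with it outside `(-δ, δ)`. -/
def smoothRamp (δ t : ℝ) : ℝ := (max (t + δ) 0 ^ 2 - max (t - δ) 0 ^ 2) / (4 * δ)

/-- The derivative of `smoothRamp`, with values in `[0, 1]`. -/
def smoothStep (δ t : ℝ) : ℝ := (max (t + δ) 0 - max (t - δ) 0) / (2 * δ)

theorem hasDerivAt_max_zero_sq (t : ℝ) : HasDerivAt (fun s : ℝ ↦ max s 0 ^ 2) (2 * max t 0) t := by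
  rcases lt_trichotomy t 0 with h | rfl | h
  · rw [max_eq_right h.le, mul_zero]
    refine (hasDerivAt_const t (0 : ℝ)).congr_of_eventuallyEq ?_
    filter_upwards [Iio_mem_nhds h] with s hs
    rw [max_eq_right (le_of_lt hs)]; norm_num
  · have h1 : HasDerivWithinAt (fun s : ℝ ↦ max s 0 ^ 2) 0 (Iic 0) 0 :=
      (hasDerivWithinAt_const (0 : ℝ) (Iic 0) (0 : ℝ)).congr
        (fun s hs ↦ by rw [max_eq_right hs]; norm_num) (by norm_num)
    have h2 : HasDerivWithinAt (fun s : ℝ ↦ max s 0 ^ 2) 0 (Ici 0) 0 := by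
      have : HasDerivWithinAt (fun s : ℝ ↦ s ^ 2) 0 (Ici 0) 0 := by
        simpa using (hasDerivAt_pow 2 (0 : ℝ)).hasDerivWithinAt
      exact this.congr (fun s hs ↦ by rw [max_eq_left hs]) (by norm_num)
    have := h1.union h2
    rw [Iic_union_Ici, hasDerivWithinAt_univ] at this
    simpa using this
  · rw [max_eq_left h.le]
    have : HasDerivAt (fun s : ℝ ↦ s ^ 2) (2 * t) t := by simpa using hasDerivAt_pow 2 t
    refine this.congr_of_eventuallyEq ?_
    filter_upwards [Ioi_mem_nhds h] with s hs
    rw [max_eq_left (le_of_lt hs)]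

theorem hasDerivAt_smoothRamp {δ : ℝ} (hδ : 0 < δ) (t : ℝ) :
    HasDerivAt (smoothRamp δ) (smoothStep δ t) t := by
  have h1 := (hasDerivAt_max_zero_sq (t + δ)).comp_add_const t δ
  have h2 := (hasDerivAt_max_zero_sq (t - δ)).comp_sub_const t δ
  refine ((h1.sub h2).div_const (4 * δ)).congr_deriv ?_
  unfold smoothStep
  field_simp
  ring

theorem smoothStep_mem {δ : ℝ} (hδ : 0 < δ) (t : ℝ) : smoothStep δ t ∈ Icc (0 : ℝ) 1 := by
  unfold smoothStep
  constructor
  · have := max_le_max_right (0 : ℝ) (show t - δ ≤ t + δ by linarith)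
    exact div_nonneg (by linarith) (by linarith)
  · rw [div_le_one (by linarith)]
    rcases le_total (t - δ) 0 with h | h <;> rcases le_total (t + δ) 0 with h' | h' <;>
      simp only [max_eq_left, max_eq_right, h, h'] <;> linarith

theorem smoothRamp_of_le {δ t : ℝ} (hδ : 0 < δ) (h : t ≤ -δ) : smoothRamp δ t = 0 := by
  unfold smoothRamp
  rw [max_eq_right (by linarith), max_eq_right (by linarith)]
  simp

theorem smoothRamp_of_ge {δ t : ℝ} (hδ : 0 < δ) (h : δ ≤ t) : smoothRamp δ t = t := by
  unfold smoothRamp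
  rw [max_eq_left (by linarith), max_eq_left (by linarith)]
  field_simp
  ring

theorem abs_smoothRamp_le {δ : ℝ} (hδ : 0 < δ) (t : ℝ) : |smoothRamp δ t| ≤ |t| + δ := by
  rcases le_total t (-δ) with h | h
  · rw [smoothRamp_of_le hδ h, abs_zero]; positivity
  rcases le_total δ t with h' | h'
  · rw [smoothRamp_of_ge hδ h']; linarith
  · unfold smoothRamp
    rw [max_eq_left (by linarith), max_eq_right (by linarith)]
    have h2 : (t + δ) ^ 2 ≤ 4 * δ * δ := by nlinarith
    rw [abs_of_nonneg (div_nonneg (by nlinarith [sq_nonneg (t + δ)]) (by linarith)),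
      div_le_iff₀ (by linarith)]
    nlinarith [mul_nonneg (abs_nonneg t) hδ.le]

theorem contDiff_smoothRamp {δ : ℝ} (hδ : 0 < δ) : ContDiff ℝ 1 (smoothRamp δ) := by
  rw [contDiff_one_iff_deriv]
  refine ⟨fun t ↦ (hasDerivAt_smoothRamp hδ t).differentiableAt, ?_⟩
  rw [funext fun t ↦ (hasDerivAt_smoothRamp hδ t).deriv]
  unfold smoothStep
  fun_prop

/-- Rounding a corner: two `C¹` curves meeting at parameter `0` are joined by a `C¹` curve which
differs from their concatenation only close to `0`, and whose position and velocity there are close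
to the corner point and to the segment joining the two velocities at the corner. -/
theorem exists_rounded_corner {f g : ℝ → E}
    (hf : ContDiffWithinAt ℝ 1 f (Iic 0) 0) (hg : ContDiffWithinAt ℝ 1 g (Ici 0) 0)
    (h0 : f 0 = g 0) {U : Set (E × E)} (hU : IsOpen U)
    (hseg : ∀ σ ∈ Icc (0 : ℝ) 1,
      (f 0, (1 - σ) • derivWithin f (Iic 0) 0 + σ • derivWithin g (Ici 0) 0) ∈ U)
    {η₀ : ℝ} (hη₀ : 0 < η₀) :
    ∃ η δ : ℝ, 0 < δ ∧ δ < η ∧ η < η₀ ∧ ∃ c : ℝ → E,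
      (∀ t ∈ Ioo (-η) η, ContDiffAt ℝ 1 c t ∧ (c t, deriv c t) ∈ U) ∧
      (∀ t ≤ -δ, c t = f t) ∧ ∀ t, δ ≤ t → c t = g t := by
  set u := derivWithin f (Iic 0) 0 with hu
  set v := derivWithin g (Ici 0) 0 with hv
  -- Subtracting the two tangent lines leaves a remainder which is `C¹` across the corner.
  set f₁ : ℝ → E := fun t ↦ f t - t • u with hf₁
  set g₁ : ℝ → E := fun t ↦ g t - t • v with hg₁
  have hlin : ∀ w : E, ContDiff ℝ 1 (fun t : ℝ ↦ t • w) := fun w ↦ by fun_prop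
  have hdlin : ∀ (w : E) (s : Set ℝ) (t : ℝ), HasDerivWithinAt (fun t : ℝ ↦ t • w) w s t :=
    fun w s t ↦ by simpa using (hasDerivWithinAt_id t s).smul_const w
  have hf₁' : ContDiffWithinAt ℝ 1 f₁ (Iic 0) 0 := hf.sub (hlin u).contDiffWithinAt
  have hg₁' : ContDiffWithinAt ℝ 1 g₁ (Ici 0) 0 := hg.sub (hlin v).contDiffWithinAt
  have hdf : derivWithin f₁ (Iic 0) 0 = 0 := by
    have := ((hf.differentiableWithinAt one_ne_zero).hasDerivWithinAt.sub (hdlin u _ 0)).derivWithin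
      (uniqueDiffOn_Iic (0 : ℝ) 0 self_mem_Iic)
    rw [← hu, sub_self] at this
    exact this
  have hdg : derivWithin g₁ (Ici 0) 0 = 0 := by
    have := ((hg.differentiableWithinAt one_ne_zero).hasDerivWithinAt.sub (hdlin v _ 0)).derivWithin
      (uniqueDiffOn_Ici (0 : ℝ) 0 self_mem_Ici)
    rw [← hv, sub_self] at this
    exact this
  have h01 : f₁ 0 = g₁ 0 := by simp [hf₁, hg₁, h0]
  set r := glue 0 f₁ g₁ with hr
  have hr1 : ContDiffAt ℝ 1 r 0 := contDiffAt_one_glue hf₁' hg₁' h01 (by rw [hdf, hdg])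
  have hr0 : r 0 = f 0 := by rw [hr, glue_of_le le_rfl]; simp [hf₁]
  have hr0' : deriv r 0 = 0 := by
    have := (eventually_hasDerivAt_glue hf₁' hg₁' h01 (by rw [hdf, hdg])).self_of_nhds.deriv
    rwa [glue_of_le le_rfl, hdf] at this
  -- A uniform neighbourhood of the segment of velocities at the corner is contained in `U`.
  set S : Set (E × E) := (fun σ : ℝ ↦ (f 0, (1 - σ) • u + σ • v)) '' Icc 0 1 with hS
  have hSc : IsCompact S := isCompact_Icc.image (by fun_prop)
  obtain ⟨ρ, hρ, hρU⟩ := hSc.exists_thickening_subset_open hU (by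
    rintro _ ⟨σ, hσ, rfl⟩; exact hseg σ hσ)
  have hcd : ContDiffWithinAt ℝ 0 (derivWithin r univ) univ 0 :=
    (contDiffWithinAt_univ.2 hr1).derivWithin_right (m := 0) uniqueDiffOn_univ (by simp) (mem_univ _)
  have hcont' : ContinuousAt (deriv r) 0 := by
    have := hcd.continuousWithinAt
    rwa [derivWithin_univ, continuousWithinAt_univ] at this
  have hsmall : ∀ᶠ t : ℝ in 𝓝 0, ContDiffAt ℝ 1 r t ∧ ‖deriv r t‖ < ρ ∧ ‖r t - f 0‖ < ρ / 2 := by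
    refine (hr1.eventually (by simp)).and (Eventually.and ?_ ?_)
    · have : Tendsto (fun t ↦ ‖deriv r t‖) (𝓝 0) (𝓝 ‖deriv r 0‖) := hcont'.norm
      rw [hr0', norm_zero] at this
      exact this.eventually (gt_mem_nhds hρ)
    · have : Tendsto (fun t ↦ ‖r t - f 0‖) (𝓝 0) (𝓝 ‖r 0 - f 0‖) :=
        (hr1.continuousAt.sub continuousAt_const).norm
      rw [hr0, sub_self, norm_zero] at this
      exact this.eventually (gt_mem_nhds (by positivity))
  obtain ⟨ε, hε, hεr⟩ := Metric.eventually_nhds_iff.1 hsmall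
  set C : ℝ := ‖u‖ + 2 * ‖v - u‖ + 1 with hC
  have hCpos : 0 < C := by positivity
  set η := min (η₀ / 2) (min ε (ρ / (2 * C))) with hη
  have hηpos : 0 < η := lt_min (by positivity) (lt_min hε (by positivity))
  have hηρ : η * C ≤ ρ / 2 := by
    have : η ≤ ρ / (2 * C) := (min_le_right _ _).trans (min_le_right _ _)
    calc η * C ≤ ρ / (2 * C) * C := by gcongr
      _ = ρ / 2 := by field_simp
  have hδ : 0 < η / 2 := by positivity
  refine ⟨η, η / 2, hδ, by linarith, lt_of_le_of_lt (min_le_left _ _) (by linarith),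
    fun t ↦ r t + t • u + smoothRamp (η / 2) t • (v - u), fun t ht ↦ ?_, fun t ht ↦ ?_,
    fun t ht ↦ ?_⟩
  · have htη : |t| < η := abs_lt.2 ht
    obtain ⟨h1, h2, h3⟩ := hεr (y := t) (by
      rw [Real.dist_0_eq_abs]
      exact htη.trans_le ((min_le_right _ _).trans (min_le_left _ _)))
    have hd : HasDerivAt (fun t ↦ r t + t • u + smoothRamp (η / 2) t • (v - u))
        (deriv r t + u + smoothStep (η / 2) t • (v - u)) t :=
      ((h1.differentiableAt one_ne_zero).hasDerivAt.add
        (hasDerivWithinAt_univ.1 (hdlin u univ t))).add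
        ((hasDerivAt_smoothRamp hδ t).smul_const (v - u))
    refine ⟨(h1.add (hlin u).contDiffAt).add
      ((contDiff_smoothRamp hδ).contDiffAt.smul contDiffAt_const), ?_⟩
    rw [hd.deriv]
    apply hρU
    rw [Metric.mem_thickening_iff]
    refine ⟨_, mem_image_of_mem _ (smoothStep_mem hδ t), ?_⟩
    rw [Prod.dist_eq, max_lt_iff, dist_eq_norm, dist_eq_norm]
    constructor
    · have e : r t + t • u + smoothRamp (η / 2) t • (v - u) - f 0
          = (r t - f 0) + (t • u + smoothRamp (η / 2) t • (v - u)) := by abel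
      have hb : ‖t • u + smoothRamp (η / 2) t • (v - u)‖ ≤ η * C := by
        have hs := abs_smoothRamp_le hδ t
        calc ‖t • u + smoothRamp (η / 2) t • (v - u)‖
            ≤ |t| * ‖u‖ + |smoothRamp (η / 2) t| * ‖v - u‖ := by
              refine (norm_add_le _ _).trans ?_
              rw [norm_smul, norm_smul, Real.norm_eq_abs, Real.norm_eq_abs]
          _ ≤ η * ‖u‖ + (2 * η) * ‖v - u‖ := by gcongr; linarith
          _ ≤ η * C := by rw [hC]; nlinarith
      simp only [e]
      refine (norm_add_le _ _).trans_lt ?_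
      linarith
    · have e : deriv r t + u + smoothStep (η / 2) t • (v - u)
          - ((1 - smoothStep (η / 2) t) • u + smoothStep (η / 2) t • v) = deriv r t := by module
      simp only [e]
      exact h2
  · have : r t = f t - t • u := glue_of_le (by linarith)
    simp only [this, smoothRamp_of_le hδ ht]
    simp
  · have : r t = g t - t • v := glue_of_ge h01 (by linarith)
    simp only [this, smoothRamp_of_ge hδ ht]
    module

end Glue

/-! ### Strict differentiability of averaged trajectories -/

/-- For a `C¹` vector field `F` near `z₀` there is a map `A`, strictly differentiable at `(0, z₀)`,
whose value at `(h, z)` is the average over `[0, h]` of the integral curve starting at `z`. The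
Lipschitz dependence of integral curves on the initial value is enough for the strict
differentiability, since only time `0` matters. -/
theorem exists_average_flow {Z : Type*} [NormedAddCommGroup Z] [NormedSpace ℝ Z] [CompleteSpace Z]
    {F : Z → Z} {z₀ : Z} (hF : ContDiffAt ℝ 1 F z₀) :
    ∃ A : ℝ × Z → Z, A (0, z₀) = z₀ ∧
      HasStrictFDerivAt A (ContinuousLinearMap.snd ℝ ℝ Z +
        (ContinuousLinearMap.fst ℝ ℝ Z).smulRight ((1 / 2 : ℝ) • F z₀)) (0, z₀) ∧
      ∀ W ∈ 𝓝 z₀, ∀ᶠ p : ℝ × Z in 𝓝 (0, z₀), 0 < p.1 → ∃ c : ℝ → Z, c 0 = p.2 ∧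
        (∀ t ∈ Icc 0 p.1, HasDerivWithinAt c (F (c t)) (Icc 0 p.1) t ∧ c t ∈ W) ∧
        ∫ s in (0 : ℝ)..p.1, c s = p.1 • A p := by
  obtain ⟨ε, hε, a, r, L, K₀, hr, hPL⟩ := IsPicardLindelof.of_contDiffAt_one hF
  obtain ⟨α, hα, L', hL'⟩ :=
    (hPL 0).exists_forall_mem_closedBall_eq_hasDerivWithinAt_lipschitzOnWith
  simp only [zero_sub, zero_add] at hα hL'
  obtain ⟨K, s, hs, hK⟩ := hF.exists_lipschitzOnWith
  set Φ : ℝ × Z → Z := fun p ↦ α p.2 p.1 with hΦ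
  have hz₀ : z₀ ∈ Metric.closedBall z₀ (r : ℝ) := Metric.mem_closedBall_self r.2
  have hder : ∀ z ∈ Metric.closedBall z₀ (r : ℝ), ∀ t ∈ Ioo (-ε) ε,
      HasDerivAt (α z) (F (α z t)) t := fun z hz t ht ↦
    ((hα z hz).2 t (Ioo_subset_Icc_self ht)).hasDerivAt (Icc_mem_nhds ht.1 ht.2)
  have hball : ∀ᶠ p : ℝ × Z in 𝓝 (0, z₀), p.1 ∈ Ioo (-ε) ε ∧ p.2 ∈ Metric.closedBall z₀ (r : ℝ) :=
    prod_mem_nhds (Ioo_mem_nhds (by linarith) hε)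
      (Metric.closedBall_mem_nhds z₀ (NNReal.coe_pos.2 hr))
  have hcont : Tendsto Φ (𝓝 (0, z₀)) (𝓝 z₀) := by
    rw [tendsto_iff_dist_tendsto_zero]
    have hlim : Tendsto (fun p : ℝ × Z ↦ L' * dist p.2 z₀ + dist (α z₀ p.1) z₀) (𝓝 (0, z₀))
        (𝓝 (L' * dist z₀ z₀ + dist (α z₀ 0) z₀)) := by
      refine Tendsto.add ?_ ?_
      · exact (((continuous_snd.tendsto (0, z₀)).dist tendsto_const_nhds).const_mul _)
      · have h1 : ContinuousAt (α z₀) ((0, z₀) : ℝ × Z).1 :=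
          (hder z₀ hz₀ 0 ⟨by linarith, hε⟩).continuousAt
        exact (h1.tendsto.comp (continuous_fst.tendsto (0, z₀))).dist tendsto_const_nhds
    rw [(hα z₀ hz₀).1, dist_self, mul_zero, add_zero] at hlim
    refine squeeze_zero' (Eventually.of_forall fun _ ↦ dist_nonneg) ?_ hlim
    filter_upwards [hball] with p hp
    refine (dist_triangle _ (α z₀ p.1) _).trans ?_
    gcongr
    exact (hL' p.1 (Ioo_subset_Icc_self hp.1)).dist_le_mul _ hp.2 _ hz₀
  -- The flow itself is strictly differentiable at `(0, z₀)`, with derivative `dz + dt • F z₀`.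
  have hstrict : ∀ η > 0, ∃ ρ > 0, ∀ p ∈ Metric.ball ((0, z₀) : ℝ × Z) ρ,
      ∀ p' ∈ Metric.ball ((0, z₀) : ℝ × Z) ρ,
      ‖Φ p - Φ p' - ((p.2 - p'.2) + (p.1 - p'.1) • F z₀)‖ ≤ η * ‖p - p'‖ := by
    intro η hη
    have h1 : ∀ᶠ p : ℝ × Z in 𝓝 (0, z₀), ‖F (Φ p) - F z₀‖ ≤ η / 2 := by
      have := ((hF.continuousAt.tendsto.comp hcont).sub_const (F z₀)).norm
      rw [sub_self, norm_zero] at this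
      exact this.eventually (ge_mem_nhds (by positivity))
    have h2 : ∀ᶠ p : ℝ × Z in 𝓝 (0, z₀), |p.1| * (K * L') ≤ η / 2 := by
      have : Tendsto (fun p : ℝ × Z ↦ |p.1| * (K * L' : ℝ)) (𝓝 (0, z₀)) (𝓝 (|0| * (K * L' : ℝ))) :=
        ((continuous_abs.comp continuous_fst).mul continuous_const).tendsto (0, z₀)
      rw [abs_zero, zero_mul] at this
      exact this.eventually (ge_mem_nhds (by positivity))
    obtain ⟨ρ, hρ, hρ'⟩ := Metric.eventually_nhds_iff_ball.1
      (hball.and ((hcont.eventually hs).and (h1.and h2)))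
    have hmem : ∀ {t : ℝ} {z : Z}, t ∈ Ioo (-ρ) ρ → z ∈ Metric.ball z₀ ρ →
        ((t, z) : ℝ × Z) ∈ Metric.ball ((0, z₀) : ℝ × Z) ρ := by
      intro t z ht hz
      rw [Metric.mem_ball, Prod.dist_eq, max_lt_iff, Real.dist_0_eq_abs]
      exact ⟨abs_lt.2 ht, hz⟩
    have hmem' : ∀ p ∈ Metric.ball ((0, z₀) : ℝ × Z) ρ, p.1 ∈ Ioo (-ρ) ρ ∧ p.2 ∈ Metric.ball z₀ ρ := by
      intro p hp
      rw [Metric.mem_ball, Prod.dist_eq, max_lt_iff, Real.dist_0_eq_abs] at hp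
      exact ⟨abs_lt.1 hp.1, hp.2⟩
    refine ⟨ρ, hρ, ?_⟩
    rintro ⟨t, z⟩ hp ⟨t', z'⟩ hp'
    obtain ⟨ht, hz⟩ := hmem' _ hp
    obtain ⟨ht', hz'⟩ := hmem' _ hp'
    -- Variation of the time: the velocity `F` along the flow is close to `F z₀`.
    have hA : ‖(α z t - t • F z₀) - (α z t' - t' • F z₀)‖ ≤ η / 2 * ‖t - t'‖ := by
      refine (convex_Ioo (-ρ) ρ).norm_image_sub_le_of_norm_hasDerivWithin_le
        (f := fun τ ↦ α z τ - τ • F z₀) (f' := fun τ ↦ F (α z τ) - F z₀) (fun τ hτ ↦ ?_)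
        (fun τ hτ ↦ (hρ' (τ, z) (hmem hτ hz)).2.2.1) ht' ht
      have h := hρ' (τ, z) (hmem hτ hz)
      have hd := (hder z h.1.2 τ h.1.1).sub ((hasDerivAt_id τ).smul_const (F z₀))
      rw [one_smul] at hd
      exact hd.hasDerivWithinAt
    -- Variation of the initial value: two integral curves separate at rate at most
    -- `K L' ‖z - z'‖`.
    have hB : ‖(α z t' - α z' t') - (α z 0 - α z' 0)‖ ≤ K * (L' * ‖z - z'‖) * ‖t' - 0‖ := by
      refine (convex_Ioo (-ρ) ρ).norm_image_sub_le_of_norm_hasDerivWithin_le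
        (f := fun τ ↦ α z τ - α z' τ) (f' := fun τ ↦ F (α z τ) - F (α z' τ)) (fun τ hτ ↦ ?_)
        (fun τ hτ ↦ ?_) ⟨by linarith, hρ⟩ ht'
      · have h := hρ' (τ, z) (hmem hτ hz)
        have h' := hρ' (τ, z') (hmem hτ hz')
        exact ((hder z h.1.2 τ h.1.1).sub (hder z' h'.1.2 τ h.1.1)).hasDerivWithinAt
      · have h := hρ' (τ, z) (hmem hτ hz)
        have h' := hρ' (τ, z') (hmem hτ hz')
        refine (hK.norm_sub_le h.2.1 h'.2.1).trans ?_
        gcongr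
        exact (hL' τ (Ioo_subset_Icc_self h.1.1)).norm_sub_le h.1.2 h'.1.2
    have hzb := (hρ' _ hp).1.2
    have hzb' := (hρ' _ hp').1.2
    have ht'K := (hρ' _ hp').2.2.2
    rw [(hα z hzb).1, (hα z' hzb').1, sub_zero, Real.norm_eq_abs] at hB
    have e : Φ (t, z) - Φ (t', z') - ((z - z') + (t - t') • F z₀)
        = ((α z t - t • F z₀) - (α z t' - t' • F z₀)) + ((α z t' - α z' t') - (z - z')) := by
      simp only [hΦ]; module
    simp only [e]
    have hn1 : ‖t - t'‖ ≤ ‖(t, z) - (t', z')‖ := norm_fst_le ((t, z) - (t', z'))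
    have hn2 : ‖z - z'‖ ≤ ‖(t, z) - (t', z')‖ := norm_snd_le ((t, z) - (t', z'))
    calc _ ≤ η / 2 * ‖t - t'‖ + K * (L' * ‖z - z'‖) * |t'| :=
          (norm_add_le _ _).trans (add_le_add hA hB)
      _ = η / 2 * ‖t - t'‖ + (|t'| * (K * L')) * ‖z - z'‖ := by ring
      _ ≤ η / 2 * ‖(t, z) - (t', z')‖ + η / 2 * ‖(t, z) - (t', z')‖ := by gcongr
      _ = η * ‖(t, z) - (t', z')‖ := by ring
  have hscale : ∀ {σ : ℝ}, σ ∈ Icc (0 : ℝ) 1 → ∀ p : ℝ × Z, ‖((σ * p.1, p.2) : ℝ × Z)‖ ≤ ‖p‖ := by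
    intro σ hσ p
    rw [Prod.norm_def, Prod.norm_def]
    refine max_le_max ?_ le_rfl
    rw [norm_mul, Real.norm_of_nonneg hσ.1]
    exact mul_le_of_le_one_left (norm_nonneg _) hσ.2
  have hscale_mem : ∀ {σ : ℝ}, σ ∈ Icc (0 : ℝ) 1 → ∀ {ρ : ℝ}, ∀ p ∈ Metric.ball ((0, z₀) : ℝ × Z) ρ,
      ((σ * p.1, p.2) : ℝ × Z) ∈ Metric.ball ((0, z₀) : ℝ × Z) ρ := by
    intro σ hσ ρ p hp
    rw [mem_ball_iff_norm] at hp ⊢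
    have e : ((σ * p.1, p.2) : ℝ × Z) - (0, z₀) = (σ * (p - (0, z₀)).1, (p - (0, z₀)).2) := by
      simp
    rw [e]
    exact (hscale hσ (p - (0, z₀))).trans_lt hp
  have hcontOn : ∀ᶠ p : ℝ × Z in 𝓝 (0, z₀), IntervalIntegrable (fun σ ↦ Φ (σ * p.1, p.2))
      MeasureTheory.volume 0 1 := by
    obtain ⟨ρ, hρ, hρ'⟩ := Metric.eventually_nhds_iff_ball.1 hball
    filter_upwards [Metric.ball_mem_nhds _ hρ] with p hp
    apply ContinuousOn.intervalIntegrable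
    rw [uIcc_of_le zero_le_one]
    intro σ hσ
    have h := hρ' _ (hscale_mem hσ p hp)
    have hcσ : ContinuousAt (α p.2) (σ * p.1) := (hder p.2 h.2 _ h.1).continuousAt
    exact (hcσ.comp (f := fun σ : ℝ ↦ σ * p.1) (by fun_prop)).continuousWithinAt
  -- After rescaling the time, the average is an integral over a fixed interval, which makes sense
  -- at `h = 0` too.
  refine ⟨fun p ↦ ∫ σ in (0 : ℝ)..1, Φ (σ * p.1, p.2), ?_, ?_, ?_⟩
  · simp [hΦ, (hα z₀ hz₀).1]
  · rw [hasStrictFDerivAt_iff_isLittleO, Asymptotics.isLittleO_iff]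
    intro η hη
    obtain ⟨ρ, hρ, hρ'⟩ := hstrict η hη
    have hb : ∀ᶠ p : ℝ × Z in 𝓝 (0, z₀), p ∈ Metric.ball ((0, z₀) : ℝ × Z) ρ ∧
        IntervalIntegrable (fun σ ↦ Φ (σ * p.1, p.2)) MeasureTheory.volume 0 1 :=
      (show ∀ᶠ p in 𝓝 ((0, z₀) : ℝ × Z), p ∈ Metric.ball ((0, z₀) : ℝ × Z) ρ from
        Metric.ball_mem_nhds _ hρ).and hcontOn
    rw [nhds_prod_eq]
    filter_upwards [hb.prod_mk hb] with ⟨p, p'⟩ ⟨⟨hp, hpi⟩, hp', hpi'⟩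
    have hlin : ∫ σ in (0 : ℝ)..1, ((p.2 - p'.2) + (σ * p.1 - σ * p'.1) • F z₀)
        = (p.2 - p'.2) + (p.1 - p'.1) • (1 / 2 : ℝ) • F z₀ := by
      have e : ∀ σ : ℝ, (p.2 - p'.2) + (σ * p.1 - σ * p'.1) • F z₀
          = (p.2 - p'.2) + σ • ((p.1 - p'.1) • F z₀) := fun σ ↦ by module
      simp only [e]
      rw [intervalIntegral.integral_add (by simp) (Continuous.intervalIntegrable (by fun_prop) _ _),
        intervalIntegral.integral_smul_const, intervalIntegral.integral_const, integral_id]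
      module
    have hlini : IntervalIntegrable (fun σ : ℝ ↦ (p.2 - p'.2) + (σ * p.1 - σ * p'.1) • F z₀)
        MeasureTheory.volume 0 1 := Continuous.intervalIntegrable (by fun_prop) _ _
    have hD : (ContinuousLinearMap.snd ℝ ℝ Z +
        (ContinuousLinearMap.fst ℝ ℝ Z).smulRight ((1 / 2 : ℝ) • F z₀)) (p - p')
        = ∫ σ in (0 : ℝ)..1, ((p.2 - p'.2) + (σ * p.1 - σ * p'.1) • F z₀) := by
      rw [hlin]; simp
    simp only [hD]
    rw [← intervalIntegral.integral_sub hpi hpi',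
      ← intervalIntegral.integral_sub (hpi.sub hpi') hlini]
    have := intervalIntegral.norm_integral_le_of_norm_le_const (a := (0 : ℝ)) (b := 1)
      (C := η * ‖p - p'‖) (f := fun σ ↦ Φ (σ * p.1, p.2) - Φ (σ * p'.1, p'.2)
        - ((p.2 - p'.2) + (σ * p.1 - σ * p'.1) • F z₀)) (fun σ hσ ↦ ?_)
    · simpa using this
    · rw [uIoc_of_le zero_le_one] at hσ
      have hσ' := Ioc_subset_Icc_self hσ
      refine (hρ' _ (hscale_mem hσ' p hp) _ (hscale_mem hσ' p' hp')).trans ?_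
      gcongr
      have e : ((σ * p.1, p.2) : ℝ × Z) - (σ * p'.1, p'.2) = (σ * (p - p').1, (p - p').2) := by
        simp [mul_sub]
      rw [e]
      exact hscale hσ' (p - p')
  · intro W hW
    obtain ⟨ρ, hρ, hρ'⟩ := Metric.eventually_nhds_iff_ball.1 (hball.and (hcont.eventually hW))
    filter_upwards [Metric.ball_mem_nhds _ hρ] with p hp hp0
    refine ⟨α p.2, (hα _ (hρ' p hp).1.2).1, fun t ht ↦ ?_, ?_⟩
    · have ht' : t / p.1 ∈ Icc (0 : ℝ) 1 := ⟨div_nonneg ht.1 hp0.le, (div_le_one hp0).2 ht.2⟩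
      have h := hρ' _ (hscale_mem ht' p hp)
      rw [div_mul_cancel₀ _ hp0.ne'] at h
      exact ⟨(hder _ h.1.2 _ h.1.1).hasDerivWithinAt, h.2⟩
    · have := intervalIntegral.smul_integral_comp_mul_right (a := 0) (b := 1) (α p.2) p.1
      rw [zero_mul, one_mul] at this
      exact this.symm

/-! ### The metric and the time orientation in a chart -/

section Chart

variable {M : Type*} [TopologicalSpace M] [ChartedSpace (EuclideanSpace ℝ (Fin 4)) M]
  [IsManifold (𝓡 4) ∞ M]

/-- The coordinate space of the charts. -/
abbrev CoordSpace := EuclideanSpace ℝ (Fin 4)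

/-- The derivative of the inverse of the preferred chart at `x₀`, which sends coordinate vectors
to tangent vectors. -/
def chartFrame (x₀ : M) (y : CoordSpace) :
    CoordSpace →L[ℝ] TangentSpace (𝓡 4) ((extChartAt (𝓡 4) x₀).symm y) :=
  mfderiv (𝓡 4) (𝓡 4) (extChartAt (𝓡 4) x₀).symm y

theorem mfderiv_comp_chartFrame (x₀ : M) {y : CoordSpace} (hy : y ∈ (extChartAt (𝓡 4) x₀).target)
    (v : CoordSpace) :
    mfderiv (𝓡 4) (𝓡 4) (extChartAt (𝓡 4) x₀) ((extChartAt (𝓡 4) x₀).symm y)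
      (chartFrame x₀ y v) = v := by
  have h := mfderiv_extChartAt_comp_mfderivWithin_extChartAt_symm (I := 𝓡 4) hy
  rw [ModelWithCorners.range_eq_univ, mfderivWithin_univ] at h
  exact DFunLike.congr_fun h v

theorem chartFrame_mfderiv (x₀ : M) {y : CoordSpace} (hy : y ∈ (extChartAt (𝓡 4) x₀).target)
    (v : TangentSpace (𝓡 4) ((extChartAt (𝓡 4) x₀).symm y)) :
    chartFrame x₀ y (mfderiv (𝓡 4) (𝓡 4) (extChartAt (𝓡 4) x₀) ((extChartAt (𝓡 4) x₀).symm y) v)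
      = v := by
  have h := mfderivWithin_extChartAt_symm_comp_mfderiv_extChartAt (I := 𝓡 4) hy
  rw [ModelWithCorners.range_eq_univ, mfderivWithin_univ] at h
  exact DFunLike.congr_fun h v

theorem contMDiffOn_chartFrame (x₀ : M) (v : CoordSpace) :
    ContMDiffOn (𝓡 4) ((𝓡 4).prod 𝓘(ℝ, CoordSpace)) ∞
      (fun y ↦ TotalSpace.mk' CoordSpace (E := (TangentSpace (𝓡 4) : M → Type _))
        ((extChartAt (𝓡 4) x₀).symm y) (chartFrame x₀ y v))
      (extChartAt (𝓡 4) x₀).target := by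
  have hopen := isOpen_extChartAt_target (I := 𝓡 4) x₀
  have h := (contMDiffOn_extChartAt_symm (I := 𝓡 4) (n := ∞) x₀).contMDiffOn_tangentMapWithin
    (m := ∞) (by simp) hopen.uniqueMDiffOn
  have hc : ContMDiffOn (𝓡 4) (𝓡 4).tangent ∞
      (fun y : CoordSpace ↦ (⟨y, v⟩ : TangentBundle (𝓡 4) CoordSpace))
      (extChartAt (𝓡 4) x₀).target :=
    (contMDiffOn_vectorSpace_iff_contDiffOn (V := fun _ ↦ v)).2 contDiffOn_const
  refine (h.comp hc fun y hy ↦ hy).congr fun y hy ↦ ?_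
  simp only [Function.comp, tangentMapWithin, chartFrame]
  rw [mfderivWithin_of_isOpen hopen hy]
  rfl

namespace LorentzMetric

variable (g : LorentzMetric M)

/-- The metric as a field of bilinear forms on the coordinate space of the chart at `x₀`. -/
def inChart (x₀ : M) (y : CoordSpace) : CoordSpace →L[ℝ] CoordSpace →L[ℝ] ℝ :=
  let B : CoordSpace →L[ℝ] CoordSpace →L[ℝ] ℝ := g.form ((extChartAt (𝓡 4) x₀).symm y)
  let D : CoordSpace →L[ℝ] CoordSpace := chartFrame x₀ y
  B.bilinearComp D D

theorem inChart_apply (x₀ : M) (y v w : CoordSpace) :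
    g.inChart x₀ y v w = g.form ((extChartAt (𝓡 4) x₀).symm y) (chartFrame x₀ y v)
      (chartFrame x₀ y w) := rfl

theorem chartForm_eq (x₀ : M) (v w : CoordSpace) :
    g.chartForm x₀ v w = fun y ↦ g.inChart x₀ y v w := rfl

theorem contDiffOn_inChart (x₀ : M) :
    ContDiffOn ℝ ∞ (g.inChart x₀) (extChartAt (𝓡 4) x₀).target := by
  rw [contDiffOn_clm_apply]
  intro v
  rw [contDiffOn_clm_apply]
  intro w
  rw [← contMDiffOn_iff_contDiffOn]
  have h : ContMDiffOn (𝓡 4) ((𝓡 4).prod 𝓘(ℝ, ℝ)) ∞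
      (fun y ↦ TotalSpace.mk' ℝ (E := Bundle.Trivial M ℝ) ((extChartAt (𝓡 4) x₀).symm y)
        (g.form ((extChartAt (𝓡 4) x₀).symm y) (chartFrame x₀ y v) (chartFrame x₀ y w)))
      (extChartAt (𝓡 4) x₀).target := by
    apply ContMDiffOn.clm_bundle_apply₂ (F₁ := CoordSpace) (F₂ := CoordSpace)
      (E₁ := (TangentSpace (𝓡 4) : M → Type _)) (E₂ := (TangentSpace (𝓡 4) : M → Type _))
    · exact g.smooth.comp_contMDiffOn (contMDiffOn_extChartAt_symm x₀)
    · exact contMDiffOn_chartFrame x₀ v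
    · exact contMDiffOn_chartFrame x₀ w
  intro y hy
  have := h y hy
  rw [Bundle.contMDiffWithinAt_totalSpace] at this
  exact this.2

theorem contDiffAt_inChart (x₀ : M) {y : CoordSpace} (hy : y ∈ (extChartAt (𝓡 4) x₀).target) :
    ContDiffAt ℝ ∞ (g.inChart x₀) y :=
  (g.contDiffOn_inChart x₀).contDiffAt ((isOpen_extChartAt_target x₀).mem_nhds hy)

theorem isLorentz_inChart (x₀ : M) {y : CoordSpace} (hy : y ∈ (extChartAt (𝓡 4) x₀).target) :
    IsLorentz (g.inChart x₀ y) := by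
  obtain ⟨e, he⟩ := g.signature ((extChartAt (𝓡 4) x₀).symm y)
  let D : TangentSpace (𝓡 4) ((extChartAt (𝓡 4) x₀).symm y) ≃ₗ[ℝ] CoordSpace :=
    { toFun := mfderiv (𝓡 4) (𝓡 4) (extChartAt (𝓡 4) x₀) ((extChartAt (𝓡 4) x₀).symm y)
      map_add' := fun v w ↦ map_add _ v w
      map_smul' := fun c v ↦ map_smul _ c v
      invFun := chartFrame x₀ y
      left_inv := fun v ↦ chartFrame_mfderiv x₀ hy v
      right_inv := fun v ↦ mfderiv_comp_chartFrame x₀ hy v }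
  have hD : ∀ v, chartFrame x₀ y (D v) = v := fun v ↦ chartFrame_mfderiv x₀ hy v
  refine IsLorentz.of_basis (fun v w ↦ g.symm _ _ _) (e.map D) fun i j ↦ ?_
  rw [inChart_apply, Module.Basis.map_apply, Module.Basis.map_apply, hD, hD]
  exact he i j

end LorentzMetric

namespace TimeOrientation

variable {g : LorentzMetric M} (T : TimeOrientation g)

/-- The timelike field in the coordinates of the chart at `x₀`. -/
def inChart (x₀ : M) (y : CoordSpace) : CoordSpace :=
  mfderiv (𝓡 4) (𝓡 4) (extChartAt (𝓡 4) x₀) ((extChartAt (𝓡 4) x₀).symm y)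
    (T.field ((extChartAt (𝓡 4) x₀).symm y))

theorem chartFrame_inChart (x₀ : M) {y : CoordSpace} (hy : y ∈ (extChartAt (𝓡 4) x₀).target) :
    chartFrame x₀ y (T.inChart x₀ y) = T.field ((extChartAt (𝓡 4) x₀).symm y) :=
  chartFrame_mfderiv x₀ hy _

theorem continuousOn_inChart (x₀ : M) :
    ContinuousOn (T.inChart x₀) (extChartAt (𝓡 4) x₀).target := by
  have hopen := isOpen_extChartAt_source (I := 𝓡 4) x₀
  have h := ((contMDiffOn_extChartAt (I := 𝓡 4) (n := ∞) (x := x₀)).contMDiffOn_tangentMapWithin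
    (m := 0) (by simp) (by
      rw [← extChartAt_source (𝓡 4)]; exact hopen.uniqueMDiffOn)).continuousOn
  have hs := (contMDiff_snd_tangentBundle_modelSpace CoordSpace (𝓡 4) (n := 0)).continuous
  have hf := T.continuous_field.comp_continuousOn (continuousOn_extChartAt_symm (I := 𝓡 4) x₀)
  refine (hs.comp_continuousOn (h.comp hf fun y hy ↦ ?_)).congr fun y hy ↦ ?_
  · have := (extChartAt (𝓡 4) x₀).map_target hy
    rwa [extChartAt_source] at this
  · have hy' := (extChartAt (𝓡 4) x₀).map_target hy
    simp only [Function.comp, tangentMapWithin, inChart]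
    rw [mfderivWithin_of_isOpen (chartAt _ x₀).open_source (by rwa [extChartAt_source] at hy')]

theorem inChart_timelike (x₀ : M) {y : CoordSpace} (hy : y ∈ (extChartAt (𝓡 4) x₀).target) :
    g.inChart x₀ y (T.inChart x₀ y) (T.inChart x₀ y) < 0 := by
  rw [LorentzMetric.inChart_apply, T.chartFrame_inChart x₀ hy]
  exact T.timelike_field _

end TimeOrientation

end Chart

section Timelike

variable {M : Type*} [TopologicalSpace M] [ChartedSpace (EuclideanSpace ℝ (Fin 4)) M]
  [IsManifold (𝓡 4) ∞ M]

/-! ### Velocities in charts -/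

theorem derivWithin_comp_affine {E : Type*} [NormedAddCommGroup E] [NormedSpace ℝ E] (x : ℝ → E)
    (l m : ℝ) (s : Set ℝ) (t : ℝ) :
    derivWithin (fun t ↦ x (l * t + m)) s t
      = l • derivWithin x ((fun t ↦ l * t + m) '' s) (l * t + m) := by
  rw [derivWithin_comp_mul_left l (fun t ↦ x (t + m)), derivWithin_comp_add_const]
  congr 2
  ext u
  simp [Set.mem_smul_set, Set.mem_vadd_set, add_comm]

theorem ContDiffWithinAt.derivWithin_mono_of_mem_nhdsWithin {E : Type*} [NormedAddCommGroup E]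
    [NormedSpace ℝ E] {x : ℝ → E} {s s' : Set ℝ} {t : ℝ} {n : WithTop ℕ∞}
    (hx : ContDiffWithinAt ℝ n x s t) (hn : n ≠ 0) (hs : s ∈ 𝓝[s'] t)
    (hu : UniqueDiffWithinAt ℝ s' t) : derivWithin x s' t = derivWithin x s t :=
  ((hx.differentiableWithinAt hn).hasDerivWithinAt.mono_of_mem_nhdsWithin hs).derivWithin hu

/-- The derivative in a chart of a curve, as the image of the velocity of the curve. -/
theorem mfderiv_chart_velocity {γ : ℝ → M} {s : Set ℝ} {t : ℝ} {x₀ : M}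
    (hγ : MDifferentiableWithinAt 𝓘(ℝ, ℝ) (𝓡 4) γ s t)
    (ht : γ t ∈ (extChartAt (𝓡 4) x₀).source) (hs : UniqueDiffWithinAt ℝ s t) :
    mfderiv (𝓡 4) (𝓡 4) (extChartAt (𝓡 4) x₀) (γ t)
      (mfderivWithin 𝓘(ℝ, ℝ) (𝓡 4) γ s t (1 : ℝ))
      = derivWithin (fun u ↦ extChartAt (𝓡 4) x₀ (γ u)) s t := by
  have h := mfderiv_comp_mfderivWithin (I := 𝓘(ℝ, ℝ)) (I' := 𝓡 4) (I'' := 𝓡 4) (x := t)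
    (f := γ) (s := s) (g := extChartAt (𝓡 4) x₀)
    (mdifferentiableAt_extChartAt (by rwa [extChartAt_source] at ht)) hγ hs.uniqueMDiffWithinAt
  rw [mfderivWithin_eq_fderivWithin] at h
  exact (DFunLike.congr_fun h (1 : ℝ)).symm

namespace LorentzMetric

variable (g : LorentzMetric M)

theorem inChart_mfderiv {x₀ p : M} (hp : p ∈ (extChartAt (𝓡 4) x₀).source)
    (u w : TangentSpace (𝓡 4) p) :
    g.inChart x₀ (extChartAt (𝓡 4) x₀ p) (mfderiv (𝓡 4) (𝓡 4) (extChartAt (𝓡 4) x₀) p u)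
      (mfderiv (𝓡 4) (𝓡 4) (extChartAt (𝓡 4) x₀) p w) = g.form p u w := by
  obtain ⟨y, hy, rfl⟩ : ∃ y ∈ (extChartAt (𝓡 4) x₀).target, (extChartAt (𝓡 4) x₀).symm y = p :=
    ⟨_, (extChartAt (𝓡 4) x₀).map_source hp, (extChartAt (𝓡 4) x₀).left_inv hp⟩
  rw [(extChartAt (𝓡 4) x₀).right_inv hy]
  exact congrArg₂ (fun a b ↦ g.form ((extChartAt (𝓡 4) x₀).symm y) a b)
    (chartFrame_mfderiv x₀ hy u) (chartFrame_mfderiv x₀ hy w)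

end LorentzMetric

namespace TimeOrientation

variable {g : LorentzMetric M} (T : TimeOrientation g)

theorem inChart_apply_chart {x₀ p : M} (hp : p ∈ (extChartAt (𝓡 4) x₀).source) :
    T.inChart x₀ (extChartAt (𝓡 4) x₀ p)
      = mfderiv (𝓡 4) (𝓡 4) (extChartAt (𝓡 4) x₀) p (T.field p) := by
  obtain ⟨y, hy, rfl⟩ : ∃ y ∈ (extChartAt (𝓡 4) x₀).target, (extChartAt (𝓡 4) x₀).symm y = p :=
    ⟨_, (extChartAt (𝓡 4) x₀).map_source hp, (extChartAt (𝓡 4) x₀).left_inv hp⟩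
  rw [(extChartAt (𝓡 4) x₀).right_inv hy]
  rfl

/-! ### Timelike curves in charts -/

/-- The future-pointing vectors over the points of a chart whose square lies in `S`, in coordinates:
the future timelike vectors for `S = Iio 0`, the future null vectors for `S = {0}`. -/
def futureCone (S : Set ℝ) (x₀ : M) : Set (CoordSpace × CoordSpace) :=
  {z | z.1 ∈ (extChartAt (𝓡 4) x₀).target ∧ g.inChart x₀ z.1 z.2 z.2 ∈ S ∧
    g.inChart x₀ z.1 (T.inChart x₀ z.1) z.2 < 0}

/-- The curve `γ` is, near the parameter `t` of its domain `s`, continuously differentiable, and its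
velocity at `t` is future-pointing with square in `S`. -/
def IsFutureAt (S : Set ℝ) (γ : ℝ → M) (s : Set ℝ) (t : ℝ) : Prop :=
  ContMDiffWithinAt 𝓘(ℝ, ℝ) (𝓡 4) 1 γ s t ∧
    (g.form (γ t) (mfderivWithin 𝓘(ℝ, ℝ) (𝓡 4) γ s t (1 : ℝ))
      (mfderivWithin 𝓘(ℝ, ℝ) (𝓡 4) γ s t (1 : ℝ)) ∈ S) ∧
    T.IsFuturePointing (mfderivWithin 𝓘(ℝ, ℝ) (𝓡 4) γ s t (1 : ℝ) : TangentSpace (𝓡 4) (γ t))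

variable {T}

theorem existsTimelikeCurve_iff {A B : M} : T.ExistsTimelikeCurve A B ↔
    ∃ (γ : ℝ → M) (a b : ℝ), a < b ∧ γ a = A ∧ γ b = B ∧
      ∀ t ∈ Icc a b, T.IsFutureAt (Iio 0) γ (Icc a b) t := by
  constructor
  · rintro ⟨γ, a, b, hab, ha, hb, h1, h2⟩
    exact ⟨γ, a, b, hab, ha, hb, fun t ht ↦ ⟨h1 t ht, h2 t ht⟩⟩
  · rintro ⟨γ, a, b, hab, ha, hb, h⟩
    exact ⟨γ, a, b, hab, ha, hb, fun t ht ↦ (h t ht).1, fun t ht ↦ (h t ht).2⟩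

theorem isFutureAt_iff {S : Set ℝ} {γ : ℝ → M} {s : Set ℝ} {t : ℝ} {x₀ : M}
    (hγ : ContinuousWithinAt γ s t) (ht : γ t ∈ (extChartAt (𝓡 4) x₀).source)
    (hs : UniqueDiffWithinAt ℝ s t) :
    T.IsFutureAt S γ s t ↔ ContDiffWithinAt ℝ 1 (fun u ↦ extChartAt (𝓡 4) x₀ (γ u)) s t ∧
      (extChartAt (𝓡 4) x₀ (γ t), derivWithin (fun u ↦ extChartAt (𝓡 4) x₀ (γ u)) s t)
        ∈ T.futureCone S x₀ := by
  have e : ContMDiffWithinAt 𝓘(ℝ, ℝ) (𝓡 4) 1 γ s t ↔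
      ContDiffWithinAt ℝ 1 (fun u ↦ extChartAt (𝓡 4) x₀ (γ u)) s t := by
    rw [contMDiffWithinAt_iff_target_of_mem_source (I' := 𝓡 4) (y := x₀)
      (by rwa [extChartAt_source] at ht), contMDiffWithinAt_iff_contDiffWithinAt]
    exact and_iff_right hγ
  rw [IsFutureAt, e]
  refine and_congr_right fun hd ↦ ?_
  rw [← mfderiv_chart_velocity ((e.2 hd).mdifferentiableWithinAt one_ne_zero) ht hs]
  simp only [futureCone, mem_ofPred_eq, T.inChart_apply_chart ht]
  rw [g.inChart_mfderiv ht, g.inChart_mfderiv ht]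
  exact (and_iff_right ((extChartAt (𝓡 4) x₀).map_source ht)).symm

theorem continuousOn_coneForms (x₀ : M) :
    ContinuousOn (fun z : CoordSpace × CoordSpace ↦ (g.inChart x₀ z.1 z.2 z.2,
      g.inChart x₀ z.1 (T.inChart x₀ z.1) z.2)) ((extChartAt (𝓡 4) x₀).target ×ˢ univ) := by
  have h1 : ContinuousOn (fun z : CoordSpace × CoordSpace ↦ g.inChart x₀ z.1)
      ((extChartAt (𝓡 4) x₀).target ×ˢ univ) :=
    (g.contDiffOn_inChart x₀).continuousOn.comp continuousOn_fst fun z hz ↦ hz.1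
  have h2 : ContinuousOn (fun z : CoordSpace × CoordSpace ↦ T.inChart x₀ z.1)
      ((extChartAt (𝓡 4) x₀).target ×ˢ univ) :=
    (T.continuousOn_inChart x₀).comp continuousOn_fst fun z hz ↦ hz.1
  exact ((h1.clm_apply continuousOn_snd).clm_apply continuousOn_snd).prodMk
    ((h1.clm_apply h2).clm_apply continuousOn_snd)

theorem isOpen_futureCone (x₀ : M) : IsOpen (T.futureCone (Iio 0) x₀) := by
  have h := (continuousOn_coneForms (T := T) x₀).isOpen_inter_preimage
    ((isOpen_extChartAt_target x₀).prod isOpen_univ)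
    ((isOpen_Iio (a := (0 : ℝ))).prod (isOpen_Iio (a := (0 : ℝ))))
  convert h using 1
  ext z
  simp [futureCone]

theorem futureCone_segment {x₀ : M} {y u v : CoordSpace} (hu : (y, u) ∈ T.futureCone (Iio 0) x₀)
    (hv : (y, v) ∈ T.futureCone (Iio 0) x₀) {σ : ℝ} (hσ : σ ∈ Icc (0 : ℝ) 1) :
    (y, (1 - σ) • u + σ • v) ∈ T.futureCone (Iio 0) x₀ := by
  obtain ⟨hy, hu1, hu2⟩ := hu
  obtain ⟨-, hv1, hv2⟩ := hv
  simp only [mem_Iio] at hy hu1 hu2 hv1 hv2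
  have hL := g.isLorentz_inChart x₀ hy
  have huv := hL.neg_of_causal_of_timelike (T.inChart_timelike x₀ hy) hu1.le hv1 hu2 hv2
  have h01 : 0 ≤ 1 - σ := by linarith [hσ.2]
  have h0 := hσ.1
  refine ⟨hy, ?_, ?_⟩
  · simp only [map_add, map_smul, add_apply, smul_apply, smul_eq_mul, hL.symm v u, mem_Iio]
    rcases h0.eq_or_lt with rfl | h0
    · simpa using hu1
    · nlinarith [mul_pos h0 h0, mul_nonneg h01 h0.le, mul_nonneg h01 h01]
  · simp only [map_add, map_smul, smul_eq_mul]
    rcases h0.eq_or_lt with rfl | h0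
    · simpa using hu2
    · nlinarith [mul_pos h0 (neg_pos.2 hv2), mul_nonneg h01 (neg_pos.2 hu2).le]

theorem IsFutureAt.congr_mono {S : Set ℝ} {γ γ' : ℝ → M} {s s' : Set ℝ} {t : ℝ}
    (h : T.IsFutureAt S γ s t) (hγ' : γ' =ᶠ[𝓝[s'] t] γ) (hss : s ∈ 𝓝[s'] t) (ht : t ∈ s')
    (hs : UniqueDiffWithinAt ℝ s t) (hs' : UniqueDiffWithinAt ℝ s' t) :
    T.IsFutureAt S γ' s' t := by
  have htt : γ' t = γ t := hγ'.self_of_nhdsWithin ht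
  have hsrc : γ t ∈ (extChartAt (𝓡 4) (γ t)).source := mem_extChartAt_source _
  have hc := h.1.continuousWithinAt
  rw [isFutureAt_iff hc hsrc hs] at h
  rw [isFutureAt_iff (x₀ := γ t)
    ((hc.mono_of_mem_nhdsWithin hss).congr_of_eventuallyEq hγ' htt) (by rwa [htt]) hs']
  have he : (fun u ↦ extChartAt (𝓡 4) (γ t) (γ' u))
      =ᶠ[𝓝[s'] t] fun u ↦ extChartAt (𝓡 4) (γ t) (γ u) := hγ'.fun_comp _
  have hd := h.1.mono_of_mem_nhdsWithin hss
  refine ⟨hd.congr_of_eventuallyEq he (by simp only [htt]), ?_⟩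
  rw [he.derivWithin_eq (by simp only [htt]),
    h.1.derivWithin_mono_of_mem_nhdsWithin one_ne_zero hss hs', htt]
  exact h.2

theorem isFutureAt_of_chart {S : Set ℝ} {x : ℝ → CoordSpace} {s : Set ℝ} {t : ℝ} {x₀ : M}
    (hx : ContDiffWithinAt ℝ 1 x s t) (hxt : (x t, derivWithin x s t) ∈ T.futureCone S x₀)
    (ht : t ∈ s) (hs : UniqueDiffWithinAt ℝ s t) :
    T.IsFutureAt S (fun u ↦ (extChartAt (𝓡 4) x₀).symm (x u)) s t := by
  have hy : x t ∈ (extChartAt (𝓡 4) x₀).target := hxt.1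
  have hc : ContinuousWithinAt (fun u ↦ (extChartAt (𝓡 4) x₀).symm (x u)) s t :=
    ((continuousOn_extChartAt_symm (I := 𝓡 4) x₀).continuousAt
      ((isOpen_extChartAt_target x₀).mem_nhds hy)).comp_continuousWithinAt hx.continuousWithinAt
  rw [isFutureAt_iff hc ((extChartAt (𝓡 4) x₀).map_target hy) hs]
  have he : (fun u ↦ extChartAt (𝓡 4) x₀ ((extChartAt (𝓡 4) x₀).symm (x u))) =ᶠ[𝓝[s] t] x := by
    filter_upwards [hx.continuousWithinAt.eventually
      ((isOpen_extChartAt_target (I := 𝓡 4) x₀).mem_nhds hy)] with u hu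
    exact (extChartAt (𝓡 4) x₀).right_inv hu
  have he' := he.self_of_nhdsWithin ht
  refine ⟨hx.congr_of_eventuallyEq he he', ?_⟩
  rw [he.derivWithin_eq he']
  simp only at he'
  rw [he']
  exact hxt

theorem IsFutureAt.comp_affine {S : Set ℝ} {γ : ℝ → M} {s s' : Set ℝ} {l t m : ℝ}
    (h : T.IsFutureAt S γ s (l * t + m)) (hl : 0 < l) (hS : ∀ r ∈ S, l * l * r ∈ S)
    (hs : UniqueDiffWithinAt ℝ s (l * t + m)) (hs' : UniqueDiffWithinAt ℝ s' t)
    (hss : (fun u ↦ l * u + m) '' s' = s) : T.IsFutureAt S (fun u ↦ γ (l * u + m)) s' t := by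
  have hsrc : γ (l * t + m) ∈ (extChartAt (𝓡 4) (γ (l * t + m))).source := mem_extChartAt_source _
  have hc := h.1.continuousWithinAt
  have hmaps : MapsTo (fun u ↦ l * u + m) s' s := hss ▸ mapsTo_image _ _
  rw [isFutureAt_iff hc hsrc hs] at h
  have hc' : ContinuousWithinAt (fun u ↦ γ (l * u + m)) s' t :=
    hc.comp (f := fun u ↦ l * u + m) (by fun_prop) hmaps
  rw [isFutureAt_iff (x₀ := γ (l * t + m)) hc' hsrc hs']
  refine ⟨h.1.comp t (g := fun u ↦ extChartAt (𝓡 4) (γ (l * t + m)) (γ u))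
    (f := fun u ↦ l * u + m) (by fun_prop) hmaps, ?_⟩
  rw [derivWithin_comp_affine (fun u ↦ extChartAt (𝓡 4) (γ (l * t + m)) (γ u)), hss]
  obtain ⟨-, hy, h2, h3⟩ := h
  refine ⟨hy, ?_, ?_⟩
  · simpa [mul_assoc] using hS _ h2
  · simpa using mul_neg_of_pos_of_neg hl h3

theorem ExistsTimelikeCurve.exists_translate {A B : M} (h : T.ExistsTimelikeCurve A B) :
    ∃ l : ℝ, 0 < l ∧ ∀ c, ∃ γ : ℝ → M, γ c = A ∧ γ (c + l) = B ∧
      ∀ t ∈ Icc c (c + l), T.IsFutureAt (Iio 0) γ (Icc c (c + l)) t := by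
  obtain ⟨γ, a, b, hab, ha, hb, h⟩ := existsTimelikeCurve_iff.1 h
  refine ⟨b - a, by linarith, fun c ↦ ⟨fun u ↦ γ (1 * u + (a - c)), by simp [ha], ?_,
    fun t ht ↦ ?_⟩⟩
  · simp only [show 1 * (c + (b - a)) + (a - c) = b by ring, hb]
  · have ht' : 1 * t + (a - c) ∈ Icc a b := ⟨by linarith [ht.1], by linarith [ht.2]⟩
    exact (h _ ht').comp_affine one_pos (by simp) (uniqueDiffOn_Icc hab _ ht')
      (uniqueDiffOn_Icc (by linarith) _ ht) (by simp)

theorem existsTimelikeCurve_of_chart {x : ℝ → CoordSpace} {a b : ℝ} (hab : a < b) {x₀ : M}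
    (hx : ∀ t ∈ Icc a b, ContDiffWithinAt ℝ 1 x (Icc a b) t ∧
      (x t, derivWithin x (Icc a b) t) ∈ T.futureCone (Iio 0) x₀) :
    T.ExistsTimelikeCurve ((extChartAt (𝓡 4) x₀).symm (x a))
      ((extChartAt (𝓡 4) x₀).symm (x b)) :=
  existsTimelikeCurve_iff.2 ⟨_, a, b, hab, rfl, rfl, fun t ht ↦
    isFutureAt_of_chart (hx t ht).1 (hx t ht).2 ht (uniqueDiffOn_Icc hab t ht)⟩

theorem isFutureAt_subinterval {S : Set ℝ} {γ : ℝ → M} {a b c d : ℝ}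
    (h : ∀ t ∈ Icc a b, T.IsFutureAt S γ (Icc a b) t) (hac : a ≤ c) (hcd : c < d) (hdb : d ≤ b) :
    ∀ t ∈ Icc c d, T.IsFutureAt S γ (Icc c d) t := by
  intro t ht
  have hab : a < b := by linarith
  have ht' : t ∈ Icc a b := ⟨hac.trans ht.1, ht.2.trans hdb⟩
  exact (h t ht').congr_mono EventuallyEq.rfl
    (mem_of_superset self_mem_nhdsWithin (Icc_subset_Icc hac hdb)) ht
    (uniqueDiffOn_Icc hab t ht') (uniqueDiffOn_Icc hcd t ht)

/-! ### The chronological relation is transitive and open -/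

/-- Timelike curves laid end to end can be rounded at the joint, within the open convex cones of
future timelike vectors. -/
theorem ExistsTimelikeCurve.trans {A B C : M} (hAB : T.ExistsTimelikeCurve A B)
    (hBC : T.ExistsTimelikeCurve B C) : T.ExistsTimelikeCurve A C := by
  obtain ⟨l, hl, h₁⟩ := hAB.exists_translate
  obtain ⟨l', hl', h₂⟩ := hBC.exists_translate
  obtain ⟨γ₁, hA, hB, h₁⟩ := h₁ (-l)
  obtain ⟨γ₂, hB', hC, h₂⟩ := h₂ 0
  rw [neg_add_cancel] at hB h₁
  rw [zero_add] at hC h₂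
  -- The corner is rounded in the chart at `B`; away from it the curve stays as it is.
  set φ := extChartAt (𝓡 4) B with hφ
  have hu₁ : ∀ t ∈ Icc (-l) 0, UniqueDiffWithinAt ℝ (Icc (-l) 0) t := uniqueDiffOn_Icc (by linarith)
  have hu₂ : ∀ t ∈ Icc 0 l', UniqueDiffWithinAt ℝ (Icc 0 l') t := uniqueDiffOn_Icc hl'
  have hsrc : B ∈ φ.source := mem_extChartAt_source B
  have hopen : IsOpen φ.source := isOpen_extChartAt_source B
  have hl0 : (0 : ℝ) ∈ Icc (-l) 0 := ⟨by linarith, le_rfl⟩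
  have hr0 : (0 : ℝ) ∈ Icc 0 l' := ⟨le_rfl, hl'.le⟩
  have hc₁ := (h₁ 0 hl0).1.continuousWithinAt
  have hc₂ := (h₂ 0 hr0).1.continuousWithinAt
  obtain ⟨hf, hfc⟩ := (isFutureAt_iff hc₁ (by rwa [hB]) (hu₁ 0 hl0)).1 (h₁ 0 hl0)
  obtain ⟨hg, hgc⟩ := (isFutureAt_iff hc₂ (by rwa [hB']) (hu₂ 0 hr0)).1 (h₂ 0 hr0)
  have hmem₁ : Icc (-l) 0 ∈ 𝓝[≤] (0 : ℝ) := Icc_mem_nhdsLE (by linarith)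
  have hmem₂ : Icc 0 l' ∈ 𝓝[≥] (0 : ℝ) := Icc_mem_nhdsGE hl'
  rw [← hf.derivWithin_mono_of_mem_nhdsWithin one_ne_zero hmem₁
    (uniqueDiffOn_Iic (0 : ℝ) 0 self_mem_Iic), hB] at hfc
  rw [← hg.derivWithin_mono_of_mem_nhdsWithin one_ne_zero hmem₂
    (uniqueDiffOn_Ici (0 : ℝ) 0 self_mem_Ici), hB'] at hgc
  have hs₁ : ∀ᶠ t in 𝓝[≤] (0 : ℝ), γ₁ t ∈ φ.source :=
    (hc₁.mono_of_mem_nhdsWithin hmem₁).eventually (hopen.mem_nhds (by rwa [hB]))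
  have hs₂ : ∀ᶠ t in 𝓝[≥] (0 : ℝ), γ₂ t ∈ φ.source :=
    (hc₂.mono_of_mem_nhdsWithin hmem₂).eventually (hopen.mem_nhds (by rwa [hB']))
  obtain ⟨e₁, he₁, hs₁⟩ := (mem_nhdsLE_iff_exists_Icc_subset).1 hs₁
  obtain ⟨e₂, he₂, hs₂⟩ := (mem_nhdsGE_iff_exists_Icc_subset).1 hs₂
  obtain ⟨η, δ, hδ, hδη, hη, c, hc, hcf, hcg⟩ := exists_rounded_corner
    (hf.mono_of_mem_nhdsWithin hmem₁) (hg.mono_of_mem_nhdsWithin hmem₂)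
    (by simp only [hB, hB']) (isOpen_futureCone (T := T) B)
    (by simp only [hB]; exact fun σ hσ ↦ futureCone_segment hfc hgc hσ)
    (η₀ := min (min l l') (min (-e₁) e₂))
    (lt_min (lt_min hl hl') (lt_min (by linarith) he₂))
  simp only [lt_min_iff] at hη
  obtain ⟨⟨hηl, hηl'⟩, hηe₁, hηe₂⟩ := hη
  set Γ : ℝ → M := fun t ↦ if t ≤ -δ then γ₁ t else if δ ≤ t then γ₂ t else φ.symm (c t) with hΓ
  have hΓ₁ : ∀ t ≤ -δ, Γ t = γ₁ t := fun t ht ↦ if_pos ht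
  have hΓ₂ : ∀ t, δ ≤ t → Γ t = γ₂ t := fun t ht ↦ by
    rw [hΓ]; simp only [if_pos ht, if_neg (show ¬ t ≤ -δ by linarith)]
  have hΓ₃ : ∀ t ∈ Ioo (-η) η, Γ t = φ.symm (c t) := by
    intro t ht
    by_cases h : t ≤ -δ
    · rw [hΓ₁ t h, hcf t h]
      exact (φ.left_inv (hs₁ ⟨by linarith [ht.1], by linarith⟩)).symm
    by_cases h' : δ ≤ t
    · rw [hΓ₂ t h', hcg t h']
      exact (φ.left_inv (hs₂ ⟨by linarith, by linarith [ht.2]⟩)).symm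
    · rw [hΓ]; simp only [if_neg h, if_neg h']
  have hu : ∀ t ∈ Icc (-l) l', UniqueDiffWithinAt ℝ (Icc (-l) l') t := uniqueDiffOn_Icc (by linarith)
  refine existsTimelikeCurve_iff.2 ⟨Γ, -l, l', by linarith, ?_, ?_, fun t ht ↦ ?_⟩
  · rw [hΓ₁ _ (by linarith), hA]
  · rw [hΓ₂ _ (by linarith), hC]
  by_cases htη : t ∈ Ioo (-η) η
  · obtain ⟨hct, hcc⟩ := hc t htη
    have hd := (hct.differentiableAt one_ne_zero).derivWithin (hu t ht)
    refine (isFutureAt_of_chart (x₀ := B) hct.contDiffWithinAt (by rwa [hd]) ht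
      (hu t ht)).congr_mono ?_ self_mem_nhdsWithin ht (hu t ht) (hu t ht)
    exact mem_nhdsWithin_of_mem_nhds
      (mem_of_superset (Ioo_mem_nhds htη.1 htη.2) fun u hu' ↦ hΓ₃ u hu')
  · rcases le_or_gt t (-η) with h | h
    · have ht' : t ∈ Icc (-l) 0 := ⟨ht.1, by linarith⟩
      refine (h₁ t ht').congr_mono ?_ ?_ ht (hu₁ t ht') (hu t ht)
      · exact mem_nhdsWithin_of_mem_nhds (mem_of_superset (Iio_mem_nhds (by linarith : t < -δ))
          fun u hu' ↦ hΓ₁ u (le_of_lt hu'))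
      · exact mem_nhdsWithin_iff_exists_mem_nhds_inter.2 ⟨Iio 0, Iio_mem_nhds (by linarith),
          fun u hu' ↦ ⟨hu'.2.1, le_of_lt hu'.1⟩⟩
    · have h' : η ≤ t := by
        by_contra! h'
        exact htη ⟨h, h'⟩
      have ht' : t ∈ Icc 0 l' := ⟨by linarith, ht.2⟩
      refine (h₂ t ht').congr_mono ?_ ?_ ht (hu₂ t ht') (hu t ht)
      · exact mem_nhdsWithin_of_mem_nhds (mem_of_superset (Ioi_mem_nhds (by linarith : δ < t))
          fun u hu' ↦ hΓ₂ u (le_of_lt hu'))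
      · exact mem_nhdsWithin_iff_exists_mem_nhds_inter.2 ⟨Ioi 0, Ioi_mem_nhds (by linarith),
          fun u hu' ↦ ⟨le_of_lt hu'.1, hu'.2.2⟩⟩

/-- Short coordinate segments in nearly the direction of a timelike vector are timelike. -/
theorem eventually_existsTimelikeCurve_segment {x₀ : M} {z : CoordSpace × CoordSpace}
    (hz : z ∈ T.futureCone (Iio 0) x₀) :
    ∀ᶠ p : (CoordSpace × CoordSpace) × ℝ in 𝓝 (z, 0), 0 < p.2 →
      T.ExistsTimelikeCurve ((extChartAt (𝓡 4) x₀).symm p.1.1)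
        ((extChartAt (𝓡 4) x₀).symm (p.1.1 + p.2 • p.1.2)) := by
  have hcont : Continuous (fun p : (CoordSpace × CoordSpace) × ℝ ↦
      ((p.1.1 + p.2 • p.1.2, p.1.2) : CoordSpace × CoordSpace)) := by fun_prop
  have hev : ∀ᶠ p : (CoordSpace × CoordSpace) × ℝ in 𝓝 (z, 0),
      (p.1.1 + p.2 • p.1.2, p.1.2) ∈ T.futureCone (Iio 0) x₀ :=
    hcont.continuousAt.eventually ((isOpen_futureCone x₀).mem_nhds (by simpa using hz))
  obtain ⟨ρ, hρ, hρ'⟩ := Metric.eventually_nhds_iff_ball.1 hev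
  filter_upwards [Metric.ball_mem_nhds _ hρ] with p hp hp0
  have hcone : ∀ s ∈ Icc 0 p.2, (p.1.1 + s • p.1.2, p.1.2) ∈ T.futureCone (Iio 0) x₀ := by
    intro s hs
    refine hρ' (p.1, s) ?_
    rw [Metric.mem_ball, Prod.dist_eq, max_lt_iff, Real.dist_0_eq_abs] at hp ⊢
    refine ⟨hp.1, lt_of_le_of_lt ?_ hp.2⟩
    rw [abs_of_nonneg hs.1, abs_of_pos hp0]
    exact hs.2
  have h := existsTimelikeCurve_of_chart (T := T) (x₀ := x₀) (x := fun s : ℝ ↦ p.1.1 + s • p.1.2)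
    hp0 fun t ht ↦ by
      refine ⟨by fun_prop, ?_⟩
      have hd : HasDerivWithinAt (fun s : ℝ ↦ p.1.1 + s • p.1.2) p.1.2 (Icc 0 p.2) t := by
        simpa using ((hasDerivWithinAt_id t (Icc 0 p.2)).smul_const p.1.2).const_add p.1.1
      rw [hd.derivWithin (uniqueDiffOn_Icc hp0 t ht)]
      exact hcone t ht
  simpa using h

end TimeOrientation

end Timelike

section Push

variable {M : Type*} [TopologicalSpace M] [ChartedSpace (EuclideanSpace ℝ (Fin 4)) M]
  [IsManifold (𝓡 4) ∞ M]

/-- Difference quotients of a `C¹` curve between parameters near `t₀` are close to the velocity at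
`t₀`. Hence a property `P ((y, v), h)` of short segments, from `y` to `y + h • v`, holds for the
chords of the curve near `t₀`. -/
theorem eventually_slope {E : Type*} [NormedAddCommGroup E] [NormedSpace ℝ E] {x : ℝ → E}
    {a b t₀ : ℝ} (hab : a < b) (ht₀ : t₀ ∈ Icc a b) (hx : ContDiffWithinAt ℝ 1 x (Icc a b) t₀)
    {P : (E × E) × ℝ → Prop}
    (hP : ∀ᶠ p in 𝓝 ((x t₀, derivWithin x (Icc a b) t₀), (0 : ℝ)), 0 < p.2 → P p) :
    ∀ᶠ p : ℝ × ℝ in 𝓝 (t₀, t₀), p.1 ∈ Icc a b → p.2 ∈ Icc a b → p.1 < p.2 →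
      P ((x p.1, (p.2 - p.1)⁻¹ • (x p.2 - x p.1)), p.2 - p.1) := by
  obtain ⟨ρ, hρ, hρ'⟩ := Metric.eventually_nhds_iff_ball.1 hP
  have hev := hx.eventually (by simp)
  rw [insert_eq_of_mem ht₀] at hev
  have hd := (hx.derivWithin_right (m := 0) (uniqueDiffOn_Icc hab) (by simp) ht₀).continuousWithinAt
  have hd' := hd.eventually (Metric.closedBall_mem_nhds _ (half_pos hρ))
  have hx' := hx.continuousWithinAt.eventually (Metric.ball_mem_nhds _ hρ)
  have hall := hev.and (hd'.and hx')
  rw [eventually_nhdsWithin_iff] at hall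
  obtain ⟨ε, hε, hε'⟩ := Metric.eventually_nhds_iff_ball.1 hall
  filter_upwards [Metric.ball_mem_nhds _ (lt_min hε (half_pos hρ))] with p hp h1 h2 hlt
  rw [Metric.mem_ball, Prod.dist_eq, max_lt_iff, lt_min_iff, lt_min_iff, Real.dist_eq,
    Real.dist_eq] at hp
  obtain ⟨⟨hp1, hp1'⟩, hp2, hp2'⟩ := hp
  have hpos : 0 < p.2 - p.1 := sub_pos.2 hlt
  have hbound :=
    ((convex_Icc a b).inter (convex_ball t₀ ε)).norm_image_sub_le_of_norm_hasDerivWithin_le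
    (f := fun u ↦ x u - u • derivWithin x (Icc a b) t₀)
    (f' := fun u ↦ derivWithin x (Icc a b) u - derivWithin x (Icc a b) t₀) (C := ρ / 2)
    (fun u hu ↦ by
      have h := ((hε' u hu.2 hu.1).1.differentiableWithinAt one_ne_zero).hasDerivWithinAt.sub
        ((hasDerivWithinAt_id u (Icc a b)).smul_const (derivWithin x (Icc a b) t₀))
      rw [one_smul] at h
      exact h.mono inter_subset_left)
    (fun u hu ↦ by
      rw [← dist_eq_norm]
      exact (hε' u hu.2 hu.1).2.1)
    (x := p.1) (y := p.2) ⟨h1, by rwa [Metric.mem_ball, Real.dist_eq]⟩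
    ⟨h2, by rwa [Metric.mem_ball, Real.dist_eq]⟩
  refine hρ' _ ?_ hpos
  rw [Metric.mem_ball, Prod.dist_eq, Prod.dist_eq, max_lt_iff, max_lt_iff]
  refine ⟨⟨(hε' p.1 (by rwa [Metric.mem_ball, Real.dist_eq]) h1).2.2, ?_⟩, ?_⟩
  · rw [dist_eq_norm]
    have e : (p.2 - p.1)⁻¹ • (x p.2 - x p.1) - derivWithin x (Icc a b) t₀
        = (p.2 - p.1)⁻¹ • ((x p.2 - p.2 • derivWithin x (Icc a b) t₀)
          - (x p.1 - p.1 • derivWithin x (Icc a b) t₀)) := by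
      have : (p.2 - p.1)⁻¹ • ((p.2 - p.1) • derivWithin x (Icc a b) t₀)
          = derivWithin x (Icc a b) t₀ := by
        rw [smul_smul, inv_mul_cancel₀ hpos.ne', one_smul]
      conv_lhs => rw [← this]
      rw [← smul_sub]
      congr 1
      module
    simp only [e]
    rw [norm_smul, norm_inv, Real.norm_of_nonneg hpos.le]
    calc (p.2 - p.1)⁻¹ * _ ≤ (p.2 - p.1)⁻¹ * (ρ / 2 * ‖p.2 - p.1‖) := by gcongr
      _ = ρ / 2 := by rw [Real.norm_of_nonneg hpos.le]; field_simp
      _ < ρ := by linarith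
  · rw [Real.dist_0_eq_abs, abs_of_pos hpos]
    linarith [abs_lt.1 hp1', abs_lt.1 hp2', (abs_lt.1 hp1').1, (abs_lt.1 hp2').2]

namespace TimeOrientation

variable {g : LorentzMetric M} {T : TimeOrientation g}

theorem tendsto_chart_symm {N : Type*} [TopologicalSpace N]
    [ChartedSpace (EuclideanSpace ℝ (Fin 4)) N] {x₀ p : N} (hp : p ∈ (extChartAt (𝓡 4) x₀).source) :
    Tendsto (extChartAt (𝓡 4) x₀).symm (𝓝 (extChartAt (𝓡 4) x₀ p)) (𝓝 p) := by
  have h := (continuousOn_extChartAt_symm (I := 𝓡 4) x₀).continuousAt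
    ((isOpen_extChartAt_target x₀).mem_nhds ((extChartAt (𝓡 4) x₀).map_source hp))
  rw [ContinuousAt, (extChartAt (𝓡 4) x₀).left_inv hp] at h
  exact h

/-- The chronological future of a point is open. -/
theorem ExistsTimelikeCurve.eventually_right {A B : M} (hAB : T.ExistsTimelikeCurve A B) :
    ∀ᶠ B' in 𝓝 B, T.ExistsTimelikeCurve A B' := by
  obtain ⟨γ, a, b, hab, rfl, rfl, h⟩ := existsTimelikeCurve_iff.1 hAB
  have hbm : b ∈ Icc a b := right_mem_Icc.2 hab.le
  have hsrc : γ b ∈ (extChartAt (𝓡 4) (γ b)).source := mem_extChartAt_source _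
  obtain ⟨hx, hcone⟩ := (isFutureAt_iff (h b hbm).1.continuousWithinAt hsrc
    (uniqueDiffOn_Icc hab b hbm)).1 (h b hbm)
  have hslope := eventually_slope hab hbm hx
    ((eventually_existsTimelikeCurve_segment hcone).eventually_nhds.mono fun p hp _ ↦ hp)
  have hmem : ∀ᶠ s in 𝓝[<] b, s ∈ Ioo a b := Ioo_mem_nhdsLT hab
  have hs : ∀ᶠ s in 𝓝[<] b, γ s ∈ (extChartAt (𝓡 4) (γ b)).source :=
    ((h b hbm).1.continuousWithinAt.eventually
      ((isOpen_extChartAt_source (I := 𝓡 4) (γ b)).mem_nhds hsrc)).filter_mono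
      (nhdsWithin_le_of_mem (mem_of_superset (Ioo_mem_nhdsLT hab) Ioo_subset_Icc_self))
  have htend : Tendsto (fun s : ℝ ↦ (s, b)) (𝓝[<] b) (𝓝 (b, b)) :=
    (tendsto_id'.2 nhdsWithin_le_nhds).prodMk_nhds tendsto_const_nhds
  obtain ⟨s, ⟨⟨has, hsb⟩, hssrc⟩, hseg⟩ := ((hmem.and hs).and (htend.eventually hslope)).exists
  have hpos : 0 < b - s := sub_pos.2 hsb
  have hcont : ContinuousAt (fun B' : M ↦ (((extChartAt (𝓡 4) (γ b) (γ s),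
      (b - s)⁻¹ • (extChartAt (𝓡 4) (γ b) B' - extChartAt (𝓡 4) (γ b) (γ s))), b - s) :
        (CoordSpace × CoordSpace) × ℝ)) (γ b) :=
    ContinuousAt.comp (f := extChartAt (𝓡 4) (γ b)) (g := fun y : CoordSpace ↦
      (((extChartAt (𝓡 4) (γ b) (γ s), (b - s)⁻¹ • (y - extChartAt (𝓡 4) (γ b) (γ s))), b - s) :
        (CoordSpace × CoordSpace) × ℝ)) (by fun_prop) (continuousAt_extChartAt (γ b))
  filter_upwards [hcont.eventually (hseg ⟨has.le, hsb.le⟩ hbm hsb),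
    (isOpen_extChartAt_source (I := 𝓡 4) (γ b)).mem_nhds hsrc] with B' hB' hB'src
  have h2 := hB' hpos
  simp only [smul_smul, mul_inv_cancel₀ hpos.ne', one_smul, add_sub_cancel] at h2
  rw [(extChartAt (𝓡 4) (γ b)).left_inv hssrc, (extChartAt (𝓡 4) (γ b)).left_inv hB'src] at h2
  exact (existsTimelikeCurve_iff.2 ⟨γ, a, s, has, rfl, rfl,
    isFutureAt_subinterval h le_rfl has hsb.le⟩).trans h2

/-- The chronological past of a point is open. -/
theorem ExistsTimelikeCurve.eventually_left {A B : M} (hAB : T.ExistsTimelikeCurve A B) :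
    ∀ᶠ A' in 𝓝 A, T.ExistsTimelikeCurve A' B := by
  obtain ⟨γ, a, b, hab, rfl, rfl, h⟩ := existsTimelikeCurve_iff.1 hAB
  have ham : a ∈ Icc a b := left_mem_Icc.2 hab.le
  have hsrc : γ a ∈ (extChartAt (𝓡 4) (γ a)).source := mem_extChartAt_source _
  obtain ⟨hx, hcone⟩ := (isFutureAt_iff (h a ham).1.continuousWithinAt hsrc
    (uniqueDiffOn_Icc hab a ham)).1 (h a ham)
  have hslope := eventually_slope hab ham hx
    ((eventually_existsTimelikeCurve_segment hcone).eventually_nhds.mono fun p hp _ ↦ hp)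
  have hmem : ∀ᶠ s in 𝓝[>] a, s ∈ Ioo a b := Ioo_mem_nhdsGT hab
  have hs : ∀ᶠ s in 𝓝[>] a, γ s ∈ (extChartAt (𝓡 4) (γ a)).source :=
    ((h a ham).1.continuousWithinAt.eventually
      ((isOpen_extChartAt_source (I := 𝓡 4) (γ a)).mem_nhds hsrc)).filter_mono
      (nhdsWithin_le_of_mem (mem_of_superset (Ioo_mem_nhdsGT hab) Ioo_subset_Icc_self))
  have htend : Tendsto (fun s : ℝ ↦ (a, s)) (𝓝[>] a) (𝓝 (a, a)) :=
    tendsto_const_nhds.prodMk_nhds (tendsto_id'.2 nhdsWithin_le_nhds)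
  obtain ⟨s, ⟨⟨has, hsb⟩, hssrc⟩, hseg⟩ := ((hmem.and hs).and (htend.eventually hslope)).exists
  have hpos : 0 < s - a := sub_pos.2 has
  have hcont : ContinuousAt (fun A' : M ↦ (((extChartAt (𝓡 4) (γ a) A',
      (s - a)⁻¹ • (extChartAt (𝓡 4) (γ a) (γ s) - extChartAt (𝓡 4) (γ a) A')), s - a) :
        (CoordSpace × CoordSpace) × ℝ)) (γ a) :=
    ContinuousAt.comp (f := extChartAt (𝓡 4) (γ a)) (g := fun y : CoordSpace ↦
      (((y, (s - a)⁻¹ • (extChartAt (𝓡 4) (γ a) (γ s) - y)), s - a) :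
        (CoordSpace × CoordSpace) × ℝ)) (by fun_prop) (continuousAt_extChartAt (γ a))
  filter_upwards [hcont.eventually (hseg ham ⟨has.le, hsb.le⟩ has),
    (isOpen_extChartAt_source (I := 𝓡 4) (γ a)).mem_nhds hsrc] with A' hA' hA'src
  have h2 := hA' hpos
  simp only [smul_smul, mul_inv_cancel₀ hpos.ne', one_smul, add_sub_cancel] at h2
  rw [(extChartAt (𝓡 4) (γ a)).left_inv hssrc, (extChartAt (𝓡 4) (γ a)).left_inv hA'src] at h2
  exact h2.trans (existsTimelikeCurve_iff.2 ⟨γ, s, b, hsb, rfl, rfl,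
    isFutureAt_subinterval h has.le hsb le_rfl⟩)

/-! ### Timelike curves absorb null curves -/

/-- Moving the position of a null vector by `ε r` and the vector itself by `ε`, both in the
direction of the time orientation, gives a timelike vector, provided that `ε > 0` and `r` are
small: to first order in `ε` the square changes by `ε (O(r) + 2 g(V, v))`, with `g(V, v) < 0`. -/
theorem eventually_push_mem_futureCone {x₀ : M} {z : CoordSpace × CoordSpace}
    (hz : z ∈ T.futureCone {0} x₀) :
    ∀ᶠ p : ((CoordSpace × CoordSpace) × ℝ) × ℝ in 𝓝 ((z, 0), 0), 0 < p.2 →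
      g.inChart x₀ p.1.1.1 p.1.1.2 p.1.1.2 = 0 →
      (p.1.1.1 + (p.2 * p.1.2) • T.inChart x₀ z.1, p.1.1.2 + p.2 • T.inChart x₀ z.1)
        ∈ T.futureCone (Iio 0) x₀ := by
  obtain ⟨hy, h0, hfut⟩ := hz
  set V := T.inChart x₀ z.1 with hV
  set q : CoordSpace × CoordSpace → ℝ := fun w ↦ g.inChart x₀ w.1 w.2 w.2 with hq
  have hL := g.isLorentz_inChart x₀ hy
  have hqd : ContDiffAt ℝ ∞ q z :=
    (((g.contDiffAt_inChart x₀ hy).comp z contDiffAt_fst).clm_apply contDiffAt_snd).clm_apply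
      contDiffAt_snd
  have hstrict : HasStrictFDerivAt q (fderiv ℝ q z) z := hqd.hasStrictFDerivAt (by simp)
  have hdir : fderiv ℝ q z (0, V) = 2 * g.inChart x₀ z.1 V z.2 := by
    have h1 : HasDerivAt (fun s : ℝ ↦ q (z + s • ((0, V) : CoordSpace × CoordSpace)))
        (fderiv ℝ q z (0, V)) 0 := by
      have hl : HasDerivAt (fun s : ℝ ↦ z + s • ((0, V) : CoordSpace × CoordSpace)) (0, V) 0 := by
        simpa using ((hasDerivAt_id (0 : ℝ)).smul_const ((0, V) : CoordSpace × CoordSpace)).const_add z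
      exact HasFDerivAt.comp_hasDerivAt (x := (0 : ℝ)) (l := q) (l' := fderiv ℝ q z)
        (by simpa using hstrict.hasFDerivAt) hl
    have h2 : HasDerivAt (fun s : ℝ ↦ q (z + s • ((0, V) : CoordSpace × CoordSpace)))
        (2 * g.inChart x₀ z.1 V z.2) 0 := by
      have e : (fun s : ℝ ↦ q (z + s • ((0, V) : CoordSpace × CoordSpace)))
          = fun s : ℝ ↦ q z + s * (2 * g.inChart x₀ z.1 V z.2) + s ^ 2 * g.inChart x₀ z.1 V V := by
        funext s
        simp [hq, hL.symm z.2 V]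
        ring
      rw [e]
      exact ((((hasDerivAt_id (0 : ℝ)).mul_const (2 * g.inChart x₀ z.1 V z.2)).const_add (q z)).add
        ((hasDerivAt_pow 2 (0 : ℝ)).mul_const (g.inChart x₀ z.1 V V))).congr_deriv (by simp)
    exact h1.unique h2
  set κ := - g.inChart x₀ z.1 V z.2 with hκ
  have hκpos : 0 < κ := by linarith
  have h1 : ∀ᶠ p : ((CoordSpace × CoordSpace) × ℝ) × ℝ in 𝓝 ((z, 0), 0),
      fderiv ℝ q z (p.1.2 • V, V) < -κ ∧ |p.1.2| < 1 := by
    have hc : Continuous (fun p : ((CoordSpace × CoordSpace) × ℝ) × ℝ ↦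
        fderiv ℝ q z (p.1.2 • V, V)) := by fun_prop
    have hc' : Continuous (fun p : ((CoordSpace × CoordSpace) × ℝ) × ℝ ↦ |p.1.2|) := by fun_prop
    refine (hc.continuousAt.eventually (gt_mem_nhds ?_)).and
      (hc'.continuousAt.eventually (gt_mem_nhds (by simp)))
    simp only [zero_smul, hdir]
    linarith
  have h2 : ∀ᶠ p : ((CoordSpace × CoordSpace) × ℝ) × ℝ in 𝓝 ((z, 0), 0),
      ‖q (p.1.1 + p.2 • ((p.1.2 • V, V) : CoordSpace × CoordSpace)) - q p.1.1
        - fderiv ℝ q z (p.2 • ((p.1.2 • V, V) : CoordSpace × CoordSpace))‖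
        ≤ κ / (2 * (‖V‖ + 1)) * ‖p.2 • ((p.1.2 • V, V) : CoordSpace × CoordSpace)‖ := by
    have := (hasStrictFDerivAt_iff_isLittleO.1 hstrict).def
      (show 0 < κ / (2 * (‖V‖ + 1)) by positivity)
    have hc : Continuous (fun p : ((CoordSpace × CoordSpace) × ℝ) × ℝ ↦
        ((p.1.1 + p.2 • ((p.1.2 • V, V) : CoordSpace × CoordSpace), p.1.1) :
          (CoordSpace × CoordSpace) × (CoordSpace × CoordSpace))) := by fun_prop
    have ht := hc.tendsto ((z, 0), 0)
    simp only [zero_smul, add_zero] at ht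
    refine (ht.eventually this).mono fun p hp ↦ ?_
    simpa only [add_sub_cancel_left] using hp
  have h3 : ∀ᶠ p : ((CoordSpace × CoordSpace) × ℝ) × ℝ in 𝓝 ((z, 0), 0),
      p.1.1.1 + (p.2 * p.1.2) • V ∈ (extChartAt (𝓡 4) x₀).target ∧
      g.inChart x₀ (p.1.1.1 + (p.2 * p.1.2) • V) (T.inChart x₀ (p.1.1.1 + (p.2 * p.1.2) • V))
        (p.1.1.2 + p.2 • V) < 0 := by
    have hc : Continuous (fun p : ((CoordSpace × CoordSpace) × ℝ) × ℝ ↦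
        ((p.1.1.1 + (p.2 * p.1.2) • V, p.1.1.2 + p.2 • V) : CoordSpace × CoordSpace)) := by fun_prop
    have ht := hc.tendsto ((z, 0), 0)
    simp only [zero_smul, add_zero, mul_zero] at ht
    have hop : ∀ᶠ w in 𝓝 z, w.1 ∈ (extChartAt (𝓡 4) x₀).target ∧
        g.inChart x₀ w.1 (T.inChart x₀ w.1) w.2 < 0 := by
      have hnh : (extChartAt (𝓡 4) x₀).target ×ˢ univ ∈ 𝓝 z :=
        ((isOpen_extChartAt_target x₀).prod isOpen_univ).mem_nhds ⟨hy, mem_univ _⟩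
      have := ((continuousOn_coneForms (T := T) x₀).continuousAt hnh).snd
      exact (Filter.eventually_of_mem hnh fun w hw ↦ hw.1).and (this.eventually (gt_mem_nhds hfut))
    exact ht.eventually hop
  filter_upwards [h1, h2, h3] with p hp1 hp2 hp3 hε hq0
  refine ⟨hp3.1, ?_, hp3.2⟩
  have hnorm : ‖((p.1.2 • V, V) : CoordSpace × CoordSpace)‖ ≤ ‖V‖ := by
    rw [Prod.norm_def]
    refine max_le ?_ le_rfl
    rw [norm_smul]
    exact mul_le_of_le_one_left (norm_nonneg _) hp1.2.le
  have hq0' : q p.1.1 = 0 := hq0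
  rw [hq0', sub_zero, map_smul, norm_smul, Real.norm_of_nonneg hε.le, smul_eq_mul] at hp2
  have hle := (abs_le.1 (Real.norm_eq_abs _ ▸ hp2)).2
  have hsm : κ / (2 * (‖V‖ + 1)) * (p.2 * ‖((p.1.2 • V, V) : CoordSpace × CoordSpace)‖)
      ≤ p.2 * (κ / 2) := by
    calc _ ≤ κ / (2 * (‖V‖ + 1)) * (p.2 * (‖V‖ + 1)) := by gcongr; linarith
      _ = p.2 * (κ / 2) := by field_simp
  have hfin : q (p.1.1 + p.2 • ((p.1.2 • V, V) : CoordSpace × CoordSpace)) < 0 := by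
    nlinarith [mul_pos hε hκpos, mul_lt_mul_of_pos_left hp1.1 hε]
  have e : p.1.1 + p.2 • ((p.1.2 • V, V) : CoordSpace × CoordSpace)
      = (p.1.1.1 + (p.2 * p.1.2) • V, p.1.1.2 + p.2 • V) := by
    ext1 <;> simp [smul_smul]
  rw [e] at hfin
  exact hfin

/-- Pushing a short piece of a null curve along the time orientation, by an amount which increases
linearly and vanishes at the parameter `c`, gives a timelike curve. -/
theorem eventually_push_null {γ : ℝ → M} {a b t₀ : ℝ} (hab : a < b)
    (h : ∀ t ∈ Icc a b, T.IsFutureAt {0} γ (Icc a b) t) (ht₀ : t₀ ∈ Icc a b) :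
    ∃ V : CoordSpace, ∀ᶠ p : ℝ × ℝ in 𝓝 (t₀, t₀), p.1 ∈ Icc a b → p.2 ∈ Icc a b →
      γ p.1 ∈ (extChartAt (𝓡 4) (γ t₀)).source ∧ γ p.2 ∈ (extChartAt (𝓡 4) (γ t₀)).source ∧
      (p.1 < p.2 → ∀ c ∈ Icc p.1 p.2, ∀ᶠ ε : ℝ in 𝓝[>] 0, T.ExistsTimelikeCurve
        ((extChartAt (𝓡 4) (γ t₀)).symm
          (extChartAt (𝓡 4) (γ t₀) (γ p.1) + (ε * (p.1 - c)) • V))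
        ((extChartAt (𝓡 4) (γ t₀)).symm
          (extChartAt (𝓡 4) (γ t₀) (γ p.2) + (ε * (p.2 - c)) • V))) := by
  set φ := extChartAt (𝓡 4) (γ t₀) with hφ
  set x : ℝ → CoordSpace := fun u ↦ φ (γ u) with hx
  have hsrc : γ t₀ ∈ φ.source := mem_extChartAt_source _
  have hu := uniqueDiffOn_Icc hab
  obtain ⟨hxd, hcone⟩ := (isFutureAt_iff (h t₀ ht₀).1.continuousWithinAt hsrc (hu t₀ ht₀)).1 (h t₀ ht₀)
  refine ⟨T.inChart (γ t₀) (φ (γ t₀)), ?_⟩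
  set V := T.inChart (γ t₀) (φ (γ t₀)) with hV
  obtain ⟨ρ, hρ, hρ'⟩ := Metric.eventually_nhds_iff_ball.1 (eventually_push_mem_futureCone hcone)
  have hcd : ContinuousWithinAt (fun u ↦ (x u, derivWithin x (Icc a b) u)) (Icc a b) t₀ :=
    hxd.continuousWithinAt.prodMk
      (hxd.derivWithin_right (m := 0) hu (by simp) ht₀).continuousWithinAt
  have hall := ((h t₀ ht₀).1.continuousWithinAt.eventually
    ((isOpen_extChartAt_source (I := 𝓡 4) (γ t₀)).mem_nhds hsrc)).and
    (hcd.eventually (Metric.ball_mem_nhds _ hρ))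
  rw [eventually_nhdsWithin_iff] at hall
  obtain ⟨ε₁, hε₁, hε'⟩ := Metric.eventually_nhds_iff_ball.1 hall
  filter_upwards [Metric.ball_mem_nhds _ (lt_min hε₁ (half_pos hρ))] with p hp h1 h2
  rw [Metric.mem_ball, Prod.dist_eq, max_lt_iff, lt_min_iff, lt_min_iff, Real.dist_eq,
    Real.dist_eq] at hp
  obtain ⟨⟨hp1, hp1'⟩, hp2, hp2'⟩ := hp
  rw [abs_lt] at hp1 hp1' hp2 hp2'
  have hball : ∀ u ∈ Icc p.1 p.2, u ∈ Metric.ball t₀ ε₁ ∧ u ∈ Icc a b := by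
    intro u hu'
    refine ⟨?_, h1.1.trans hu'.1, hu'.2.trans h2.2⟩
    rw [Metric.mem_ball, Real.dist_eq, abs_lt]
    constructor <;> linarith [hu'.1, hu'.2]
  refine ⟨(hε' p.1 (by rw [Metric.mem_ball, Real.dist_eq, abs_lt]; exact hp1) h1).1,
    (hε' p.2 (by rw [Metric.mem_ball, Real.dist_eq, abs_lt]; exact hp2) h2).1, fun hlt c hc ↦ ?_⟩
  filter_upwards [Ioo_mem_nhdsGT hρ] with ε hε
  refine existsTimelikeCurve_of_chart (x := fun u ↦ x u + (ε * (u - c)) • V) hlt fun u hu' ↦ ?_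
  obtain ⟨hub, huI⟩ := hball u hu'
  obtain ⟨hus, hux⟩ := hε' u hub huI
  obtain ⟨hxu, hcu⟩ := (isFutureAt_iff (h u huI).1.continuousWithinAt hus (hu u huI)).1 (h u huI)
  have hxu' : ContDiffWithinAt ℝ 1 x (Icc p.1 p.2) u := hxu.mono (Icc_subset_Icc h1.1 h2.2)
  have hlin : ContDiff ℝ 1 (fun u : ℝ ↦ (ε * (u - c)) • V) := by fun_prop
  refine ⟨hxu'.add hlin.contDiffWithinAt, ?_⟩
  have hd : HasDerivWithinAt (fun u ↦ x u + (ε * (u - c)) • V)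
      (derivWithin x (Icc a b) u + ε • V) (Icc p.1 p.2) u := by
    refine ((hxu.differentiableWithinAt one_ne_zero).hasDerivWithinAt.mono
      (Icc_subset_Icc h1.1 h2.2)).add ?_
    have : HasDerivWithinAt (fun u : ℝ ↦ ε * (u - c)) ε (Icc p.1 p.2) u := by
      simpa using ((hasDerivWithinAt_id u (Icc p.1 p.2)).sub_const c).const_mul ε
    exact this.smul_const V
  rw [hd.derivWithin (uniqueDiffOn_Icc hlt u hu')]
  refine hρ' (((x u, derivWithin x (Icc a b) u), u - c), ε) ?_ hε.1 hcu.2.1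
  rw [Metric.mem_ball, Prod.dist_eq, Prod.dist_eq, max_lt_iff, max_lt_iff, Real.dist_0_eq_abs,
    Real.dist_0_eq_abs, abs_lt, abs_lt]
  refine ⟨⟨hux, ?_, ?_⟩, ?_, hε.2⟩ <;> linarith [hu'.1, hu'.2, hc.1, hc.2, hε.1]

theorem tendsto_push {N : Type*} [TopologicalSpace N]
    [ChartedSpace (EuclideanSpace ℝ (Fin 4)) N] {x₀ p : N} (hp : p ∈ (extChartAt (𝓡 4) x₀).source)
    (c : ℝ) (V : CoordSpace) :
    Tendsto (fun ε : ℝ ↦ (extChartAt (𝓡 4) x₀).symm (extChartAt (𝓡 4) x₀ p + (ε * c) • V))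
      (𝓝[>] 0) (𝓝 p) := by
  refine (tendsto_chart_symm hp).comp ?_
  have : Continuous (fun ε : ℝ ↦ extChartAt (𝓡 4) x₀ p + (ε * c) • V) := by fun_prop
  have h := (this.tendsto 0).mono_left (nhdsWithin_le_nhds (s := Ioi 0))
  simpa using h

/-- A timelike curve followed by a null curve can be replaced by a timelike curve. -/
theorem ExistsTimelikeCurve.trans_null {γ : ℝ → M} {a b : ℝ} (hab : a < b)
    (h : ∀ t ∈ Icc a b, T.IsFutureAt {0} γ (Icc a b) t) {A : M}
    (hA : T.ExistsTimelikeCurve A (γ a)) : T.ExistsTimelikeCurve A (γ b) := by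
  refine interval_propagation hab.le (Q := fun t ↦ T.ExistsTimelikeCurve A (γ t)) (fun t₀ ht₀ ↦ ?_) hA
  obtain ⟨V, hV⟩ := eventually_push_null hab h ht₀
  filter_upwards [hV] with p hp h1 h2 hle hA
  obtain ⟨hs1, hs2, hp⟩ := hp h1 h2
  rcases hle.eq_or_lt with heq | hlt
  · rwa [← heq]
  have hev := (hp hlt p.2 (right_mem_Icc.2 hle)).and
    ((tendsto_push hs1 (p.1 - p.2) V).eventually hA.eventually_right)
  -- The pushed curve starts close to `γ p.1`, in the future of `A`, and ends at `γ p.2`.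
  obtain ⟨ε, h3, h4⟩ := hev.exists
  rw [sub_self, mul_zero, zero_smul, add_zero, (extChartAt (𝓡 4) (γ t₀)).left_inv hs2] at h3
  exact h4.trans h3

/-- A null curve followed by a timelike curve can be replaced by a timelike curve. -/
theorem ExistsTimelikeCurve.null_trans {γ : ℝ → M} {a b : ℝ} (hab : a < b)
    (h : ∀ t ∈ Icc a b, T.IsFutureAt {0} γ (Icc a b) t) {B : M}
    (hB : T.ExistsTimelikeCurve (γ b) B) : T.ExistsTimelikeCurve (γ a) B := by
  by_contra hA
  refine interval_propagation hab.le (Q := fun t ↦ ¬ T.ExistsTimelikeCurve (γ t) B)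
    (fun t₀ ht₀ ↦ ?_) hA hB
  obtain ⟨V, hV⟩ := eventually_push_null hab h ht₀
  filter_upwards [hV] with p hp h1 h2 hle
  refine mt fun hB ↦ ?_
  obtain ⟨hs1, hs2, hp⟩ := hp h1 h2
  rcases hle.eq_or_lt with heq | hlt
  · rwa [heq]
  have hev := (hp hlt p.1 (left_mem_Icc.2 hle)).and
    ((tendsto_push hs2 (p.2 - p.1) V).eventually hB.eventually_left)
  obtain ⟨ε, h3, h4⟩ := hev.exists
  rw [sub_self, mul_zero, zero_smul, add_zero, (extChartAt (𝓡 4) (γ t₀)).left_inv hs1] at h3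
  exact h3.trans h4

end TimeOrientation

end Push

section Geodesic

variable {M : Type*} [TopologicalSpace M] [ChartedSpace (EuclideanSpace ℝ (Fin 4)) M]
  [IsManifold (𝓡 4) ∞ M]

/-! ### The geodesic equation at a parameter -/

/-- The first two derivatives of a curve within a set depend only on the germ of the curve. -/
theorem derivWithin_jet_congr {E : Type*} [NormedAddCommGroup E] [NormedSpace ℝ E]
    {x y : ℝ → E} {s s' : Set ℝ} {t : ℝ} (hx : ContDiffWithinAt ℝ 2 x s t)
    (hyx : y =ᶠ[𝓝[s'] t] x) (hss : s ∈ 𝓝[s'] t) (ht : t ∈ s) (ht' : t ∈ s')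
    (hs : UniqueDiffOn ℝ s) (hs' : UniqueDiffOn ℝ s') :
    derivWithin y s' t = derivWithin x s t ∧
      derivWithin (derivWithin y s') s' t = derivWithin (derivWithin x s) s t := by
  have hev := hx.eventually (by simp)
  rw [insert_eq_of_mem ht] at hev
  have hev' := hev.filter_mono (nhdsWithin_le_of_mem hss)
  have hss' : ∀ᶠ u in 𝓝[s'] t, s ∈ 𝓝[s'] u := eventually_mem_nhdsWithin_iff.2 hss
  have hyx' : ∀ᶠ u in 𝓝[s'] t, y =ᶠ[𝓝[s'] u] x := eventually_eventually_nhdsWithin.2 hyx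
  have hfirst : derivWithin y s' =ᶠ[𝓝[s'] t] derivWithin x s := by
    filter_upwards [hev', hss', hyx', self_mem_nhdsWithin] with u h1 h2 h3 h4
    rw [h3.derivWithin_eq (h3.self_of_nhdsWithin h4)]
    exact h1.derivWithin_mono_of_mem_nhdsWithin two_ne_zero h2 (hs' u h4)
  have h0 := hfirst.self_of_nhdsWithin ht'
  refine ⟨h0, ?_⟩
  rw [hfirst.derivWithin_eq h0]
  exact (hx.derivWithin_right (m := 1) hs (by norm_num) ht).derivWithin_mono_of_mem_nhdsWithin
    one_ne_zero hss (hs' t ht')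

namespace LorentzMetric

variable (g : LorentzMetric M)

theorem fderiv_inChart_apply {x₀ : M} {y : CoordSpace} (hy : y ∈ (extChartAt (𝓡 4) x₀).target)
    (u v w : CoordSpace) :
    fderiv ℝ (g.chartForm x₀ v w) y u = fderiv ℝ (g.inChart x₀) y u v w := by
  have h := ((g.contDiffAt_inChart x₀ hy).differentiableAt (by simp)).hasFDerivAt
  have h2 := (h.clm_apply (hasFDerivAt_const v y)).clm_apply (hasFDerivAt_const w y)
  rw [g.chartForm_eq, h2.fderiv]
  simp

theorem christoffel_eq {x₀ : M} {y : CoordSpace} (hy : y ∈ (extChartAt (𝓡 4) x₀).target)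
    (u v w : CoordSpace) :
    g.christoffel x₀ y u v w = (fderiv ℝ (g.inChart x₀) y u v w + fderiv ℝ (g.inChart x₀) y v u w
      - fderiv ℝ (g.inChart x₀) y w u v) / 2 := by
  simp only [christoffel, g.fderiv_inChart_apply hy]

theorem christoffel_smul {x₀ : M} {y : CoordSpace} (hy : y ∈ (extChartAt (𝓡 4) x₀).target)
    (l : ℝ) (v w : CoordSpace) :
    g.christoffel x₀ y (l • v) (l • v) w = l * (l * g.christoffel x₀ y v v w) := by
  rw [g.christoffel_eq hy, g.christoffel_eq hy]
  generalize fderiv ℝ (g.inChart x₀) y = D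
  have h1 : D (l • v) (l • v) w = l * (l * D v v w) := by
    rw [D.map_smul, smul_apply, (D v).map_smul]; rfl
  have h2 : D w (l • v) (l • v) = l * (l * D w v v) := by
    rw [(D w).map_smul, smul_apply, (D w v).map_smul]; rfl
  rw [h1, h2]
  ring

/-- The geodesic equation for a coordinate curve `x` on the domain `s` at the parameter `t`. -/
def GeodesicEquationAt (x₀ : M) (x : ℝ → CoordSpace) (s : Set ℝ) (t : ℝ) : Prop :=
  ∀ w, g.chartForm x₀ (derivWithin (derivWithin x s) s t) w (x t)
    + g.christoffel x₀ (x t) (derivWithin x s t) (derivWithin x s t) w = 0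

end LorentzMetric

namespace TimeOrientation

variable {g : LorentzMetric M} (T : TimeOrientation g)

/-- The curve `γ` on the domain `s` is, near the parameter `t`, twice continuously differentiable,
and satisfies at `t` the conditions on a future null geodesic. -/
structure IsNullGeodesicAt (γ : ℝ → M) (s : Set ℝ) (t : ℝ) : Prop where
  contMDiff : ContMDiffWithinAt 𝓘(ℝ, ℝ) (𝓡 4) 2 γ s t
  equation : ∀ x₀ : M, γ t ∈ (extChartAt (𝓡 4) x₀).source →
    g.GeodesicEquationAt x₀ (fun u ↦ extChartAt (𝓡 4) x₀ (γ u)) s t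
  future : T.IsFutureAt {0} γ s t

variable {T}

theorem ne_zero_of_isFuturePointing {p : M} {v : TangentSpace (𝓡 4) p} (h : T.IsFuturePointing v) :
    v ≠ 0 := by
  rintro rfl
  simp [IsFuturePointing] at h

theorem existsNullGeodesic_iff {A B : M} : T.ExistsNullGeodesic A B ↔
    ∃ (γ : ℝ → M) (a b : ℝ), a < b ∧ γ a = A ∧ γ b = B ∧
      ∀ t ∈ Icc a b, T.IsNullGeodesicAt γ (Icc a b) t := by
  constructor
  · rintro ⟨γ, a, b, hab, ha, hb, h1, h2⟩
    exact ⟨γ, a, b, hab, ha, hb, fun t ht ↦ ⟨h1.1 t ht, fun x₀ hx₀ ↦ h1.2 x₀ t ht hx₀,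
      (h1.1 t ht).of_le one_le_two, (h2 t ht).1.2, (h2 t ht).2⟩⟩
  · rintro ⟨γ, a, b, hab, ha, hb, h⟩
    exact ⟨γ, a, b, hab, ha, hb, ⟨fun t ht ↦ (h t ht).contMDiff,
      fun x₀ t ht hx₀ ↦ (h t ht).equation x₀ hx₀⟩, fun t ht ↦
      ⟨⟨ne_zero_of_isFuturePointing (h t ht).future.2.2, (h t ht).future.2.1⟩,
        (h t ht).future.2.2⟩⟩

theorem contDiffWithinAt_chart {γ : ℝ → M} {s : Set ℝ} {t : ℝ} {x₀ : M}
    (hγ : ContMDiffWithinAt 𝓘(ℝ, ℝ) (𝓡 4) 2 γ s t) (ht : γ t ∈ (extChartAt (𝓡 4) x₀).source) :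
    ContDiffWithinAt ℝ 2 (fun u ↦ extChartAt (𝓡 4) x₀ (γ u)) s t := by
  exact ((contMDiffWithinAt_iff_target_of_mem_source (I' := 𝓡 4) (y := x₀)
    (by rwa [extChartAt_source] at ht)).1 hγ).2.contDiffWithinAt

theorem contMDiffWithinAt_of_chart {γ : ℝ → M} {s : Set ℝ} {t : ℝ} {x₀ : M}
    (hγ : ContinuousWithinAt γ s t) (ht : γ t ∈ (extChartAt (𝓡 4) x₀).source)
    (h : ContDiffWithinAt ℝ 2 (fun u ↦ extChartAt (𝓡 4) x₀ (γ u)) s t) :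
    ContMDiffWithinAt 𝓘(ℝ, ℝ) (𝓡 4) 2 γ s t := by
  exact (contMDiffWithinAt_iff_target_of_mem_source (I' := 𝓡 4) (y := x₀)
    (by rwa [extChartAt_source] at ht)).2 ⟨hγ, h.contMDiffWithinAt⟩

/-- Being a null geodesic at a parameter is a property of germs, also across a change of the
domain. -/
theorem isNullGeodesicAt_congr {γ γ' : ℝ → M} {s s' : Set ℝ} {t : ℝ}
    (hγ : ContMDiffWithinAt 𝓘(ℝ, ℝ) (𝓡 4) 2 γ s t)
    (hγ' : γ' =ᶠ[𝓝[s'] t] γ) (hss : s ∈ 𝓝[s'] t) (ht : t ∈ s) (ht' : t ∈ s')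
    (hs : UniqueDiffOn ℝ s) (hs' : UniqueDiffOn ℝ s') :
    T.IsNullGeodesicAt γ' s' t ↔ T.IsNullGeodesicAt γ s t := by
  have htt : γ' t = γ t := hγ'.self_of_nhdsWithin ht'
  have hd' : ContMDiffWithinAt 𝓘(ℝ, ℝ) (𝓡 4) 2 γ' s' t :=
    (hγ.mono_of_mem_nhdsWithin hss).congr_of_eventuallyEq hγ' htt
  have hjet : ∀ x₀ : M, γ t ∈ (extChartAt (𝓡 4) x₀).source →
      derivWithin (fun u ↦ extChartAt (𝓡 4) x₀ (γ' u)) s' t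
        = derivWithin (fun u ↦ extChartAt (𝓡 4) x₀ (γ u)) s t ∧
      derivWithin (derivWithin (fun u ↦ extChartAt (𝓡 4) x₀ (γ' u)) s') s' t
        = derivWithin (derivWithin (fun u ↦ extChartAt (𝓡 4) x₀ (γ u)) s) s t := fun x₀ hx₀ ↦
    derivWithin_jet_congr (contDiffWithinAt_chart hγ hx₀)
      (hγ'.fun_comp (extChartAt (𝓡 4) x₀)) hss ht ht' hs hs'
  have heq : ∀ x₀ : M, γ t ∈ (extChartAt (𝓡 4) x₀).source →
      (g.GeodesicEquationAt x₀ (fun u ↦ extChartAt (𝓡 4) x₀ (γ' u)) s' t ↔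
        g.GeodesicEquationAt x₀ (fun u ↦ extChartAt (𝓡 4) x₀ (γ u)) s t) := by
    intro x₀ hx₀
    obtain ⟨h1, h2⟩ := hjet x₀ hx₀
    simp only [LorentzMetric.GeodesicEquationAt, h1, h2, htt]
  have hfut : T.IsFutureAt {0} γ' s' t ↔ T.IsFutureAt {0} γ s t := by
    have hsrc := mem_extChartAt_source (I := 𝓡 4) (γ t)
    rw [isFutureAt_iff (x₀ := γ t) hd'.continuousWithinAt (by rwa [htt]) (hs' t ht'),
      isFutureAt_iff (x₀ := γ t) hγ.continuousWithinAt hsrc (hs t ht), (hjet _ hsrc).1, htt]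
    have hsrc' : γ' t ∈ (extChartAt (𝓡 4) (γ t)).source := by rwa [htt]
    exact and_congr_left fun _ ↦
      iff_of_true ((contDiffWithinAt_chart hd' hsrc').of_le one_le_two)
        ((contDiffWithinAt_chart hγ hsrc).of_le one_le_two)
  constructor
  · rintro ⟨h1, h2, h3⟩
    exact ⟨hγ, fun x₀ hx₀ ↦ (heq x₀ hx₀).1 (h2 x₀ (by rwa [htt])), hfut.1 h3⟩
  · rintro ⟨h1, h2, h3⟩
    refine ⟨hd', fun x₀ hx₀ ↦ ?_, hfut.2 h3⟩
    rw [htt] at hx₀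
    exact (heq x₀ hx₀).2 (h2 x₀ hx₀)

theorem IsNullGeodesicAt.comp_affine {γ : ℝ → M} {s s' : Set ℝ} {l t m : ℝ}
    (h : T.IsNullGeodesicAt γ s (l * t + m)) (hl : 0 < l)
    (hs : UniqueDiffWithinAt ℝ s (l * t + m)) (hs' : UniqueDiffWithinAt ℝ s' t)
    (hss : (fun u ↦ l * u + m) '' s' = s) : T.IsNullGeodesicAt (fun u ↦ γ (l * u + m)) s' t := by
  have hmaps : MapsTo (fun u ↦ l * u + m) s' s := hss ▸ mapsTo_image _ _
  refine ⟨?_, fun x₀ hx₀ w ↦ ?_, h.future.comp_affine hl (by simp) hs hs' hss⟩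
  · exact h.contMDiff.comp (f := fun u ↦ l * u + m) t
      (by rw [contMDiffWithinAt_iff_contDiffWithinAt]; fun_prop) hmaps
  · have hy := (extChartAt (𝓡 4) x₀).map_source hx₀
    have heq := h.equation x₀ hx₀ w
    set x : ℝ → CoordSpace := fun u ↦ extChartAt (𝓡 4) x₀ (γ u) with hx
    have h1 : derivWithin (fun u ↦ x (l * u + m)) s' = fun u ↦ l • derivWithin x s (l * u + m) := by
      funext u
      rw [derivWithin_comp_affine, hss]
    have h2 : derivWithin (fun u ↦ l • derivWithin x s (l * u + m)) s' t
        = l • l • derivWithin (derivWithin x s) s (l * t + m) := by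
      rw [derivWithin_fun_const_smul_field, derivWithin_comp_affine, hss]
    have h3 : derivWithin (derivWithin (fun u ↦ x (l * u + m)) s') s' t
        = l • l • derivWithin (derivWithin x s) s (l * t + m) := by rw [h1, h2]
    change g.chartForm x₀ (derivWithin (derivWithin (fun u ↦ x (l * u + m)) s') s' t) w
      (x (l * t + m)) + g.christoffel x₀ (x (l * t + m))
        (derivWithin (fun u ↦ x (l * u + m)) s' t) (derivWithin (fun u ↦ x (l * u + m)) s' t) w = 0
    rw [h3, h1]
    rw [g.christoffel_smul hy, g.chartForm_eq]
    rw [g.chartForm_eq] at heq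
    have h4 (v : CoordSpace) : g.inChart x₀ (x (l * t + m)) (l • l • v) w
        = l * (l * g.inChart x₀ (x (l * t + m)) v w) := by
      rw [map_smul, map_smul]; rfl
    beta_reduce at heq ⊢
    rw [h4]
    linear_combination (l * l) * heq

/-! ### Joining null geodesics -/

/-- A broken null geodesic: cutting off the corner gives a timelike segment, which absorbs the
remaining null pieces. -/
theorem existsTimelikeCurve_of_corner {γ₁ γ₂ : ℝ → M} {a b c d : ℝ} (hab : a < b) (hcd : c < d)
    (h₁ : ∀ t ∈ Icc a b, T.IsFutureAt {0} γ₁ (Icc a b) t)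
    (h₂ : ∀ t ∈ Icc c d, T.IsFutureAt {0} γ₂ (Icc c d) t) (hbc : γ₁ b = γ₂ c)
    (hneg : g.inChart (γ₁ b) (extChartAt (𝓡 4) (γ₁ b) (γ₁ b))
      (derivWithin (fun u ↦ extChartAt (𝓡 4) (γ₁ b) (γ₁ u)) (Icc a b) b)
      (derivWithin (fun u ↦ extChartAt (𝓡 4) (γ₁ b) (γ₂ u)) (Icc c d) c) < 0) :
    T.ExistsTimelikeCurve (γ₁ a) (γ₂ d) := by
  have hb : b ∈ Icc a b := right_mem_Icc.2 hab.le
  have hc : c ∈ Icc c d := left_mem_Icc.2 hcd.le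
  have hsrc₁ : γ₁ b ∈ (extChartAt (𝓡 4) (γ₁ b)).source := mem_extChartAt_source _
  have hsrc₂ : γ₂ c ∈ (extChartAt (𝓡 4) (γ₁ b)).source := hbc ▸ hsrc₁
  have hcont₁ := (h₁ b hb).1.continuousWithinAt
  have hcont₂ := (h₂ c hc).1.continuousWithinAt
  obtain ⟨hx₁, hy, hu, hfu⟩ := (isFutureAt_iff hcont₁ hsrc₁ (uniqueDiffOn_Icc hab b hb)).1 (h₁ b hb)
  obtain ⟨hx₂, -, hv, hfv⟩ := (isFutureAt_iff hcont₂ hsrc₂ (uniqueDiffOn_Icc hcd c hc)).1 (h₂ c hc)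
  rw [← hbc] at hv hfv
  set φ := extChartAt (𝓡 4) (γ₁ b) with hφ
  set x₁ : ℝ → CoordSpace := fun u ↦ φ (γ₁ u) with hx₁'
  set x₂ : ℝ → CoordSpace := fun u ↦ φ (γ₂ u) with hx₂'
  set u := derivWithin x₁ (Icc a b) b
  set v := derivWithin x₂ (Icc c d) c
  simp only [mem_singleton_iff] at hy hu hfu hv hfv
  have hL := g.isLorentz_inChart (γ₁ b) hy
  have hcone : (φ (γ₁ b), v + u) ∈ T.futureCone (Iio 0) (γ₁ b) := by
    refine ⟨hy, ?_, ?_⟩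
    · simp only [map_add, add_apply, mem_Iio, hu, hv, hL.symm v u]
      linarith
    · simp only [map_add]
      linarith
  -- The chord from `x₁ (b - δ)` to `x₂ (c + δ)` is close to `δ (u + v)`, since `x₂ (c + δ)` and
  -- `x₁ (b - δ)` have right derivatives `v` and `-u` at `δ = 0`.
  have hseg := eventually_existsTimelikeCurve_segment hcone
  have hd₁ : HasDerivWithinAt (fun δ : ℝ ↦ x₁ (b - δ)) (-u) (Ici 0) 0 := by
    have h := (hx₁.differentiableWithinAt one_ne_zero).hasDerivWithinAt.mono_of_mem_nhdsWithin
      (Icc_mem_nhdsLE hab)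
    have hin : HasDerivWithinAt (fun δ : ℝ ↦ b - δ) (-1) (Ici 0) 0 := by
      simpa using (hasDerivWithinAt_id (0 : ℝ) (Ici 0)).const_sub b
    exact (HasDerivWithinAt.scomp_of_eq (t' := Iic b) (0 : ℝ) h hin
      (fun δ hδ ↦ by simpa using hδ) (by simp)).congr_deriv (neg_one_smul ℝ u)
  have hd₂ : HasDerivWithinAt (fun δ : ℝ ↦ x₂ (c + δ)) v (Ici 0) 0 := by
    have h := (hx₂.differentiableWithinAt one_ne_zero).hasDerivWithinAt.mono_of_mem_nhdsWithin
      (Icc_mem_nhdsGE hcd)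
    have hin : HasDerivWithinAt (fun δ : ℝ ↦ c + δ) 1 (Ici 0) 0 := by
      simpa using (hasDerivWithinAt_id (0 : ℝ) (Ici 0)).const_add c
    exact (HasDerivWithinAt.scomp_of_eq (t' := Ici c) (0 : ℝ) h hin
      (fun δ hδ ↦ by simpa using hδ) (by simp)).congr_deriv (one_smul ℝ v)
  have hslope := hasDerivWithinAt_iff_tendsto_slope.1 (hd₂.sub hd₁)
  have hIoi : Ici (0 : ℝ) \ {0} = Ioi 0 := Ici_sdiff_left
  rw [hIoi, sub_neg_eq_add] at hslope
  have hx₁c : Tendsto (fun δ : ℝ ↦ x₁ (b - δ)) (𝓝[>] 0) (𝓝 (φ (γ₁ b))) := by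
    have := (hd₁.continuousWithinAt.mono Ioi_subset_Ici_self).tendsto
    simpa using this
  have hlim : Tendsto (fun δ : ℝ ↦ ((x₁ (b - δ), slope ((fun δ : ℝ ↦ x₂ (c + δ)) -
      fun δ : ℝ ↦ x₁ (b - δ)) 0 δ), δ)) (𝓝[>] 0) (𝓝 ((φ (γ₁ b), v + u), 0)) :=
    (hx₁c.prodMk_nhds hslope).prodMk_nhds (tendsto_id'.2 nhdsWithin_le_nhds)
  have hl₁ : Tendsto (fun δ : ℝ ↦ b - δ) (𝓝[>] 0) (𝓝[Icc a b] b) := by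
    refine tendsto_nhdsWithin_iff.2 ⟨?_, ?_⟩
    · have : Continuous (fun δ : ℝ ↦ b - δ) := by fun_prop
      simpa using (this.tendsto 0).mono_left (nhdsWithin_le_nhds (s := Ioi 0))
    · filter_upwards [Ioo_mem_nhdsGT (sub_pos.2 hab)] with δ hδ
      constructor <;> linarith [hδ.1, hδ.2]
  have hl₂ : Tendsto (fun δ : ℝ ↦ c + δ) (𝓝[>] 0) (𝓝[Icc c d] c) := by
    refine tendsto_nhdsWithin_iff.2 ⟨?_, ?_⟩
    · have : Continuous (fun δ : ℝ ↦ c + δ) := by fun_prop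
      simpa using (this.tendsto 0).mono_left (nhdsWithin_le_nhds (s := Ioi 0))
    · filter_upwards [Ioo_mem_nhdsGT (sub_pos.2 hcd)] with δ hδ
      constructor <;> linarith [hδ.1, hδ.2]
  have hopen := isOpen_extChartAt_source (I := 𝓡 4) (γ₁ b)
  have hs₁ := hl₁.eventually (hcont₁.eventually (hopen.mem_nhds hsrc₁))
  have hs₂ := hl₂.eventually (hcont₂.eventually (hopen.mem_nhds hsrc₂))
  have hδ₁ : ∀ᶠ δ : ℝ in 𝓝[>] 0, δ ∈ Ioo 0 (b - a) := Ioo_mem_nhdsGT (sub_pos.2 hab)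
  have hδ₂ : ∀ᶠ δ : ℝ in 𝓝[>] 0, δ ∈ Ioo 0 (d - c) := Ioo_mem_nhdsGT (sub_pos.2 hcd)
  obtain ⟨δ, ⟨⟨⟨hδ, hs₁⟩, hs₂⟩, hδ₁⟩, hδ₂⟩ :=
    ((((hlim.eventually hseg).and hs₁).and hs₂).and hδ₁ |>.and hδ₂).exists
  have hmid := hδ hδ₁.1
  have h0 : x₂ c = x₁ b := by simp only [hx₁', hx₂', hbc]
  simp only [slope_def_module, Pi.sub_apply, add_zero, sub_zero, h0, sub_self, smul_smul,
    mul_inv_cancel₀ hδ₁.1.ne', one_smul, add_sub_cancel] at hmid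
  change T.ExistsTimelikeCurve (φ.symm (φ (γ₁ (b - δ)))) (φ.symm (φ (γ₂ (c + δ)))) at hmid
  rw [φ.left_inv hs₁, φ.left_inv hs₂] at hmid
  have hA : T.ExistsTimelikeCurve (γ₁ a) (γ₂ (c + δ)) :=
    ExistsTimelikeCurve.null_trans (by linarith [hδ₁.2])
      (isFutureAt_subinterval h₁ le_rfl (by linarith [hδ₁.2]) (by linarith [hδ₁.1])) hmid
  exact hA.trans_null (by linarith [hδ₂.2])
    (isFutureAt_subinterval h₂ (by linarith [hδ₂.1]) (by linarith [hδ₂.2]) le_rfl)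

/-- Null geodesics with matching velocities join to a null geodesic: their second derivatives match
by the geodesic equation. -/
theorem existsNullGeodesic_glue {γ₁ γ₂ : ℝ → M} {a b d : ℝ} (hab : a < b) (hbd : b < d)
    (h₁ : ∀ t ∈ Icc a b, T.IsNullGeodesicAt γ₁ (Icc a b) t)
    (h₂ : ∀ t ∈ Icc b d, T.IsNullGeodesicAt γ₂ (Icc b d) t) (hb : γ₁ b = γ₂ b)
    (hv : derivWithin (fun u ↦ extChartAt (𝓡 4) (γ₁ b) (γ₁ u)) (Icc a b) b
      = derivWithin (fun u ↦ extChartAt (𝓡 4) (γ₁ b) (γ₂ u)) (Icc b d) b) :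
    T.ExistsNullGeodesic (γ₁ a) (γ₂ d) := by
  have had : a < d := hab.trans hbd
  have hu₁ := uniqueDiffOn_Icc hab
  have hu₂ := uniqueDiffOn_Icc hbd
  have hu := uniqueDiffOn_Icc had
  have hb₁ : b ∈ Icc a b := right_mem_Icc.2 hab.le
  have hb₂ : b ∈ Icc b d := left_mem_Icc.2 hbd.le
  have hbm : b ∈ Icc a d := ⟨hab.le, hbd.le⟩
  have hle : ∀ t ∈ Icc a b, t < b → Icc a b ∈ 𝓝[Icc a d] t := fun t ht htb ↦
    mem_nhdsWithin_iff_exists_mem_nhds_inter.2 ⟨Iio b, Iio_mem_nhds htb,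
      fun u hu' ↦ ⟨hu'.2.1, le_of_lt hu'.1⟩⟩
  have hge : ∀ t ∈ Icc b d, b < t → Icc b d ∈ 𝓝[Icc a d] t := fun t ht htb ↦
    mem_nhdsWithin_iff_exists_mem_nhds_inter.2 ⟨Ioi b, Ioi_mem_nhds htb,
      fun u hu' ↦ ⟨le_of_lt hu'.1, hu'.2.2⟩⟩
  refine existsNullGeodesic_iff.2 ⟨glue b γ₁ γ₂, a, d, had, glue_of_le hab.le,
    glue_of_ge hb hbd.le, fun t ht ↦ ?_⟩
  rcases lt_trichotomy t b with htb | rfl | htb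
  · have ht' : t ∈ Icc a b := ⟨ht.1, htb.le⟩
    exact (isNullGeodesicAt_congr (h₁ t ht').contMDiff
      (mem_nhdsWithin_of_mem_nhds (glue_eventuallyEq_left htb)) (hle t ht' htb) ht' ht hu₁ hu).2
      (h₁ t ht')
  · set φ := extChartAt (𝓡 4) (γ₁ t) with hφ
    have hsrc₁ : γ₁ t ∈ φ.source := mem_extChartAt_source _
    have hsrc₂ : γ₂ t ∈ φ.source := hb ▸ hsrc₁
    set f : ℝ → CoordSpace := fun u ↦ φ (γ₁ u) with hf
    set k : ℝ → CoordSpace := fun u ↦ φ (γ₂ u) with hk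
    have hfd : ContDiffWithinAt ℝ 2 f (Icc a t) t := contDiffWithinAt_chart (h₁ t hb₁).contMDiff hsrc₁
    have hkd : ContDiffWithinAt ℝ 2 k (Icc t d) t := contDiffWithinAt_chart (h₂ t hb₂).contMDiff hsrc₂
    have hfk : f t = k t := by simp only [hf, hk, hb]
    have hy : f t ∈ φ.target := φ.map_source hsrc₁
    have hm₁ : Icc a t ∈ 𝓝[≤] t := Icc_mem_nhdsLE hab
    have hm₂ : Icc t d ∈ 𝓝[≥] t := Icc_mem_nhdsGE hbd
    obtain ⟨hf1, hf2⟩ := derivWithin_jet_congr hfd EventuallyEq.rfl hm₁ hb₁ self_mem_Iic hu₁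
      (uniqueDiffOn_Iic t)
    obtain ⟨hk1, hk2⟩ := derivWithin_jet_congr hkd EventuallyEq.rfl hm₂ hb₂ self_mem_Ici hu₂
      (uniqueDiffOn_Ici t)
    have hsecond : derivWithin (derivWithin f (Icc a t)) (Icc a t) t
        = derivWithin (derivWithin k (Icc t d)) (Icc t d) t := by
      rw [← sub_eq_zero]
      refine (g.isLorentz_inChart (γ₁ t) hy).eq_zero_of_forall fun w ↦ ?_
      have e₁ := (h₁ t hb₁).equation (γ₁ t) hsrc₁ w
      have e₂ := (h₂ t hb₂).equation (γ₁ t) hsrc₂ w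
      simp only [g.chartForm_eq] at e₁ e₂
      change g.inChart (γ₁ t) (k t) (derivWithin (derivWithin k (Icc t d)) (Icc t d) t) w
        + g.christoffel (γ₁ t) (k t) (derivWithin k (Icc t d) t) (derivWithin k (Icc t d) t) w = 0
        at e₂
      change g.inChart (γ₁ t) (f t) (derivWithin (derivWithin f (Icc a t)) (Icc a t) t) w
        + g.christoffel (γ₁ t) (f t) (derivWithin f (Icc a t) t) (derivWithin f (Icc a t) t) w = 0
        at e₁
      rw [← hfk, ← hv] at e₂
      rw [map_sub, sub_apply]
      linarith
    have hglue : ContDiffAt ℝ 2 (glue t f k) t :=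
      contDiffAt_two_glue (hfd.mono_of_mem_nhdsWithin hm₁) (hkd.mono_of_mem_nhdsWithin hm₂) hfk
        (by rw [hf1, hk1, hv]) (by rw [hf2, hk2, hsecond])
    have hcomp : (fun u ↦ φ (glue t γ₁ γ₂ u)) = glue t f k := by
      funext u
      simp only [glue, hf, hk]
      split_ifs <;> rfl
    have hgt : glue t γ₁ γ₂ t = γ₁ t := glue_of_le le_rfl
    have hgc : ContinuousAt (glue t γ₁ γ₂) t := by
      have c₁ : ContinuousWithinAt (glue t γ₁ γ₂) (Iic t) t :=
        ((h₁ t hb₁).contMDiff.continuousWithinAt.mono_of_mem_nhdsWithin hm₁).congr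
          (fun u hu' ↦ glue_of_le hu') hgt
      have c₂ : ContinuousWithinAt (glue t γ₁ γ₂) (Ici t) t :=
        ((h₂ t hb₂).contMDiff.continuousWithinAt.mono_of_mem_nhdsWithin hm₂).congr
          (fun u hu' ↦ glue_of_ge hb hu') (glue_of_ge hb le_rfl)
      have := c₁.union c₂
      rwa [Iic_union_Ici, continuousWithinAt_univ] at this
    have hd : ContMDiffWithinAt 𝓘(ℝ, ℝ) (𝓡 4) 2 (glue t γ₁ γ₂) (Icc a d) t :=
      contMDiffWithinAt_of_chart (x₀ := γ₁ t) hgc.continuousWithinAt (by rwa [hgt])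
        (by rw [hcomp]; exact hglue.contDiffWithinAt)
    refine (isNullGeodesicAt_congr hd (γ' := γ₁) (s' := Icc a t) ?_ ?_ hbm hb₁ hu hu₁).1 (h₁ t hb₁)
    · filter_upwards [self_mem_nhdsWithin] with u hu'
      exact (glue_of_le hu'.2).symm
    · exact mem_of_superset self_mem_nhdsWithin (Icc_subset_Icc le_rfl hbd.le)
  · have ht' : t ∈ Icc b d := ⟨htb.le, ht.2⟩
    exact (isNullGeodesicAt_congr (h₂ t ht').contMDiff
      (mem_nhdsWithin_of_mem_nhds (glue_eventuallyEq_right htb)) (hge t ht' htb) ht' ht hu₂ hu).2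
      (h₂ t ht')

/-- Two consecutive null geodesics either form a single null geodesic, after an affine
reparametrization of the second one, or have a corner at the joint. -/
theorem ExistsNullGeodesic.trans {A B C : M} (hAB : T.ExistsNullGeodesic A B)
    (hBC : T.ExistsNullGeodesic B C) : T.ExistsTimelikeCurve A C ∨ T.ExistsNullGeodesic A C := by
  obtain ⟨γ₁, a, b, hab, rfl, rfl, h₁⟩ := existsNullGeodesic_iff.1 hAB
  obtain ⟨γ₂, c, d, hcd, hbc, rfl, h₂⟩ := existsNullGeodesic_iff.1 hBC
  have hb : b ∈ Icc a b := right_mem_Icc.2 hab.le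
  have hc : c ∈ Icc c d := left_mem_Icc.2 hcd.le
  have hsrc₁ : γ₁ b ∈ (extChartAt (𝓡 4) (γ₁ b)).source := mem_extChartAt_source _
  have hsrc₂ : γ₂ c ∈ (extChartAt (𝓡 4) (γ₁ b)).source := hbc ▸ hsrc₁
  obtain ⟨-, hy, hu, hfu⟩ := (isFutureAt_iff (h₁ b hb).contMDiff.continuousWithinAt hsrc₁
    (uniqueDiffOn_Icc hab b hb)).1 (h₁ b hb).future
  obtain ⟨-, -, hv, hfv⟩ := (isFutureAt_iff (h₂ c hc).contMDiff.continuousWithinAt hsrc₂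
    (uniqueDiffOn_Icc hcd c hc)).1 (h₂ c hc).future
  rw [hbc] at hv hfv
  rcases (g.isLorentz_inChart (γ₁ b) hy).null_dichotomy (T.inChart_timelike (γ₁ b) hy) hu hv hfu hfv
    with hneg | ⟨l, hl, hprop⟩
  · exact Or.inl (existsTimelikeCurve_of_corner hab hcd (fun t ht ↦ (h₁ t ht).future)
      (fun t ht ↦ (h₂ t ht).future) hbc.symm hneg)
  · right
    have hend : l * (b + (d - c) / l) + (c - l * b) = d := by field_simp; ring
    have hbd : b < b + (d - c) / l := by
      have : 0 < (d - c) / l := div_pos (by linarith) hl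
      linarith
    have himg : (fun u ↦ l * u + (c - l * b)) '' Icc b (b + (d - c) / l) = Icc c d := by
      rw [image_affine_Icc' hl, hend]
      congr 1
      ring
    have hstart : l * b + (c - l * b) = c := by ring
    have h := existsNullGeodesic_glue (T := T) (γ₂ := fun u ↦ γ₂ (l * u + (c - l * b))) hab hbd h₁
      (fun t ht ↦ by
        have ht' : l * t + (c - l * b) ∈ Icc c d := himg ▸ mem_image_of_mem _ ht
        exact (h₂ _ ht').comp_affine hl (uniqueDiffOn_Icc hcd _ ht') (uniqueDiffOn_Icc hbd t ht) himg)
      (by simp only [hstart, hbc]) (by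
        rw [derivWithin_comp_affine (fun u ↦ extChartAt (𝓡 4) (γ₁ b) (γ₂ u)), himg, hstart]
        exact hprop)
    simpa only [hend] using h

/-- By induction on the number of null geodesics: once there is a timelike curve, it absorbs all
further null geodesics. -/
theorem existsTimelikeCurve_or_existsNullGeodesic {A B : M} (h : T.ExistsLightlikePath A B) :
    T.ExistsTimelikeCurve A B ∨ T.ExistsNullGeodesic A B := by
  obtain ⟨n, P, hn, rfl, rfl, h⟩ := h
  induction n, hn using Nat.le_induction with
  | base => exact Or.inr (h 0 one_pos)
  | succ n hn ih =>
    have hlast := h n (Nat.lt_succ_self n)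
    rcases ih fun i hi ↦ h i (hi.trans (Nat.lt_succ_self n)) with ht | hnull
    · obtain ⟨γ, a, b, hab, ha, hb, hγ⟩ := existsNullGeodesic_iff.1 hlast
      rw [← ha] at ht
      rw [← hb]
      exact Or.inl (ht.trans_null hab fun t ht' ↦ (hγ t ht').future)
    · exact hnull.trans hlast

end TimeOrientation

end Geodesic

/-! ### Covariance of the geodesic equation -/

set_option maxSynthPendingDepth 3 in
/-- The product rule for the pullback of a field of bilinear forms by a map `ψ` with
derivative `P`. -/
theorem fderiv_pullback_bilin {E : Type*} [NormedAddCommGroup E] [NormedSpace ℝ E]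
    {G : E → E →L[ℝ] E →L[ℝ] ℝ} {G' : E →L[ℝ] E →L[ℝ] E →L[ℝ] ℝ} {ψ : E → E} {P : E → E →L[ℝ] E}
    {H : E →L[ℝ] E →L[ℝ] E} {y : E} (hG : HasFDerivAt G G' (ψ y)) (hψ : HasFDerivAt ψ (P y) y)
    (hP : HasFDerivAt P H y) (u v w : E) :
    fderiv ℝ (fun z ↦ G (ψ z) (P z v) (P z w)) y u
      = G' (P y u) (P y v) (P y w) + G (ψ y) (H u v) (P y w) + G (ψ y) (P y v) (H u w) := by
  have h : HasFDerivAt (fun z ↦ G (ψ z) (P z v) (P z w)) _ y :=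
    ((hG.comp y hψ).clm_apply (hP.clm_apply (hasFDerivAt_const v y))).clm_apply
      (hP.clm_apply (hasFDerivAt_const w y))
  rw [h.fderiv]
  simp
  ring

section NullGeodesic

variable {M : Type*} [TopologicalSpace M] [ChartedSpace (EuclideanSpace ℝ (Fin 4)) M]
  [IsManifold (𝓡 4) ∞ M]

namespace LorentzMetric

variable (g : LorentzMetric M)

theorem contDiffAt_coordChange {x₀ x₁ : M} {y : CoordSpace}
    (hy : y ∈ (extChartAt (𝓡 4) x₀).target)
    (hy' : (extChartAt (𝓡 4) x₀).symm y ∈ (extChartAt (𝓡 4) x₁).source) :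
    ContDiffAt ℝ ∞ (fun z ↦ extChartAt (𝓡 4) x₁ ((extChartAt (𝓡 4) x₀).symm z)) y := by
  have h := contDiffWithinAt_ext_coord_change (I := 𝓡 4) (n := ∞) x₁ x₀ (y := y)
    (by rw [PartialEquiv.trans_source]; exact ⟨hy, hy'⟩)
  rw [ModelWithCorners.range_eq_univ, contDiffWithinAt_univ] at h
  exact h

theorem inChart_coordChange {x₀ x₁ : M} {y : CoordSpace}
    (hy : y ∈ (extChartAt (𝓡 4) x₀).target)
    (hy' : (extChartAt (𝓡 4) x₀).symm y ∈ (extChartAt (𝓡 4) x₁).source) (v w : CoordSpace) :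
    g.inChart x₀ y v w = g.inChart x₁ (extChartAt (𝓡 4) x₁ ((extChartAt (𝓡 4) x₀).symm y))
      (fderiv ℝ (fun z ↦ extChartAt (𝓡 4) x₁ ((extChartAt (𝓡 4) x₀).symm z)) y v)
      (fderiv ℝ (fun z ↦ extChartAt (𝓡 4) x₁ ((extChartAt (𝓡 4) x₀).symm z)) y w) := by
  have hd : MDifferentiableAt (𝓡 4) (𝓡 4) (extChartAt (𝓡 4) x₀).symm y := by
    have := mdifferentiableWithinAt_extChartAt_symm (I := 𝓡 4) hy
    rwa [ModelWithCorners.range_eq_univ, mdifferentiableWithinAt_univ] at this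
  have h := mfderiv_comp (I := 𝓡 4) (I' := 𝓡 4) (I'' := 𝓡 4) y (f := (extChartAt (𝓡 4) x₀).symm)
    (g := extChartAt (𝓡 4) x₁) (mdifferentiableAt_extChartAt (by rwa [extChartAt_source] at hy')) hd
  rw [mfderiv_eq_fderiv] at h
  have h' (u : CoordSpace) :
      fderiv ℝ (fun z ↦ extChartAt (𝓡 4) x₁ ((extChartAt (𝓡 4) x₀).symm z)) y u
        = mfderiv (𝓡 4) (𝓡 4) (extChartAt (𝓡 4) x₁) ((extChartAt (𝓡 4) x₀).symm y)
          (chartFrame x₀ y u) := DFunLike.congr_fun h u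
  rw [h', h', g.inChart_mfderiv hy', inChart_apply]

theorem fderiv_inChart_coordChange {x₀ x₁ : M} {y : CoordSpace}
    (hy : y ∈ (extChartAt (𝓡 4) x₀).target)
    (hy' : (extChartAt (𝓡 4) x₀).symm y ∈ (extChartAt (𝓡 4) x₁).source)
    {ψ : CoordSpace → CoordSpace}
    (hψ : ψ = fun z ↦ extChartAt (𝓡 4) x₁ ((extChartAt (𝓡 4) x₀).symm z)) (u v w : CoordSpace) :
    fderiv ℝ (g.inChart x₀) y u v w =
      fderiv ℝ (g.inChart x₁) (ψ y) (fderiv ℝ ψ y u) (fderiv ℝ ψ y v) (fderiv ℝ ψ y w)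
      + g.inChart x₁ (ψ y) (fderiv ℝ (fderiv ℝ ψ) y u v) (fderiv ℝ ψ y w)
      + g.inChart x₁ (ψ y) (fderiv ℝ ψ y v) (fderiv ℝ (fderiv ℝ ψ) y u w) := by
  have hsm : ContDiffAt ℝ ∞ ψ y := hψ ▸ contDiffAt_coordChange hy hy'
  have hty : ψ y ∈ (extChartAt (𝓡 4) x₁).target := by
    rw [hψ]; exact (extChartAt (𝓡 4) x₁).map_source hy'
  have hG := ((g.contDiffAt_inChart x₁ hty).differentiableAt (by simp)).hasFDerivAt
  have hP : HasFDerivAt ψ (fderiv ℝ ψ y) y := (hsm.differentiableAt (by simp)).hasFDerivAt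
  have hH : HasFDerivAt (fderiv ℝ ψ) (fderiv ℝ (fderiv ℝ ψ) y) y :=
    ((hsm.fderiv_right (m := 1) (by norm_cast)).differentiableAt one_ne_zero).hasFDerivAt
  have hev : g.chartForm x₀ v w =ᶠ[𝓝 y] fun z ↦ g.inChart x₁ (ψ z) (fderiv ℝ ψ z v)
      (fderiv ℝ ψ z w) := by
    have hopen := (continuousOn_extChartAt_symm (I := 𝓡 4) x₀).isOpen_inter_preimage
      (isOpen_extChartAt_target x₀) (isOpen_extChartAt_source (I := 𝓡 4) x₁)
    filter_upwards [hopen.mem_nhds ⟨hy, hy'⟩] with z hz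
    rw [hψ]
    exact g.inChart_coordChange hz.1 hz.2 v w
  rw [← g.fderiv_inChart_apply hy, hev.fderiv_eq]
  exact fderiv_pullback_bilin hG hP hH u v w

/-- The geodesic equation is covariant: a curve satisfying it in one chart does so in every
chart. -/
theorem geodesicEquationAt_coordChange {x₀ x₁ : M} {x v : ℝ → CoordSpace} {α : CoordSpace}
    {s : Set ℝ} {t : ℝ} (ht : t ∈ s) (hs : UniqueDiffOn ℝ s)
    (hx : ∀ τ ∈ s, HasDerivWithinAt x (v τ) s τ) (hv : HasDerivWithinAt v α s t)
    (hy : x t ∈ (extChartAt (𝓡 4) x₀).target)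
    (hy' : (extChartAt (𝓡 4) x₀).symm (x t) ∈ (extChartAt (𝓡 4) x₁).source)
    (heq : ∀ w, g.inChart x₀ (x t) α w + g.christoffel x₀ (x t) (v t) (v t) w = 0) :
    g.GeodesicEquationAt x₁ (fun u ↦ extChartAt (𝓡 4) x₁ ((extChartAt (𝓡 4) x₀).symm (x u)))
      s t := by
  obtain ⟨ψ, hψ⟩ : ∃ ψ : CoordSpace → CoordSpace,
    ψ = fun z ↦ extChartAt (𝓡 4) x₁ ((extChartAt (𝓡 4) x₀).symm z) := ⟨_, rfl⟩
  have hψu (u : ℝ) : extChartAt (𝓡 4) x₁ ((extChartAt (𝓡 4) x₀).symm (x u)) = ψ (x u) := by rw [hψ]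
  have hsm : ContDiffAt ℝ ∞ ψ (x t) := hψ ▸ contDiffAt_coordChange hy hy'
  have hty : ψ (x t) ∈ (extChartAt (𝓡 4) x₁).target := by
    rw [hψ]; exact (extChartAt (𝓡 4) x₁).map_source hy'
  have hopen := (continuousOn_extChartAt_symm (I := 𝓡 4) x₀).isOpen_inter_preimage
    (isOpen_extChartAt_target x₀) (isOpen_extChartAt_source (I := 𝓡 4) x₁)
  have hfirst : derivWithin (fun u ↦ ψ (x u)) s =ᶠ[𝓝[s] t] fun u ↦ fderiv ℝ ψ (x u) (v u) := by
    filter_upwards [(hx t ht).continuousWithinAt.eventually (hopen.mem_nhds ⟨hy, hy'⟩),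
      self_mem_nhdsWithin] with τ hτ hτs
    have hsm' : ContDiffAt ℝ ∞ ψ (x τ) := hψ ▸ contDiffAt_coordChange hτ.1 hτ.2
    exact ((hsm'.differentiableAt (by simp)).hasFDerivAt.comp_hasDerivWithinAt τ
      (hx τ hτs)).derivWithin (hs τ hτs)
  have h0 := hfirst.self_of_nhdsWithin ht
  have hH : HasFDerivAt (fderiv ℝ ψ) (fderiv ℝ (fderiv ℝ ψ) (x t)) (x t) :=
    ((hsm.fderiv_right (m := 1) (by norm_cast)).differentiableAt one_ne_zero).hasFDerivAt
  have hsecond : derivWithin (derivWithin (fun u ↦ ψ (x u)) s) s t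
      = fderiv ℝ (fderiv ℝ ψ) (x t) (v t) (v t) + fderiv ℝ ψ (x t) α := by
    rw [hfirst.derivWithin_eq h0]
    exact ((hH.comp_hasDerivWithinAt t (hx t ht)).clm_apply hv).derivWithin (hs t ht)
  have hsymm : IsSymmSndFDerivAt ℝ ψ (x t) :=
    hsm.isSymmSndFDerivAt (by simp [minSmoothness_of_isRCLikeNormedField]; norm_cast)
  have hsurj : Function.Surjective (fderiv ℝ ψ (x t)) := by
    -- The chart change is an isometry between nondegenerate forms.
    have hinj : Function.Injective ((fderiv ℝ ψ (x t) : CoordSpace →L[ℝ] CoordSpace) :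
        CoordSpace →ₗ[ℝ] CoordSpace) := by
      rw [← LinearMap.ker_eq_bot, LinearMap.ker_eq_bot']
      intro u hu
      refine (g.isLorentz_inChart x₀ hy).eq_zero_of_forall fun w ↦ ?_
      rw [g.inChart_coordChange hy hy', ← hψ]
      erw [hu]
      simp
    exact LinearMap.injective_iff_surjective.1 hinj
  -- Both the second derivative of the curve and the derivatives of the metric pick up a second
  -- derivative of the chart change; by its symmetry these terms cancel.
  intro w'
  obtain ⟨w, rfl⟩ := hsurj w'
  have e := heq w
  rw [g.christoffel_eq hy, g.inChart_coordChange hy hy', ← hψ, hψu] at e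
  simp only [g.fderiv_inChart_coordChange hy hy' hψ] at e
  simp only [hψu]
  rw [hsecond, h0, g.christoffel_eq hty, g.chartForm_eq]
  beta_reduce
  rw [hsymm.eq w (v t)] at e
  rw [map_add, add_apply]
  have hs₁ := (g.isLorentz_inChart x₁ hty).symm (fderiv ℝ (fderiv ℝ ψ) (x t) (v t) w)
    (fderiv ℝ ψ (x t) (v t))
  linarith

end LorentzMetric

end NullGeodesic

/-! ### The geodesic spray in a chart -/

set_option maxSynthPendingDepth 3 in
theorem contDiffOn_lowered_spray {E : Type*} [NormedAddCommGroup E] [NormedSpace ℝ E]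
    [FiniteDimensional ℝ E] {G : E → E →L[ℝ] E →L[ℝ] ℝ} {s : Set E} (hs : IsOpen s)
    (hG : ContDiffOn ℝ 2 G s) :
    ContDiffOn ℝ 1 (fun z : E × E ↦ fderiv ℝ G z.1 z.2 z.2
      - (1 / 2 : ℝ) • ((fderiv ℝ G z.1).flip z.2).flip z.2) (s ×ˢ univ) := by
  rw [contDiffOn_clm_apply]
  intro w
  have hD : ContDiffOn ℝ 1 (fderiv ℝ G) s := hG.fderiv_of_isOpen hs (by norm_num)
  have hD' : ContDiffOn ℝ 1 (fun z : E × E ↦ fderiv ℝ G z.1) (s ×ˢ univ) :=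
    hD.comp contDiffOn_fst fun z hz ↦ hz.1
  have h1 := ((hD'.clm_apply contDiffOn_snd).clm_apply contDiffOn_snd).clm_apply
    (contDiffOn_const (c := w))
  have h2 := ((hD'.clm_apply (contDiffOn_const (c := w))).clm_apply contDiffOn_snd).clm_apply
    contDiffOn_snd
  exact h1.sub ((contDiffOn_const (c := (1 / 2 : ℝ))).mul h2)

set_option maxSynthPendingDepth 3 in
theorem hasDerivWithinAt_quadratic {E : Type*} [NormedAddCommGroup E] [NormedSpace ℝ E]
    {G : E → E →L[ℝ] E →L[ℝ] ℝ} {x v : ℝ → E} {x' v' : E} {s : Set ℝ} {t : ℝ}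
    (hG : DifferentiableAt ℝ G (x t)) (hx : HasDerivWithinAt x x' s t)
    (hv : HasDerivWithinAt v v' s t) :
    HasDerivWithinAt (fun u ↦ G (x u) (v u) (v u))
      (fderiv ℝ G (x t) x' (v t) (v t) + G (x t) v' (v t) + G (x t) (v t) v') s t := by
  have h := ((hG.hasFDerivAt.comp_hasDerivWithinAt t hx).clm_apply hv).clm_apply hv
  exact h

section Spray

variable {M : Type*} [TopologicalSpace M] [ChartedSpace (EuclideanSpace ℝ (Fin 4)) M]
  [IsManifold (𝓡 4) ∞ M]

namespace LorentzMetric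

variable (g : LorentzMetric M)

/-- The covector `w ↦ Γ(v, v; w)` at the point `y` of the chart at `x₀`, where `z = (y, v)`. -/
def christoffelCovector (x₀ : M) (z : CoordSpace × CoordSpace) : CoordSpace →L[ℝ] ℝ :=
  fderiv ℝ (g.inChart x₀) z.1 z.2 z.2
    - (1 / 2 : ℝ) • ((fderiv ℝ (g.inChart x₀) z.1).flip z.2).flip z.2

theorem christoffelCovector_apply {x₀ : M} {y : CoordSpace}
    (hy : y ∈ (extChartAt (𝓡 4) x₀).target) (v w : CoordSpace) :
    g.christoffelCovector x₀ (y, v) w = g.christoffel x₀ y v v w := by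
  have h : g.christoffelCovector x₀ (y, v) w = fderiv ℝ (g.inChart x₀) y v v w
    - (1 / 2) * fderiv ℝ (g.inChart x₀) y w v v := rfl
  rw [h, g.christoffel_eq hy]
  ring

/-- The geodesic spray in the chart at `x₀`: the first-order form `y' = v`, `v' = -Γ(v, v)` of the
geodesic equation, with the index of `Γ(v, v)` raised by the metric. -/
def spray (x₀ : M) (z : CoordSpace × CoordSpace) : CoordSpace × CoordSpace :=
  (z.2, -(g.inChart x₀ z.1).inverse (g.christoffelCovector x₀ z))

theorem spray_snd {x₀ : M} {y : CoordSpace} (hy : y ∈ (extChartAt (𝓡 4) x₀).target)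
    (v w : CoordSpace) :
    g.inChart x₀ y (g.spray x₀ (y, v)).2 w + g.christoffel x₀ y v v w = 0 := by
  have h : g.inChart x₀ y ((g.inChart x₀ y).inverse (g.christoffelCovector x₀ (y, v)))
      = g.christoffelCovector x₀ (y, v) := by
    obtain ⟨e, he⟩ := (g.isLorentz_inChart x₀ hy).isInvertible
    rw [← he, ContinuousLinearMap.inverse_equiv]
    exact e.apply_symm_apply _
  have h' := DFunLike.congr_fun h w
  rw [g.christoffelCovector_apply hy] at h'
  have h2 : g.inChart x₀ y (g.spray x₀ (y, v)).2 w = -(g.inChart x₀ y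
    ((g.inChart x₀ y).inverse (g.christoffelCovector x₀ (y, v))) w) := by
    simp only [spray, map_neg]
    rfl
  rw [h2, h', neg_add_cancel]

theorem contDiffOn_christoffelCovector (x₀ : M) :
    ContDiffOn ℝ 1 (g.christoffelCovector x₀) ((extChartAt (𝓡 4) x₀).target ×ˢ univ) :=
  contDiffOn_lowered_spray (isOpen_extChartAt_target x₀)
    ((g.contDiffOn_inChart x₀).of_le ENat.LEInfty.out)

theorem contDiffAt_spray {x₀ : M} {z : CoordSpace × CoordSpace}
    (hz : z.1 ∈ (extChartAt (𝓡 4) x₀).target) : ContDiffAt ℝ 1 (g.spray x₀) z := by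
  have hC : ContDiffAt ℝ 1 (g.christoffelCovector x₀) z :=
    (g.contDiffOn_christoffelCovector x₀).contDiffAt
      (((isOpen_extChartAt_target x₀).prod isOpen_univ).mem_nhds ⟨hz, mem_univ _⟩)
  have hG : ContDiffAt ℝ 1 (fun z : CoordSpace × CoordSpace ↦ g.inChart x₀ z.1) z :=
    ((g.contDiffAt_inChart x₀ hz).of_le ENat.LEInfty.out).comp z contDiffAt_fst
  have hI : ContDiffAt ℝ 1 (fun z : CoordSpace × CoordSpace ↦ (g.inChart x₀ z.1).inverse) z :=
    ContDiffAt.comp (g := ContinuousLinearMap.inverse) z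
      ((g.isLorentz_inChart x₀ hz).isInvertible.contDiffAt_map_inverse) hG
  exact contDiffAt_snd.prodMk (hI.clm_apply hC).neg

end LorentzMetric

namespace TimeOrientation

variable {g : LorentzMetric M} {T : TimeOrientation g}

/-- The metric square of the velocity is conserved along integral curves of the spray. -/
theorem inChart_conserved {x₀ : M} {c : ℝ → CoordSpace × CoordSpace} {h : ℝ}
    (hc : ∀ t ∈ Icc 0 h, HasDerivWithinAt c (g.spray x₀ (c t)) (Icc 0 h) t ∧
      (c t).1 ∈ (extChartAt (𝓡 4) x₀).target) :
    ∀ t ∈ Icc 0 h, g.inChart x₀ (c t).1 (c t).2 (c t).2 = g.inChart x₀ (c 0).1 (c 0).2 (c 0).2 := by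
  have hx : ∀ t ∈ Icc 0 h, HasDerivWithinAt (fun u ↦ (c u).1) (c t).2 (Icc 0 h) t := fun t ht ↦
    (hasFDerivAt_fst (𝕜 := ℝ) (p := c t)).comp_hasDerivWithinAt t (hc t ht).1
  have hv : ∀ t ∈ Icc 0 h, HasDerivWithinAt (fun u ↦ (c u).2) (g.spray x₀ (c t)).2 (Icc 0 h) t :=
    fun t ht ↦ (hasFDerivAt_snd (𝕜 := ℝ) (p := c t)).comp_hasDerivWithinAt t (hc t ht).1
  have hq : ∀ t ∈ Icc 0 h, HasDerivWithinAt (fun u ↦ g.inChart x₀ (c u).1 (c u).2 (c u).2) 0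
      (Icc 0 h) t := by
    intro t ht
    have hy := (hc t ht).2
    refine (hasDerivWithinAt_quadratic ((g.contDiffAt_inChart x₀ hy).differentiableAt (by simp))
      (hx t ht) (hv t ht)).congr_deriv ?_
    -- The geodesic equation, paired with the velocity itself.
    have e := g.spray_snd hy (c t).2 (c t).2
    rw [g.christoffel_eq hy] at e
    rw [(g.isLorentz_inChart x₀ hy).symm (c t).2]
    linarith
  intro t ht
  exact constant_of_derivWithin_zero (fun u hu ↦ (hq u hu).differentiableWithinAt)
    (fun u hu ↦ (hq u (Ico_subset_Icc_self hu)).derivWithin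
      (uniqueDiffOn_Icc (by linarith [hu.1, hu.2]) u (Ico_subset_Icc_self hu))) t ht

/-- An integral curve of the spray with future null initial velocity projects to a null geodesic. -/
theorem existsNullGeodesic_of_spray {x₀ : M} {c : ℝ → CoordSpace × CoordSpace} {h : ℝ} (hh : 0 < h)
    (hc : ∀ t ∈ Icc 0 h, HasDerivWithinAt c (g.spray x₀ (c t)) (Icc 0 h) t ∧
      (c t).1 ∈ (extChartAt (𝓡 4) x₀).target)
    (hT : ∀ t ∈ Icc 0 h, g.inChart x₀ (c t).1 (T.inChart x₀ (c t).1) (c t).2 < 0)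
    (h0 : g.inChart x₀ (c 0).1 (c 0).2 (c 0).2 = 0) :
    T.ExistsNullGeodesic ((extChartAt (𝓡 4) x₀).symm (c 0).1)
      ((extChartAt (𝓡 4) x₀).symm (c h).1) := by
  have hu := uniqueDiffOn_Icc hh
  have hx : ∀ t ∈ Icc 0 h, HasDerivWithinAt (fun u ↦ (c u).1) (c t).2 (Icc 0 h) t := fun t ht ↦
    (hasFDerivAt_fst (𝕜 := ℝ) (p := c t)).comp_hasDerivWithinAt t (hc t ht).1
  have hv : ∀ t ∈ Icc 0 h, HasDerivWithinAt (fun u ↦ (c u).2) (g.spray x₀ (c t)).2 (Icc 0 h) t :=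
    fun t ht ↦ (hasFDerivAt_snd (𝕜 := ℝ) (p := c t)).comp_hasDerivWithinAt t (hc t ht).1
  have hcont : ContinuousOn c (Icc 0 h) := fun t ht ↦ (hc t ht).1.continuousWithinAt
  have hv1 : ContDiffOn ℝ 1 (fun u ↦ (c u).2) (Icc 0 h) := by
    rw [show (1 : WithTop ℕ∞) = 0 + 1 by simp, contDiffOn_succ_iff_derivWithin hu]
    refine ⟨fun t ht ↦ (hv t ht).differentiableWithinAt, by simp, contDiffOn_zero.2 ?_⟩
    refine ContinuousOn.congr (f := fun t ↦ (g.spray x₀ (c t)).2) (fun t ht ↦ ?_)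
      fun t ht ↦ (hv t ht).derivWithin (hu t ht)
    exact ((g.contDiffAt_spray (hc t ht).2).continuousAt.snd).comp_continuousWithinAt (hcont t ht)
  have hx2 : ContDiffOn ℝ 2 (fun u ↦ (c u).1) (Icc 0 h) := by
    rw [show (2 : WithTop ℕ∞) = 1 + 1 by norm_num, contDiffOn_succ_iff_derivWithin hu]
    exact ⟨fun t ht ↦ (hx t ht).differentiableWithinAt, by simp,
      hv1.congr fun t ht ↦ (hx t ht).derivWithin (hu t ht)⟩
  refine existsNullGeodesic_iff.2 ⟨fun u ↦ (extChartAt (𝓡 4) x₀).symm (c u).1, 0, h, hh, rfl, rfl,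
    fun t ht ↦ ?_⟩
  have hy := (hc t ht).2
  have hfut : T.IsFutureAt {0} (fun u ↦ (extChartAt (𝓡 4) x₀).symm (c u).1) (Icc 0 h) t := by
    refine isFutureAt_of_chart ((hx2 t ht).of_le one_le_two) ?_ ht (hu t ht)
    rw [(hx t ht).derivWithin (hu t ht)]
    exact ⟨hy, (inChart_conserved hc t ht).trans h0, hT t ht⟩
  refine ⟨contMDiffWithinAt_of_chart (x₀ := x₀) hfut.1.continuousWithinAt
    ((extChartAt (𝓡 4) x₀).map_target hy) ?_, fun x₁ hx₁ ↦ ?_, hfut⟩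
  · exact (hx2 t ht).congr (fun u hu' ↦ (extChartAt (𝓡 4) x₀).right_inv (hc u hu').2)
      ((extChartAt (𝓡 4) x₀).right_inv hy)
  · exact g.geodesicEquationAt_coordChange (v := fun u ↦ (c u).2) ht hu hx (hv t ht) hy hx₁
      fun w ↦ g.spray_snd hy _ w

end TimeOrientation

end Spray

/-! ### Two consecutive null steps reach every nearby timelike displacement -/

section TwoStep

variable {E : Type*} [NormedAddCommGroup E] [NormedSpace ℝ E]

set_option maxSynthPendingDepth 3 in
theorem exists_hasStrictFDerivAt_quadratic {G : E → E →L[ℝ] E →L[ℝ] ℝ} {y : E}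
    (hG : ContDiffAt ℝ 1 G y) (k : E) :
    ∃ L : E × E →L[ℝ] ℝ, HasStrictFDerivAt (fun z : E × E ↦ G z.1 z.2 z.2) L (y, k) ∧
      ∀ w, L (0, w) = G y k w + G y w k := by
  have h1 : HasStrictFDerivAt (fun z : E × E ↦ G z.1) _ (y, k) :=
    HasStrictFDerivAt.comp (g := G) (y, k) (hG.hasStrictFDerivAt one_ne_zero) hasStrictFDerivAt_fst
  have h : HasStrictFDerivAt (fun z : E × E ↦ G z.1 z.2 z.2) _ (y, k) :=
    (h1.clm_apply hasStrictFDerivAt_snd).clm_apply hasStrictFDerivAt_snd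
  refine ⟨_, h, fun w ↦ ?_⟩
  simp

/-- Since `k₁` and `k₂` are null, adding to `w₂` a multiple of `k₂`, at the expense of `w₁`, changes
only the product of `w₁` with `k₁`, and similarly for `k₁`. -/
theorem surjective_null_splitting {B : E →L[ℝ] E →L[ℝ] ℝ} (hB : ∀ v w, B v w = B w v) {k₁ k₂ : E}
    (h₁ : B k₁ k₁ = 0) (h₂ : B k₂ k₂ = 0) (h₁₂ : B k₁ k₂ ≠ 0) (c : E) (d e : ℝ) :
    ∃ w₁ w₂ : E, w₁ + w₂ = c ∧ B k₁ w₁ + B w₁ k₁ = d ∧ B k₂ w₂ + B w₂ k₂ = e := by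
  set b := B k₁ k₂ with hb
  refine ⟨c - ((e / (2 * b)) • k₁ + ((2 * B k₁ c - d) / (2 * b)) • k₂),
    (e / (2 * b)) • k₁ + ((2 * B k₁ c - d) / (2 * b)) • k₂, by abel, ?_, ?_⟩
  · rw [hB _ k₁]
    simp only [map_sub, map_add, map_smul, h₁, ← hb, smul_eq_mul]
    field_simp
    ring
  · rw [hB _ k₂]
    simp only [map_add, map_smul, h₂, hB k₂ k₁, ← hb, smul_eq_mul]
    field_simp
    ring

/-- Suppose that a step `y ↦ y + h • Q(h, y, w)` has average velocity `Q` close to `w`. Then two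
consecutive steps, with null initial velocities near the linearly independent null vectors `k₁` and
`k₂`, realize every displacement `h • v` with `v` near `k₁ + k₂`, down to `h = 0`: the two null
conditions and the total displacement form a submersion of the two initial velocities. -/
theorem eventually_exists_two_steps [CompleteSpace E] {B : E →L[ℝ] E →L[ℝ] ℝ}
    (hB : ∀ v w, B v w = B w v) {k₁ k₂ y₀ : E} (h₁ : B k₁ k₁ = 0) (h₂ : B k₂ k₂ = 0)
    (h₁₂ : B k₁ k₂ ≠ 0) {q : E × E → ℝ} {M₁ M₂ : E × E →L[ℝ] ℝ}
    (hq₁ : HasStrictFDerivAt q M₁ (y₀, k₁)) (hq₂ : HasStrictFDerivAt q M₂ (y₀, k₂))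
    (hM₁ : ∀ w, M₁ (0, w) = B k₁ w + B w k₁) (hM₂ : ∀ w, M₂ (0, w) = B k₂ w + B w k₂)
    (hqk₁ : q (y₀, k₁) = 0) (hqk₂ : q (y₀, k₂) = 0)
    {Q₁ Q₂ : ℝ × E × E → E} {L₁ L₂ : ℝ × E × E →L[ℝ] E}
    (hQ₁ : HasStrictFDerivAt Q₁ L₁ (0, y₀, k₁)) (hQ₂ : HasStrictFDerivAt Q₂ L₂ (0, y₀, k₂))
    (hL₁ : ∀ w, L₁ (0, 0, w) = w) (hL₂ : ∀ w, L₂ (0, 0, w) = w)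
    (hQk₁ : Q₁ (0, y₀, k₁) = k₁) (hQk₂ : Q₂ (0, y₀, k₂) = k₂)
    {P₁ P₂ : ℝ × E × E → Prop} (hP₁ : ∀ᶠ p in 𝓝 (0, y₀, k₁), P₁ p)
    (hP₂ : ∀ᶠ p in 𝓝 (0, y₀, k₂), P₂ p) :
    ∀ᶠ p : (E × E) × ℝ in 𝓝 ((y₀, k₁ + k₂), 0), ∃ m w₁ w₂ : E,
      q (p.1.1, w₁) = 0 ∧ P₁ (p.2, p.1.1, w₁) ∧ m = p.1.1 + p.2 • Q₁ (p.2, p.1.1, w₁) ∧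
      q (m, w₂) = 0 ∧ P₂ (p.2, m, w₂) ∧ p.1.1 + p.2 • p.1.2 = m + p.2 • Q₂ (p.2, m, w₂) := by
  -- A point `ξ = ((h, y), (w₁, w₂))` collects the step size, the initial point, and the velocities.
  let ξ₀ : (ℝ × E) × (E × E) := ((0, y₀), (k₁, k₂))
  let s₁ : (ℝ × E) × (E × E) →L[ℝ] ℝ × E × E :=
    ((ContinuousLinearMap.fst ℝ ℝ E).comp (ContinuousLinearMap.fst ℝ _ _)).prod
      (((ContinuousLinearMap.snd ℝ ℝ E).comp (ContinuousLinearMap.fst ℝ _ _)).prod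
        ((ContinuousLinearMap.fst ℝ E E).comp (ContinuousLinearMap.snd ℝ _ _)))
  let m : (ℝ × E) × (E × E) → E := fun ξ ↦ ξ.1.2 + ξ.1.1 • Q₁ (s₁ ξ)
  let s₂ : (ℝ × E) × (E × E) → ℝ × E × E := fun ξ ↦ (ξ.1.1, m ξ, ξ.2.2)
  have hs₁ : s₁ ξ₀ = (0, y₀, k₁) := rfl
  have hm₀ : m ξ₀ = y₀ := by simp [m, ξ₀]
  have hs₂ : s₂ ξ₀ = (0, y₀, k₂) := by simp only [s₂, hm₀]; rfl
  have hh : HasStrictFDerivAt (fun ξ : (ℝ × E) × (E × E) ↦ ξ.1.1) _ ξ₀ :=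
    ((ContinuousLinearMap.fst ℝ ℝ E).comp
      (ContinuousLinearMap.fst ℝ (ℝ × E) (E × E))).hasStrictFDerivAt
  have hy : HasStrictFDerivAt (fun ξ : (ℝ × E) × (E × E) ↦ ξ.1.2) _ ξ₀ :=
    ((ContinuousLinearMap.snd ℝ ℝ E).comp
      (ContinuousLinearMap.fst ℝ (ℝ × E) (E × E))).hasStrictFDerivAt
  have hw : HasStrictFDerivAt (fun ξ : (ℝ × E) × (E × E) ↦ ξ.2.2) _ ξ₀ :=
    ((ContinuousLinearMap.snd ℝ E E).comp
      (ContinuousLinearMap.snd ℝ (ℝ × E) (E × E))).hasStrictFDerivAt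
  have hQ₁' : HasStrictFDerivAt (fun ξ ↦ Q₁ (s₁ ξ)) (L₁.comp s₁) ξ₀ :=
    HasStrictFDerivAt.comp (g := Q₁) ξ₀ (by rwa [hs₁]) s₁.hasStrictFDerivAt
  have hm : HasStrictFDerivAt m _ ξ₀ := hy.add (hh.smul hQ₁')
  have hs : HasStrictFDerivAt s₂ _ ξ₀ := hh.prodMk (hm.prodMk hw)
  have hQ₂' : HasStrictFDerivAt (fun ξ ↦ Q₂ (s₂ ξ)) _ ξ₀ :=
    HasStrictFDerivAt.comp (g := Q₂) ξ₀ (by rwa [hs₂]) hs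
  have hq₁' : HasStrictFDerivAt (fun ξ ↦ q (s₁ ξ).2) _ ξ₀ :=
    HasStrictFDerivAt.comp (g := q) ξ₀ (by rwa [hs₁]) s₁.hasStrictFDerivAt.snd
  have hq₂' : HasStrictFDerivAt (fun ξ ↦ q (s₂ ξ).2) _ ξ₀ :=
    HasStrictFDerivAt.comp (g := q) ξ₀ (by rwa [hs₂]) hs.snd
  -- At `h = 0` the midpoint `m` does not depend on the velocities, so that the derivative in the
  -- velocities is that of `(w₁, w₂) ↦ (w₁ + w₂, B w₁ w₁, B w₂ w₂)`.
  obtain ⟨Λ, hΛ, hΛw⟩ : ∃ Λ : (ℝ × E) × (E × E) →L[ℝ] E × ℝ × ℝ, HasStrictFDerivAt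
      (fun ξ ↦ (Q₁ (s₁ ξ) + Q₂ (s₂ ξ), q (s₁ ξ).2, q (s₂ ξ).2)) Λ ξ₀ ∧ ∀ w₁ w₂,
        Λ (0, w₁, w₂) = (w₁ + w₂, B k₁ w₁ + B w₁ k₁, B k₂ w₂ + B w₂ k₂) := by
    refine ⟨_, (hQ₁'.add hQ₂').prodMk (hq₁'.prodMk hq₂'), fun w₁ w₂ ↦ ?_⟩
    have e₁ : s₁ (0, w₁, w₂) = (0, 0, w₁) := rfl
    have e₂ : ξ₀.1.1 = 0 := rfl
    simp [e₁, e₂, hL₁, hL₂, hM₁, hM₂]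
  have hmap := (hasStrictFDerivAt_fst.prodMk hΛ).map_nhds_eq_of_surj (LinearMap.range_eq_top.2 (by
    rintro ⟨a, c⟩
    obtain ⟨w₁, w₂, hc, hd, he⟩ := surjective_null_splitting hB h₁ h₂ h₁₂ (c - Λ (a, 0)).1
      (c - Λ (a, 0)).2.1 (c - Λ (a, 0)).2.2
    refine ⟨(a, w₁, w₂), ?_⟩
    have hsplit : ((a, w₁, w₂) : (ℝ × E) × (E × E)) = (a, 0) + (0, w₁, w₂) := by simp
    have hΛa : Λ (a, w₁, w₂) = c := by
      rw [hsplit, map_add, hΛw, hc, hd, he]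
      exact add_sub_cancel _ _
    exact Prod.ext rfl hΛa))
  have hgood : ∀ᶠ ξ in 𝓝 ξ₀, P₁ (s₁ ξ) ∧ P₂ (s₂ ξ) :=
    (s₁.continuous.continuousAt.eventually (by rwa [hs₁])).and
      (hs.continuousAt.eventually (by rwa [hs₂]))
  have himg := Filter.image_mem_map (m := fun ξ : (ℝ × E) × (E × E) ↦
    (ξ.1, Q₁ (s₁ ξ) + Q₂ (s₂ ξ), q (s₁ ξ).2, q (s₂ ξ).2)) hgood
  rw [hmap, hs₁, hs₂, hQk₁, hQk₂, hqk₁, hqk₂] at himg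
  have hcont : Continuous (fun p : (E × E) × ℝ ↦
    (((p.2, p.1.1), p.1.2, 0, 0) : (ℝ × E) × E × ℝ × ℝ)) := by fun_prop
  filter_upwards [hcont.continuousAt.preimage_mem_nhds himg] with p hp
  obtain ⟨⟨⟨h, y⟩, w₁, w₂⟩, ⟨hp₁, hp₂⟩, hξ⟩ := hp
  simp only [Prod.mk.injEq] at hξ
  obtain ⟨⟨rfl, rfl⟩, hv, hq₁0, hq₂0⟩ := hξ
  refine ⟨m ((p.2, p.1.1), w₁, w₂), w₁, w₂, hq₁0, hp₁, rfl, hq₂0, hp₂, ?_⟩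
  rw [← hv, smul_add, ← add_assoc]

end TwoStep

section Lightlike

variable {M : Type*} [TopologicalSpace M] [ChartedSpace (EuclideanSpace ℝ (Fin 4)) M]
  [IsManifold (𝓡 4) ∞ M]

namespace TimeOrientation

variable {g : LorentzMetric M} {T : TimeOrientation g}

/-! ### Timelike curves are traced by lightlike paths -/

/-- Null geodesics in coordinates: the displacement in time `h` of the null geodesic starting at `y`
with velocity `w` is `h • Q (h, y, w)`, where the average velocity `Q` is strictly differentiable
down to `h = 0`, with `Q (0, y, w) = w`. -/
theorem exists_null_step {x₀ : M} {y k : CoordSpace} (hk : (y, k) ∈ T.futureCone {0} x₀) :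
    ∃ (Q : ℝ × CoordSpace × CoordSpace → CoordSpace)
      (L : ℝ × CoordSpace × CoordSpace →L[ℝ] CoordSpace),
      HasStrictFDerivAt Q L (0, y, k) ∧ (∀ w, L (0, 0, w) = w) ∧ Q (0, y, k) = k ∧
      ∀ᶠ p in 𝓝 (0, y, k), 0 < p.1 → g.inChart x₀ p.2.1 p.2.2 p.2.2 = 0 →
        T.ExistsNullGeodesic ((extChartAt (𝓡 4) x₀).symm p.2.1)
          ((extChartAt (𝓡 4) x₀).symm (p.2.1 + p.1 • Q p)) := by
  obtain ⟨A, hA0, hA, hflow⟩ := exists_average_flow (g.contDiffAt_spray (z := (y, k)) hk.1)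
  refine ⟨fun p ↦ (A p).2, _, hA.snd, fun w ↦ by simp, by simp only [hA0], ?_⟩
  have hW : {z : CoordSpace × CoordSpace | z.1 ∈ (extChartAt (𝓡 4) x₀).target ∧
      g.inChart x₀ z.1 (T.inChart x₀ z.1) z.2 < 0} ∈ 𝓝 (y, k) := by
    have hopen := (continuousOn_coneForms (T := T) x₀).snd.isOpen_inter_preimage
      ((isOpen_extChartAt_target x₀).prod isOpen_univ) (isOpen_Iio (a := (0 : ℝ)))
    filter_upwards [hopen.mem_nhds ⟨⟨hk.1, mem_univ _⟩, hk.2.2⟩] with z hz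
    exact ⟨hz.1.1, hz.2⟩
  filter_upwards [hflow _ hW] with p hp hpos hnull
  obtain ⟨c, hc0, hc, hint⟩ := hp hpos
  have hgeo := existsNullGeodesic_of_spray (T := T) hpos (fun t ht ↦ ⟨(hc t ht).1, (hc t ht).2.1⟩)
    (fun t ht ↦ (hc t ht).2.2) (by rwa [hc0])
  have hcont : ContinuousOn c (Icc 0 p.1) := fun t ht ↦ (hc t ht).1.continuousWithinAt
  have hci : IntervalIntegrable c MeasureTheory.volume 0 p.1 := by
    apply ContinuousOn.intervalIntegrable
    rwa [uIcc_of_le hpos.le]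
  have hsnd := (ContinuousLinearMap.snd ℝ CoordSpace CoordSpace).intervalIntegral_comp_comm hci
  have hftc : ∫ s in (0 : ℝ)..p.1, (c s).2 = (c p.1).1 - (c 0).1 := by
    refine intervalIntegral.integral_eq_sub_of_hasDerivAt_of_le hpos.le hcont.fst (fun t ht ↦ ?_)
      (ContinuousOn.intervalIntegrable (by rw [uIcc_of_le hpos.le]; exact hcont.snd))
    have h := (hc t (Ioo_subset_Icc_self ht)).1.hasDerivAt (Icc_mem_nhds ht.1 ht.2)
    exact (hasFDerivAt_fst (𝕜 := ℝ) (p := c t)).comp_hasDerivAt t h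
  have hend : (c p.1).1 = p.2.1 + p.1 • (A p).2 := by
    have e : ∫ s in (0 : ℝ)..p.1, (c s).2 = p.1 • (A p).2 := by
      have := hsnd
      rw [hint] at this
      exact this
    rw [← e, hftc, hc0]
    abel
  rwa [hc0, hend] at hgeo

theorem ExistsLightlikePath.trans {A B C : M} (hAB : T.ExistsLightlikePath A B)
    (hBC : T.ExistsLightlikePath B C) : T.ExistsLightlikePath A C := by
  obtain ⟨n, P, hn, rfl, rfl, hP⟩ := hAB
  obtain ⟨n', P', hn', hB, rfl, hP'⟩ := hBC
  refine ⟨n + n', fun i ↦ if i ≤ n then P i else P' (i - n), by omega, by simp, ?_, fun i hi ↦ ?_⟩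
  · simp [show ¬ n + n' ≤ n by omega]
  · rcases lt_trichotomy i n with h | rfl | h
    · simpa [h.le, Nat.succ_le_of_lt h] using hP i h
    · simpa [hB] using hP' 0 hn'
    · simpa [show ¬ i ≤ n by omega, show ¬ i + 1 ≤ n by omega, show i + 1 - n = i - n + 1 by omega]
        using hP' (i - n) (by omega)

theorem ExistsNullGeodesic.existsLightlikePath {A B : M} (h : T.ExistsNullGeodesic A B) :
    T.ExistsLightlikePath A B :=
  ⟨1, fun i ↦ if i = 0 then A else B, one_pos, by simp, by simp, fun i hi ↦ by
    obtain rfl : i = 0 := by omega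
    simpa using h⟩

/-- Short coordinate segments in nearly the direction of a timelike vector join the end points of
two consecutive null geodesics. -/
theorem eventually_existsLightlikePath_segment {x₀ : M} {z : CoordSpace × CoordSpace}
    (hz : z ∈ T.futureCone (Iio 0) x₀) :
    ∀ᶠ p : (CoordSpace × CoordSpace) × ℝ in 𝓝 (z, 0), 0 < p.2 →
      T.ExistsLightlikePath ((extChartAt (𝓡 4) x₀).symm p.1.1)
        ((extChartAt (𝓡 4) x₀).symm (p.1.1 + p.2 • p.1.2)) := by
  obtain ⟨y, v⟩ := z
  obtain ⟨hy, hv, hTv⟩ := hz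
  have hL := g.isLorentz_inChart x₀ hy
  obtain ⟨k₁, k₂, rfl, hk₁, hk₂, hT₁, hT₂, h₁₂⟩ :=
    hL.exists_null_add_null (by simp [CoordSpace]) (T.inChart_timelike x₀ hy) hv hTv
  obtain ⟨Q₁, L₁, hQ₁, hL₁, hQk₁, hstep₁⟩ := exists_null_step (T := T) (k := k₁) ⟨hy, hk₁, hT₁⟩
  obtain ⟨Q₂, L₂, hQ₂, hL₂, hQk₂, hstep₂⟩ := exists_null_step (T := T) (k := k₂) ⟨hy, hk₂, hT₂⟩
  have hG : ContDiffAt ℝ 1 (g.inChart x₀) y := (g.contDiffAt_inChart x₀ hy).of_le ENat.LEInfty.out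
  obtain ⟨M₁, hq₁, hM₁⟩ := exists_hasStrictFDerivAt_quadratic hG k₁
  obtain ⟨M₂, hq₂, hM₂⟩ := exists_hasStrictFDerivAt_quadratic hG k₂
  filter_upwards [eventually_exists_two_steps hL.symm hk₁ hk₂ h₁₂.ne hq₁ hq₂ hM₁ hM₂ hk₁ hk₂ hQ₁ hQ₂
    hL₁ hL₂ hQk₁ hQk₂ hstep₁ hstep₂] with p hp hpos
  obtain ⟨m, w₁, w₂, hn₁, h₁, hm, hn₂, h₂, hend⟩ := hp
  have hgeo₁ := h₁ hpos hn₁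
  have hgeo₂ := h₂ hpos hn₂
  simp only [← hm] at hgeo₁
  simp only [← hend] at hgeo₂
  exact hgeo₁.existsLightlikePath.trans hgeo₂.existsLightlikePath

theorem ExistsTimelikeCurve.existsLightlikePath {A B : M} (h : T.ExistsTimelikeCurve A B) :
    T.ExistsLightlikePath A B := by
  obtain ⟨γ, a, b, hab, rfl, rfl, hγ⟩ := existsTimelikeCurve_iff.1 h
  -- The disjunct `t = a` is needed because a lightlike path has at least one segment.
  have hQ : b = a ∨ T.ExistsLightlikePath (γ a) (γ b) := by
    refine interval_propagation (Q := fun t ↦ t = a ∨ T.ExistsLightlikePath (γ a) (γ t)) hab.le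
      (fun t₀ ht₀ ↦ ?_) (Or.inl rfl)
    have hsrc : γ t₀ ∈ (extChartAt (𝓡 4) (γ t₀)).source := mem_extChartAt_source _
    have hc := (hγ t₀ ht₀).1.continuousWithinAt
    obtain ⟨hx, hcone⟩ := (isFutureAt_iff hc hsrc (uniqueDiffOn_Icc hab t₀ ht₀)).1 (hγ t₀ ht₀)
    have hs : ∀ᶠ t in 𝓝 t₀, t ∈ Icc a b → γ t ∈ (extChartAt (𝓡 4) (γ t₀)).source :=
      eventually_nhdsWithin_iff.1 (hc.eventually ((isOpen_extChartAt_source _).mem_nhds hsrc))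
    have hs₁ : ∀ᶠ p : ℝ × ℝ in 𝓝 (t₀, t₀),
        p.1 ∈ Icc a b → γ p.1 ∈ (extChartAt (𝓡 4) (γ t₀)).source :=
      (continuousAt_fst (p := (t₀, t₀))).eventually hs
    have hs₂ : ∀ᶠ p : ℝ × ℝ in 𝓝 (t₀, t₀),
        p.2 ∈ Icc a b → γ p.2 ∈ (extChartAt (𝓡 4) (γ t₀)).source :=
      (continuousAt_snd (p := (t₀, t₀))).eventually hs
    filter_upwards [eventually_slope hab ht₀ hx (eventually_existsLightlikePath_segment hcone),
      hs₁, hs₂] with p hp hp₁ hp₂ h1 h2 hle hQ1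
    rcases hle.eq_or_lt with heq | hlt
    · rwa [← heq]
    · have hpath := hp h1 h2 hlt
      simp only [smul_smul, mul_inv_cancel₀ (sub_pos.2 hlt).ne', one_smul, add_sub_cancel,
        (extChartAt (𝓡 4) (γ t₀)).left_inv (hp₁ h1),
        (extChartAt (𝓡 4) (γ t₀)).left_inv (hp₂ h2)] at hpath
      rcases hQ1 with heq | hQ1
      · rw [heq] at hpath
        exact Or.inr hpath
      · exact Or.inr (hQ1.trans hpath)
  exact hQ.resolve_left hab.ne'

end TimeOrientation

end Lightlike

end

theorem theorem1 {M : Type*} [TopologicalSpace M] [T2Space M]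
    [ChartedSpace (EuclideanSpace ℝ (Fin 4)) M] [IsManifold (𝓡 4) ∞ M]
    (g : LorentzMetric M) (T : TimeOrientation g) (A B : M) :
    (T.ExistsLightlikePath A B → T.ExistsTimelikeCurve A B ∨ T.ExistsNullGeodesic A B) ∧
    (T.ExistsTimelikeCurve A B → T.ExistsLightlikePath A B) :=
  ⟨TimeOrientation.existsTimelikeCurve_or_existsNullGeodesic,
    TimeOrientation.ExistsTimelikeCurve.existsLightlikePath⟩
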